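/- **Words.** Fix $q\in\mathbb N$; alphabets are finite sets with $q$ letters. For an infinite word $W\in A^{\mathbb N}$ and a finite word $x$, write $x\sqsubseteq W$ if $x$ is a factor (contiguous subword) of $W$; for finite words (over any alphabet) $x\sqsubseteq_k y$ means that $x$ occurs in $y$ at least $k$ times, overlaps allowed, and $x\sqsubseteq y$ means $x\sqsubseteq_1 y$. A number $C\in\mathbb N$ is a *recurrence bound* of $W$ if for every $N$ the least $m=P_2(N)$ such that every factor of $W$ of length $m$ contains all factors of $W$ of length $N$ exists and satisfies $P_2(N)\le CN$. **Rauzy schemes.** A *graph with words* over $A$ is a finite strongly connected directed graph (loops and multiple edges allowed) with two words of $A^*$, the front word $F(e)$ and the back word $B(e)$, on each edge $e$, such that every vertex is either *distributing* (in-degree $1$, out-degree $>1$) or *collecting* (in-degree $>1$, out-degree $1$). Paths are nonempty sequences of consecutive edges; a path is *symmetric* if it starts in a collecting and ends in a distributing vertex. For a path $s=e_1\dots e_n$, $F(s)$ is the concatenation, in order, of the front words of $e_1$ and of those $e_i$ with $i>1$ that leave distributing vertices; $B(s)$ is the concatenation, in order, of the back words of those $e_i$ with $i<n$ that enter collecting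 vertices, and of $e_n$. A graph with words is a *Rauzy scheme* of $W$ if (1) it has more than one edge; (2) the front words of the edges leaving one distributing vertex have pairwise different first letters, and the back words of the edges entering one collecting vertex have pairwise different last letters (in particular these words are nonempty); (3) $F(s)=B(s)$ for every symmetric path $s$; (4) if $s_1,s_2$ are symmetric paths and $F(s_1)\sqsubseteq_k F(s_2)$, then $s_1\sqsubseteq_k s_2$ as sequences of edges; (5) all words on edges are factors of $W$; (6) every factor of $W$ is contained in $F(s)$ for some symmetric path $s$; (7) for every edge $e$ there is a factor $u_e$ of $W$ such that every symmetric path $s$ with $u_e\sqsubseteq F(s)$ passes through $e$. **Evolution.** An edge $v$ of a scheme $S$ is *supporting* if it goes from a collecting to a distributing vertex. Let $x_i$ be the edges entering the beginning of $v$ and $y_j$ those leaving its end (an edge may be both), $X_i=B(x_i)$, $V=F(v)$, $Y_j=F(y_j)$. Let $S'$ be obtained from $S$ by replacing $v$ with a complete bipartite graph: the beginning of $v$ becomes vertices $A_i$, with $x_i$ entering $A_i$; the end of $v$ becomes vertices $B_j$, with $y_j$ leaving $B_j$; and there are edges $v_{ij}$ from $A_i$ to $B_j$. In $S'$ the front word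 of $y_j$ is $VY_j$, the front word of $v_{ij}$ is $Y_j$, the back word of $x_i$ is $X_iV$, the back word of $v_{ij}$ is $X_i$, and all other words are unchanged. The edge $v_{ij}$ is *bad* if $X_iVY_j\not\sqsubseteq W$; all other edges of $S'$ are *good*. The vertices of $S''$ are the distributing vertices of $S'$ that more than one good edge leaves and the collecting vertices of $S'$ that more than one good edge enters; the edges of $S''$ are the paths of good edges in $S'$ joining such vertices with no such vertex in between. If there is no such vertex (the good edges form a cycle), the evolution *reveals periodicity* and stops. Otherwise, the front word of an edge $e$ of $S''$ is the front word, in $S'$, of the shortest path of $S''$ that begins with $e$ and ends in a distributing vertex, and its back word is the back word, in $S'$, of the shortest path of $S''$ that ends with $e$ and starts in a collecting vertex. A *numbered scheme* is a scheme with pairwise distinct natural numbers on its edges; erasing the words gives a *lightened numbered scheme* (considered up to isomorphism). A *method of evolution* assigns to every finite directed graph whose edges carry pairwise distinct labels, each a number or a pair of numbers, a new numbering of its edges by $1,\dots,n$, each used once. Given such a method, one step $S\mapsto\mathrm{Evol}(S)$ of the *deterministic evolution* of a numbered scheme takes the supporting edge $v$ with the least number, forms $S''$ (if periodicity is not revealed),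 labels each edge of $S''$ with the label in $S'$ of the first edge of its path, where $v_{ij}$ is labelled with the pair of numbers of $x_i$ and $y_j$ and other edges keep their numbers, and then renumbers by the method. A lightened numbered scheme *arises in a deterministic evolution of $W$* if it is that of a Rauzy scheme of $W$ numbered by $1,\dots,n$, or of a scheme obtained by one or more steps from a numbered Rauzy scheme of $W$. **Statement.** For every $q$ the following hold. 1. There is a computable function $C_7:\mathbb N\to\mathbb N$ such that, if $C_{rec}$ is a recurrence bound of an infinite word $W$ over an alphabet of $q$ letters and $S$ is a Rauzy scheme of $W$, then $S$ has at most $C_7(C_{rec})$ vertices. 2. There is a computable function $C_{sch}:\mathbb N\to\mathbb N$ such that, for every method of evolution and every $C_{rec}\in\mathbb N$, the set of all lightened numbered schemes that arise in deterministic evolutions of infinite words over alphabets of $q$ letters with recurrence bound $C_{rec}$ is finite and has at most $C_{sch}(C_{rec})$ elements. -/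

import Mathlib

universe u w

/-! ### Words, infinite words, recurrence -/

/-- The finite word `W i, W (i+1), …, W (i+n-1)`. -/
def block {A : Type w} (W : ℕ → A) (i n : ℕ) : List A :=
  (List.range n).map fun j => W (i + j)

/-- `x` is a finite factor (subword) of the infinite word `W`. -/
def IsFactor {A : Type w} (W : ℕ → A) (x : List A) : Prop :=
  ∃ i n, x = block W i n

/-- The number of (possibly overlapping) occurrences of the finite word `x` in the finite
word `y`. -/
noncomputable def occCount {B : Type w} (x y : List B) : ℕ :=
  Set.ncard {i : ℕ | ∃ p r : List B, p.length = i ∧ y = p ++ x ++ r}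

/-- `x` occurs in `y` at least `k` times. -/
def OccursAtLeast {B : Type w} (k : ℕ) (x y : List B) : Prop :=
  k ≤ occCount x y

/-- `C` bounds the recurrence function of `W` linearly: for every `N`, the least `m` such that every
factor of `W` of length `m` contains all factors of `W` of length `N` exists and is at most
`C * N`. -/
def IsRecurrenceBound {A : Type w} (W : ℕ → A) (C : ℕ) : Prop :=
  ∀ N : ℕ, ∃ m ≤ C * N, ∀ y : List A, IsFactor W y → y.length = m →
    ∀ x : List A, IsFactor W x → x.length = N → x <:+: y

/-! ### Directed graphs and their paths -/

/-- A directed graph; loops and multiple edges are allowed. -/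
structure DirGraph where
  V : Type u
  E : Type u
  src : E → V
  tgt : E → V

namespace DirGraph

variable (G : DirGraph.{u})

/-- Exactly one incoming edge and more than one outgoing edge. -/
def IsDistributing (x : G.V) : Prop :=
  (∃! e, G.tgt e = x) ∧ ∃ e f, e ≠ f ∧ G.src e = x ∧ G.src f = x

/-- More than one incoming edge and exactly one outgoing edge. -/
def IsCollecting (x : G.V) : Prop :=
  (∃ e f, e ≠ f ∧ G.tgt e = x ∧ G.tgt f = x) ∧ ∃! e, G.src e = x

def StronglyConnected : Prop :=
  ∀ x y : G.V, Relation.ReflTransGen (fun a b => ∃ e, G.src e = a ∧ G.tgt e = b) x y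

/-- A path, given by its (nonempty) sequence of edges. -/
def IsPath (p : List G.E) : Prop :=
  p ≠ [] ∧ p.IsChain fun e f => G.tgt e = G.src f

/-- The first edge of `p` leaves a vertex with property `P`. -/
def StartsIn (P : G.V → Prop) (p : List G.E) : Prop :=
  ∃ e, p.head? = some e ∧ P (G.src e)

/-- The last edge of `p` enters a vertex with property `P`. -/
def EndsIn (P : G.V → Prop) (p : List G.E) : Prop :=
  ∃ e, p.getLast? = some e ∧ P (G.tgt e)

/-- A symmetric path: from a collecting vertex to a distributing vertex. -/
def IsSymmetric (p : List G.E) : Prop :=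
  G.IsPath p ∧ G.StartsIn G.IsCollecting p ∧ G.EndsIn G.IsDistributing p

/-- A supporting edge: an edge from a collecting vertex to a distributing vertex. -/
def IsSupporting (v : G.E) : Prop :=
  G.IsCollecting (G.src v) ∧ G.IsDistributing (G.tgt v)

/-- `p` is a shortest path that begins with `s` and ends in a distributing vertex. -/
def IsRightExtension (s p : List G.E) : Prop :=
  (G.IsPath p ∧ s <+: p ∧ G.EndsIn G.IsDistributing p) ∧
    ∀ p', G.IsPath p' → s <+: p' → G.EndsIn G.IsDistributing p' → p.length ≤ p'.length

/-- `p` is a shortest path that ends with `s` and starts in a collecting vertex. -/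
def IsLeftExtension (s p : List G.E) : Prop :=
  (G.IsPath p ∧ s <:+ p ∧ G.StartsIn G.IsCollecting p) ∧
    ∀ p', G.IsPath p' → s <:+ p' → G.StartsIn G.IsCollecting p' → p.length ≤ p'.length

open scoped Classical in
/-- The natural extension of `s` to the right (it exists and is unique in a strongly connected
graph all of whose vertices are distributing or collecting). -/
noncomputable def rightExtension (s : List G.E) : List G.E :=
  if h : ∃ p, G.IsRightExtension s p then h.choose else s

open scoped Classical in
/-- The natural extension of `s` to the left. -/
noncomputable def leftExtension (s : List G.E) : List G.E :=
  if h : ∃ p, G.IsLeftExtension s p then h.choose else s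

end DirGraph

/-! ### Graphs with words and Rauzy schemes -/

/-- A directed graph with two words, the front word and the back word, on every edge. -/
structure WordGraph (A : Type w) extends DirGraph.{u} where
  front : E → List A
  back : E → List A

namespace WordGraph

variable {A : Type w} (S : WordGraph.{u, w} A)

open scoped Classical in
/-- The front word of a path: the front words of the first edge and of those later edges that
leave distributing vertices are concatenated in order. -/
noncomputable def frontWord : List S.E → List A
  | [] => []
  | e :: p => S.front e ++ (p.filter fun f => S.IsDistributing (S.src f)).flatMap S.front

open scoped Classical in
/-- The back word of a path: the back words of those edges before the last one that enter
collecting vertices, and of the last edge, are concatenated in order. -/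
noncomputable def backWord (p : List S.E) : List A :=
  (p.dropLast.filter fun f => S.IsCollecting (S.tgt f)).flatMap S.back ++
    p.getLast?.toList.flatMap S.back

/-- The conditions on the underlying graph: it is finite and strongly connected, and every vertex
is distributing or collecting. -/
structure IsGraphWithWords : Prop where
  finite_V : Finite S.V
  finite_E : Finite S.E
  stronglyConnected : S.StronglyConnected
  vertex : ∀ x : S.V, S.IsDistributing x ∨ S.IsCollecting x

/-- `S` is a Rauzy scheme of the infinite word `W`. -/
structure IsRauzyScheme (W : ℕ → A) : Prop extends S.IsGraphWithWords where
  nontrivial_E : Nontrivial S.E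
  front_letters : ∀ e, S.IsDistributing (S.src e) → S.front e ≠ [] ∧
    ∀ f, S.src f = S.src e → f ≠ e → (S.front f).head? ≠ (S.front e).head?
  back_letters : ∀ e, S.IsCollecting (S.tgt e) → S.back e ≠ [] ∧
    ∀ f, S.tgt f = S.tgt e → f ≠ e → (S.back f).getLast? ≠ (S.back e).getLast?
  front_eq_back : ∀ p, S.IsSymmetric p → S.frontWord p = S.backWord p
  occurs : ∀ p₁ p₂, S.IsSymmetric p₁ → S.IsSymmetric p₂ → ∀ k,
    OccursAtLeast k (S.frontWord p₁) (S.frontWord p₂) → OccursAtLeast k p₁ p₂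
  front_factor : ∀ e, IsFactor W (S.front e)
  back_factor : ∀ e, IsFactor W (S.back e)
  covers : ∀ x, IsFactor W x → ∃ p, S.IsSymmetric p ∧ x <:+: S.frontWord p
  forces : ∀ e, ∃ x, IsFactor W x ∧ ∀ p, S.IsSymmetric p → x <:+: S.frontWord p → e ∈ p

/-! ### Elementary evolution -/

section Evolution

variable (W : ℕ → A) (v : S.E) (hv : S.IsSupporting v)

/-- The edges `xᵢ` that enter the beginning of `v`. -/
abbrev InEdge : Type u := {e : S.E // S.tgt e = S.src v}

/-- The edges `yⱼ` that leave the end of `v`. -/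
abbrev OutEdge : Type u := {e : S.E // S.src e = S.tgt v}

open scoped Classical in
/-- The graph `S'`: the edge `v` is replaced by a complete bipartite graph. The beginning of `v` is
replaced by vertices `Aᵢ`, one for each `xᵢ`, the end of `v` by vertices `Bⱼ`, one for each `yⱼ`,
the edge `xᵢ` now enters `Aᵢ`, the edge `yⱼ` now leaves `Bⱼ`, and `v` itself is replaced by edges
`vᵢⱼ` from `Aᵢ` to `Bⱼ`. -/
noncomputable def split : WordGraph.{u, w} A where
  V := {x : S.V // x ≠ S.src v ∧ x ≠ S.tgt v} ⊕ (S.InEdge v ⊕ S.OutEdge v)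
  E := {e : S.E // e ≠ v} ⊕ (S.InEdge v × S.OutEdge v)
  src
    | .inl e =>
      if h : S.src e.1 = S.tgt v then .inr (.inr ⟨e.1, h⟩)
      else .inl ⟨S.src e.1, fun h' => e.2 (hv.1.2.unique h' rfl), h⟩
    | .inr (x, _) => .inr (.inl x)
  tgt
    | .inl e =>
      if h : S.tgt e.1 = S.src v then .inr (.inl ⟨e.1, h⟩)
      else .inl ⟨S.tgt e.1, h, fun h' => e.2 (hv.2.1.unique h' rfl)⟩
    | .inr (_, y) => .inr (.inr y)
  front
    | .inl e => if S.src e.1 = S.tgt v then S.front v ++ S.front e.1 else S.front e.1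
    | .inr (_, y) => S.front y.1
  back
    | .inl e => if S.tgt e.1 = S.src v then S.back e.1 ++ S.front v else S.back e.1
    | .inr (x, _) => S.back x.1

/-- The pair `(xᵢ, yⱼ)` is good if `Xᵢ V Yⱼ` is a factor of `W`; the edge `vᵢⱼ` is good if its pair
is, and all the other edges of `S'` are good. -/
def IsGood : (S.split v hv).E → Prop
  | .inl _ => True
  | .inr (x, y) => IsFactor W (S.back x.1 ++ S.front v ++ S.front y.1)

/-- The non-vanishing vertices of `S'`: the distributing vertices that more than one good edge
leaves and the collecting vertices that more than one good edge enters. -/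
def NonVanishing (z : (S.split v hv).V) : Prop :=
  ((S.split v hv).IsDistributing z ∧ ∃ e f, e ≠ f ∧ S.IsGood W v hv e ∧ S.IsGood W v hv f ∧
      (S.split v hv).src e = z ∧ (S.split v hv).src f = z) ∨
  ((S.split v hv).IsCollecting z ∧ ∃ e f, e ≠ f ∧ S.IsGood W v hv e ∧ S.IsGood W v hv f ∧
      (S.split v hv).tgt e = z ∧ (S.split v hv).tgt f = z)

/-- The paths of `S'` that become the edges of `S''`: all their edges are good, both ends are
non-vanishing, and no intermediate vertex is. -/
def IsEvolvedEdge (p : List (S.split v hv).E) : Prop :=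
  ∃ hp : (S.split v hv).IsPath p, (∀ e ∈ p, S.IsGood W v hv e) ∧
    S.NonVanishing W v hv ((S.split v hv).src (p.head hp.1)) ∧
    S.NonVanishing W v hv ((S.split v hv).tgt (p.getLast hp.1)) ∧
    ∀ e ∈ p.dropLast, ¬ S.NonVanishing W v hv ((S.split v hv).tgt e)

/-- The underlying graph of `S''`. -/
noncomputable def evolvedGraph : DirGraph.{u} where
  V := {z : (S.split v hv).V // S.NonVanishing W v hv z}
  E := {p : List (S.split v hv).E // S.IsEvolvedEdge W v hv p}
  src p := ⟨(S.split v hv).src (p.1.head p.2.choose.1), p.2.choose_spec.2.1⟩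
  tgt p := ⟨(S.split v hv).tgt (p.1.getLast p.2.choose.1), p.2.choose_spec.2.2.1⟩

/-- The path in `S'` that corresponds to a path in `S''`. -/
noncomputable def expand (p : List (S.evolvedGraph W v hv).E) : List (S.split v hv).E :=
  p.flatMap fun e => e.1

/-- The elementary evolution `S''` of `S` along the supporting edge `v`: the front (back) word of an
edge is the front (back) word, in `S'`, of its natural extension to the right (left). -/
noncomputable def evolved : WordGraph.{u, w} A where
  toDirGraph := S.evolvedGraph W v hv
  front e := (S.split v hv).frontWord
    (S.expand W v hv ((S.evolvedGraph W v hv).rightExtension [e]))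
  back e := (S.split v hv).backWord
    (S.expand W v hv ((S.evolvedGraph W v hv).leftExtension [e]))

/-- The good edges of `S'` form a cycle, so that no vertex is left in `S''`: the elementary
evolution reveals that `W` is periodic. -/
def RevealsPeriodicity : Prop :=
  IsEmpty (S.evolvedGraph W v hv).V

end Evolution

end WordGraph

/-! ### Numbered schemes and deterministic evolution -/

/-- A directed graph with labels from `L` on its edges. For `L = ℕ` and pairwise distinct labels, a
lightened numbered scheme; for `L = ℕ ⊕ ℕ × ℕ`, one where double indices are allowed as well. -/
structure LabelledGraph (L : Type) extends DirGraph.{u} where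
  num : E → L

namespace LabelledGraph

/-- Isomorphism of labelled graphs. -/
def Iso {L : Type} (G H : LabelledGraph.{u} L) : Prop :=
  ∃ (f : G.V ≃ H.V) (g : G.E ≃ H.E), ∀ e, H.src (g e) = f (G.src e) ∧
    H.tgt (g e) = f (G.tgt e) ∧ H.num (g e) = G.num e

instance isoSetoid (L : Type) : Setoid (LabelledGraph.{u} L) where
  r := Iso
  iseqv :=
    { refl := fun _ => ⟨Equiv.refl _, Equiv.refl _, fun _ => ⟨rfl, rfl, rfl⟩⟩
      symm := by
        rintro G H ⟨f, g, h⟩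
        refine ⟨f.symm, g.symm, fun e => ?_⟩
        have := h (g.symm e)
        simp only [Equiv.apply_symm_apply] at this
        exact ⟨by rw [this.1, Equiv.symm_apply_apply], by rw [this.2.1, Equiv.symm_apply_apply],
          this.2.2.symm⟩
      trans := by
        rintro G H K ⟨f, g, h⟩ ⟨f', g', h'⟩
        refine ⟨f.trans f', g.trans g', fun e => ?_⟩
        simp only [Equiv.trans_apply]
        exact ⟨by rw [(h' _).1, (h _).1], by rw [(h' _).2.1, (h _).2.1],
          by rw [(h' _).2.2, (h _).2.2]⟩ }

end LabelledGraph

/-- The numbers on the edges are `1, …, n`, each used exactly once. -/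
def IsInitialNumbering {E : Type u} (num : E → ℕ) : Prop :=
  Set.BijOn num Set.univ (Set.Icc 1 (Nat.card E))

/-- A method of evolution: it gives every finite graph with pairwise distinct labels (numbers or
double indices) on its edges a new numbering of the edges by `1, …, n`. -/
structure EvolutionMethod where
  renumber : ∀ H : LabelledGraph.{u} (ℕ ⊕ ℕ × ℕ), H.E → ℕ
  isInitial : ∀ H : LabelledGraph.{u} (ℕ ⊕ ℕ × ℕ), Finite H.V → Finite H.E →
    Function.Injective H.num → IsInitialNumbering (renumber H)

/-- A graph with words and with a number on every edge. -/
structure NumberedScheme (A : Type w) extends WordGraph.{u, w} A where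
  num : E → ℕ

namespace NumberedScheme

variable {A : Type w}

/-- The lightened numbered scheme: the words are erased, the numbers are kept. -/
def lighten (S : NumberedScheme.{u, w} A) : LabelledGraph.{u} ℕ where
  toDirGraph := S.toDirGraph
  num := S.num

/-- The numbering of `S'`: the edge `vᵢⱼ` gets the numbers of `xᵢ` and `yⱼ` as a double index, the
other edges keep their numbers. -/
def splitNum (S : NumberedScheme.{u, w} A) (v : S.E) (hv : S.IsSupporting v) :
    (S.split v hv).E → ℕ ⊕ ℕ × ℕ
  | .inl e => .inl (S.num e.1)
  | .inr (x, y) => .inr (S.num x.1, S.num y.1)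

/-- The graph `S''` without words; an edge carries the number of the first edge of its path in
`S'`. -/
noncomputable def evolvedLabelled (S : NumberedScheme.{u, w} A) (W : ℕ → A) (v : S.E) (hv : S.IsSupporting v) :
    LabelledGraph.{u} (ℕ ⊕ ℕ × ℕ) where
  toDirGraph := S.evolvedGraph W v hv
  num p := S.splitNum v hv (p.1.head p.2.choose.1)

/-- One step of the deterministic evolution, `T = Evol(S)`: the elementary evolution along the
supporting edge with the least number does not reveal periodicity, and its result, renumbered by the
method of evolution, is `T`. -/
def EvolStep (W : ℕ → A) (M : EvolutionMethod.{u}) (S T : NumberedScheme.{u, w} A) : Prop :=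
  ∃ (v : S.E) (hv : S.IsSupporting v), (∀ v', S.IsSupporting v' → S.num v ≤ S.num v') ∧
    ¬ S.RevealsPeriodicity W v hv ∧
    T = { toWordGraph := S.evolved W v hv
          num := M.renumber (S.evolvedLabelled W v hv) }

/-- `T` arises in a deterministic evolution of `W`: it is a Rauzy scheme of `W` numbered by
`1, …, n` (the beginning of an evolution), or it is obtained by one or more steps from a Rauzy scheme
of `W` whose edges carry pairwise distinct numbers. -/
def Arises (W : ℕ → A) (M : EvolutionMethod.{u}) (T : NumberedScheme.{u, w} A) : Prop :=
  (T.IsRauzyScheme W ∧ IsInitialNumbering T.num) ∨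
  ∃ S : NumberedScheme.{u, w} A, S.IsRauzyScheme W ∧ Function.Injective S.num ∧
    Relation.TransGen (EvolStep W M) S T

end NumberedScheme

/-- The lightened numbered schemes, up to isomorphism, that arise in deterministic evolutions of the
infinite words over alphabets of `q` letters whose recurrence function is bounded linearly by
`C`. -/
def arisingLightSchemes (q C : ℕ) (M : EvolutionMethod.{u}) :
    Set (Quotient (LabelledGraph.isoSetoid.{u} ℕ)) :=
  {X | ∃ (A : Type w) (_ : Finite A) (W : ℕ → A) (T : NumberedScheme.{u, w} A),
    Nat.card A = q ∧ IsRecurrenceBound W C ∧ T.Arises W M ∧ X = Quotient.mk _ T.lighten}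

/-!
# Rauzy schemes of linearly recurrent words and their evolution

The scheme axioms make reading words along symmetric paths faithful: for symmetric paths `t` and `s`
the occurrences of `F(t)` in `F(s)` are exactly those that come from the occurrences of `t` in `s`
(`WordGraph.IsRauzyScheme.exists_of_frontWord_eq`). Indeed the latter inject into the former, and the
axiom that compares numbers of occurrences says that there are as many. Since every factor of a
recurrent word `W` occurs arbitrarily far to the right, it follows that symmetric paths whose words
are factors of `W` can be joined by paths that read any given factor in between
(`WordGraph.IsRauzyScheme.exists_link`).

**The number of vertices.** Let `v` be a supporting edge whose word has the least length `n`. Every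
other edge lies on a path that returns to `v`. The word of such a path meets `F(v)` only at its two
ends, so linear recurrence bounds its length by `C * n + 1`. For a distributing vertex `x` take the
shortest symmetric path that ends in `x`. Its first edge is a supporting one, so its word has length
at least `n`; the word is part of the word of a return path, so its length is at most `C * n + 1`; it
is right special, because the edges leaving `x` begin with different letters; and the words of
different vertices are not suffixes of one another, by faithfulness. A linearly recurrent word has
at most `(8 * C ^ 4 + 1) ^ 2` right special factors of this kind
(`IsRecurrenceBound.card_special_le`): each of them contains the prefix of `W` of length `n / C`, the
occurrences of that prefix in a fixed long factor of `W` are far apart, unless `W` is periodic and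
has no long special factors, and a special word is determined up to suffixes by two of these
occurrences. Counting the edges at their two ends then bounds the collecting vertices and the edges
(`WordGraph.IsRauzyScheme.card_le`).

**Evolution.** The elementary evolution of a Rauzy scheme of `W` is a Rauzy scheme of `W`, unless it
reveals periodicity (`WordGraph.IsRauzyScheme.evolved_isRauzyScheme`). A symmetric path of the
evolved graph `S''` is a path of the split graph `S'`, and that one comes from a symmetric path of
`S`; all three have the same words. In both steps the word of an edge is moved to an edge nearby, so
that along a path the changes cancel (`List.IsChain.flatMap_telescope`). Occurrences of paths
correspond as well, because a path of `S'` is recovered from its image in `S`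
(`WordGraph.exists_of_unsplit`), and a path of `S''` from the edges of its expansion that leave
non-vanishing vertices (`WordGraph.IsRauzyScheme.occCount_expansion_le`). Conversely, a path of `S`
whose word is a factor of `W` lifts to a path of good edges (`WordGraph.exists_lift`); this gives the
connectedness of `S''` and the axioms on the factors of `W`.

**Counting.** Hence everything that arises in a deterministic evolution is a Rauzy scheme whose edges
are numbered by `1, …, n` and whose size is bounded in terms of `q` and `C`. Up to isomorphism a
numbered graph is the set of the triples (number, beginning, end) of its edges, so there are finitely
many of them, with a bound that is primitive recursive in `C` (`LabelledGraph.ncard_le`).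
-/

/-! ### Factors of infinite words -/

section Words

variable {A : Type w} {W : ℕ → A}

@[simp] lemma length_block (W : ℕ → A) (i n : ℕ) : (block W i n).length = n := by
  simp [block]

lemma block_add (W : ℕ → A) (i m n : ℕ) :
    block W i (m + n) = block W i m ++ block W (i + m) n := by
  simp [block, List.range_add, Function.comp_def, add_assoc]

lemma isFactor_block (W : ℕ → A) (i n : ℕ) : IsFactor W (block W i n) := ⟨i, n, rfl⟩

lemma block_eq_iff {i j n : ℕ} : block W i n = block W j n ↔ ∀ k < n, W (i + k) = W (j + k) := by
  simp [block]

lemma block_eq_append {x y : List A} {i n : ℕ} (h : block W i n = x ++ y) :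
    x = block W i x.length ∧ y = block W (i + x.length) y.length := by
  have hn : n = x.length + y.length := by simpa using congrArg List.length h
  rw [hn, block_add] at h
  have := List.append_inj h (by simp)
  exact ⟨this.1.symm, this.2.symm⟩

lemma block_eq_append₃ {x y z : List A} {i n : ℕ} (h : block W i n = x ++ y ++ z) :
    y = block W (i + x.length) y.length := by
  rw [List.append_assoc] at h
  exact (block_eq_append (block_eq_append h).2.symm).1

lemma IsFactor.of_infix {x y : List A} (hy : IsFactor W y) (h : x <:+: y) : IsFactor W x := by
  obtain ⟨i, n, rfl⟩ := hy
  obtain ⟨a, b, h⟩ := h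
  exact ⟨_, _, block_eq_append₃ h.symm⟩

/-- Every factor of `W` occurs in `W` arbitrarily far to the right. -/
def IsRecurrentWord (W : ℕ → A) : Prop :=
  ∀ x, IsFactor W x → ∀ N, ∃ i, N ≤ i ∧ x = block W i x.length

lemma IsRecurrenceBound.isRecurrentWord {C : ℕ} (h : IsRecurrenceBound W C) :
    IsRecurrentWord W := by
  intro x hx N
  obtain ⟨m, -, hm⟩ := h x.length
  obtain ⟨a, b, hab⟩ := hm (block W N m) (isFactor_block _ _ _) (by simp) x hx rfl
  exact ⟨_, Nat.le_add_right _ _, block_eq_append₃ hab.symm⟩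

lemma IsRecurrenceBound.pos {C : ℕ} (h : IsRecurrenceBound W C) : 0 < C := by
  rcases Nat.eq_zero_or_pos C with rfl | h0
  · obtain ⟨m, hm, h⟩ := h 1
    have := (h (block W 0 m) (isFactor_block _ _ _) (by simp) (block W 0 1)
      (isFactor_block _ _ _) (by simp)).length_le
    simp at this
    omega
  · exact h0

/-- A factor of length at least `C * N` contains every factor of length `N`. -/
lemma IsRecurrenceBound.infix {C : ℕ} (h : IsRecurrenceBound W C) {x y : List A}
    (hx : IsFactor W x) (hy : IsFactor W y) (hxy : C * x.length ≤ y.length) : x <:+: y := by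
  obtain ⟨m, hm, h⟩ := h x.length
  have hpre : y.take m <+: y := List.take_prefix _ _
  exact (h _ (hy.of_infix hpre.isInfix) (by rw [List.length_take]; omega) x hx rfl).trans
    hpre.isInfix

/-- In a recurrent word three factors occur one after the other, with nonempty gaps. -/
lemma IsRecurrentWord.exists_link (h : IsRecurrentWord W) {x y z : List A} (hx : IsFactor W x)
    (hy : IsFactor W y) (hz : IsFactor W z) :
    ∃ a b, a ≠ [] ∧ b ≠ [] ∧ IsFactor W (x ++ a ++ y ++ b ++ z) := by
  obtain ⟨i, -, hi⟩ := h x hx 0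
  obtain ⟨j, hj, hj'⟩ := h y hy (i + x.length + 1)
  obtain ⟨k, hk, hk'⟩ := h z hz (j + y.length + 1)
  refine ⟨block W (i + x.length) (j - (i + x.length)),
    block W (j + y.length) (k - (j + y.length)), ?_, ?_, i,
    x.length + (j - (i + x.length)) + y.length + (k - (j + y.length)) + z.length, ?_⟩
  · rw [← List.length_pos_iff]; simp; omega
  · rw [← List.length_pos_iff]; simp; omega
  · rw [block_add, block_add, block_add, block_add, ← hi]
    congr 1
    · congr 1
      · congr 1
        convert hj' using 2
        omega
      · congr 1
        omega
    · convert hk' using 2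
      omega

end Words

/-! ### Counting special factors of a linearly recurrent word -/

section Special

variable {A : Type w} {W : ℕ → A} {C : ℕ}

/-- A word with a long right special factor is not locally periodic: two occurrences of the same
factor of length `n` are at distance at least `(n + 1) / (2 * C)`. Otherwise that factor has a small
period and contains all short factors, so `W` itself is periodic. -/
lemma IsRecurrenceBound.gap (h : IsRecurrenceBound W C) {n i j : ℕ} {z : List A} {a b : A}
    (hab : a ≠ b) (ha : IsFactor W (z ++ [a])) (hb : IsFactor W (z ++ [b])) (hz : n ≤ z.length)
    (hij : i < j) (heq : block W i n = block W j n) : n + 1 ≤ 2 * C * (j - i) := by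
  by_contra hlt
  obtain ⟨p', hp', rfl⟩ : ∃ p', 0 < p' ∧ j = i + p' := ⟨j - i, by omega, by omega⟩
  have hC := h.pos
  rw [Nat.add_sub_cancel_left] at hlt
  have hCp : C * (p' + 1) ≤ n := by nlinarith
  have hpn : p' < n := by nlinarith
  have hper : ∀ k, W (k + p') = W k := by
    intro k
    obtain ⟨u, t, hut⟩ := h.infix (isFactor_block W k (p' + 1)) (isFactor_block W (i + p') n)
      (by simpa using hCp)
    have h1 := block_eq_append₃ hut.symm
    have hlen := congrArg List.length hut
    simp only [List.length_append, length_block] at hlen h1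
    rw [block_eq_iff] at h1 heq
    have h2 := h1 0 (by omega)
    have h3 := h1 p' (by omega)
    have h4 := heq (u.length + p') (by omega)
    rw [add_zero] at h2
    rw [h2, h3, show i + p' + u.length + p' = i + p' + (u.length + p') by ring, ← h4, add_zero]
    congr 1
    omega
  have key : ∀ c, IsFactor W (z ++ [c]) → z[z.length - p']? = some c := by
    rintro c ⟨l, m, hl⟩
    have hm : m = z.length + 1 := by simpa using (congrArg List.length hl).symm
    have h1 : (z ++ [c])[z.length]? = some c := by simp
    have h2 : (z ++ [c])[z.length - p']? = z[z.length - p']? :=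
      List.getElem?_append_left (by omega)
    rw [← h2]
    rw [hl] at h1 ⊢
    rw [← h1]
    simp only [block, List.getElem?_map]
    rw [List.getElem?_range (by omega), List.getElem?_range (by omega)]
    simp only [Option.map_some, Option.some.injEq]
    rw [← hper]
    congr 1
    omega
  exact hab (Option.some.inj ((key a ha).symm.trans (key b hb)))

/-- A linearly recurrent word has boundedly many right special factors of lengths between `n` and
`C * n + 1` none of which is a suffix of another. All of them contain one fixed factor `V` of length
`n / C`. A special word is determined, up to passing to a suffix, by two positions of `V` in a
fixed long factor of `W`: those of an occurrence of `V` inside it, for two different right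
extensions. The number of positions of `V` is bounded because their distances are bounded below. -/
theorem IsRecurrenceBound.card_special_le (h : IsRecurrenceBound W C) (n : ℕ) {ι : Type*} [Finite ι]
    (z : ι → List A) (hlen : ∀ i, n ≤ (z i).length ∧ (z i).length ≤ C * n + 1)
    (hsp : ∀ i, ∃ a b, a ≠ b ∧ IsFactor W (z i ++ [a]) ∧ IsFactor W (z i ++ [b]))
    (hsuf : ∀ i j, z i <:+ z j → i = j) : Nat.card ι ≤ (8 * C ^ 4 + 1) ^ 2 := by
  have hC := h.pos
  -- `m = n / C` is the length of `V = block W 0 m`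
  obtain ⟨m, hmn, hmn', hnm⟩ : ∃ m, C * m ≤ n ∧ m ≤ n ∧ n + 1 ≤ C * (m + 1) :=
    ⟨n / C, Nat.mul_div_le n C, Nat.div_le_self _ _, Nat.lt_mul_div_succ n hC⟩
  set l := C * n + 2 with hl
  have hlm : l ≤ 2 * C ^ 2 * (m + 1) := by
    have h1 : C * (n + 1) ≤ C * (C * (m + 1)) := Nat.mul_le_mul_left _ hnm
    nlinarith
  -- every extension of a special word is found near the beginning of `W`, around an
  -- occurrence `c` of `V`
  have centre : ∀ (x y : List A) (a : A), x.length + m + y.length ≤ C * n + 1 →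
      IsFactor W (x ++ block W 0 m ++ y ++ [a]) → ∃ c, l ≤ c ∧ c ≤ l + 2 * C * l ∧
        block W c m = block W 0 m ∧ x ++ block W 0 m ++ y ++ [a] =
          block W (c - x.length) (x.length + m + y.length + 1) := by
    intro x y a hxy hf
    obtain ⟨i, hi, hi'⟩ := h.isRecurrentWord _ hf (2 * l)
    obtain ⟨u, t, hut⟩ := h.infix (isFactor_block W (i + x.length - l) (2 * l))
      (isFactor_block W 0 (C * (2 * l))) (by simp)
    have h1 := block_eq_append₃ hut.symm
    have h2 := congrArg List.length hut
    simp only [List.length_append, length_block, zero_add] at h1 h2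
    rw [block_eq_iff] at h1
    have h3 : (x ++ block W 0 m ++ y ++ [a]).length = x.length + m + y.length + 1 := by
      simp only [List.length_append, length_block, List.length_singleton]
    rw [h3] at hi'
    have h4 : x ++ block W 0 m ++ y ++ [a] =
        block W (u.length + l - x.length) (x.length + m + y.length + 1) := by
      rw [hi', block_eq_iff]
      intro k hk
      have := h1 (l - x.length + k) (by omega)
      convert this using 2 <;> omega
    refine ⟨u.length + l, by omega, by nlinarith, ?_, h4⟩
    have h5 : block W (u.length + l - x.length) (x.length + m + y.length + 1) =
        x ++ block W 0 m ++ (y ++ [a]) := by rw [← h4]; simp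
    have h6 := block_eq_append₃ h5
    rw [length_block] at h6
    rw [h6]
    congr 1
    omega
  -- `c i` and `d i` are the centres for two right extensions of `z i`, and `o i` is the offset of
  -- `V` in `z i`
  have data : ∀ i, ∃ c d o, (l ≤ c ∧ c ≤ l + 2 * C * l ∧ block W c m = block W 0 m) ∧
      (l ≤ d ∧ d ≤ l + 2 * C * l ∧ block W d m = block W 0 m) ∧ o ≤ (z i).length ∧
      z i = block W (c - o) (z i).length ∧
      z i = block W (d - o) (z i).length ∧ W (c - o + (z i).length) ≠ W (d - o + (z i).length) := by
    intro i
    obtain ⟨a, b, hab, ha, hb⟩ := hsp i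
    obtain ⟨x, y, hxy⟩ := h.infix (isFactor_block W 0 m)
      (ha.of_infix (List.prefix_append _ _).isInfix) (by simpa using hmn.trans (hlen i).1)
    have hz : (z i).length = x.length + m + y.length := by
      simp only [← hxy, List.length_append, length_block]
    rw [← hxy] at ha hb
    have hle := (hlen i).2
    obtain ⟨c, hc1, hc2, hc3, hc4⟩ := centre x y a (by omega) ha
    obtain ⟨d, hd1, hd2, hd3, hd4⟩ := centre x y b (by omega) hb
    rw [hxy, ← hz, block_add] at hc4 hd4
    have hc5 := List.append_inj hc4 (by simp)
    have hd5 := List.append_inj hd4 (by simp)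
    refine ⟨c, d, x.length, ⟨hc1, hc2, hc3⟩, ⟨hd1, hd2, hd3⟩, by omega, hc5.1, hd5.1, ?_⟩
    have h1 := hc5.2
    have h2 := hd5.2
    simp only [block, List.range_one, List.map_cons, add_zero, List.map_nil, List.cons.injEq,
      and_true] at h1 h2
    rwa [← h1, ← h2]
  choose c d o hc hd ho hzc hzd hne using data
  -- the occurrences of `V` are so far apart that rounding their positions to multiples of
  -- `(m + 1) / (2 * C)` does not identify any two of them
  have code : ∀ (i : ι) (x), l ≤ x ∧ x ≤ l + 2 * C * l ∧ block W x m = block W 0 m → ∀ y,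
      l ≤ y ∧ y ≤ l + 2 * C * l ∧ block W y m = block W 0 m → x < y →
      2 * C * (x - l) / (m + 1) ≠ 2 * C * (y - l) / (m + 1) := by
    intro i x hx y hy hxy
    obtain ⟨a, b, hab, ha, hb⟩ := hsp i
    have hg := h.gap hab ha hb (hmn'.trans (hlen i).1) hxy (hx.2.2.trans hy.2.2.symm)
    apply ne_of_lt
    rw [Nat.lt_iff_add_one_le, ← Nat.add_div_right _ (Nat.succ_pos m)]
    apply Nat.div_le_div_right
    have : 2 * C * (y - l) = 2 * C * (x - l) + 2 * C * (y - x) := by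
      rw [← mul_add]; congr 1; omega
    omega
  have codeLt : ∀ x, x ≤ l + 2 * C * l → 2 * C * (x - l) / (m + 1) < 8 * C ^ 4 + 1 := by
    intro x hx
    rw [Nat.lt_succ_iff]
    apply Nat.div_le_of_le_mul
    calc 2 * C * (x - l) ≤ 2 * C * (2 * C * l) := Nat.mul_le_mul_left _ (by omega)
      _ ≤ 2 * C * (2 * C * (2 * C ^ 2 * (m + 1))) := by gcongr
      _ = (m + 1) * (8 * C ^ 4) := by ring
  -- a special word ends where the letters after its two centres cease to agree
  have inj : ∀ i j, c i = c j → d i = d j → o i ≤ o j → z i <:+ z j := by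
    intro i j hcij hdij hoij
    have key : ∀ i j, c i = c j → d i = d j → ¬ (z i).length - o i < (z j).length - o j := by
      intro i j hcij hdij hlt
      have h1 := (hzc j).symm.trans (hzd j)
      rw [block_eq_iff] at h1
      have h2 := h1 (o j + ((z i).length - o i)) (by omega)
      apply hne i
      have := ho i
      have := hlen i
      have := hlen j
      have := ho j
      have := (hc i).1
      have := (hd i).1
      convert h2 using 2 <;> omega
    have h1 := key i j hcij hdij
    have h2 := key j i hcij.symm hdij.symm
    have h3 := ho i
    have h4 := ho j
    have h5 := (hc i).1
    have h6 := (hc j).1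
    have h7 := (hlen j).2
    have h8 : (z j).length = (o j - o i) + (z i).length := by omega
    rw [hzc i, hzc j, h8, block_add]
    have h9 : c i - o i = c j - o j + (o j - o i) := by omega
    rw [h9]
    exact List.suffix_append _ _
  have hinj : Function.Injective fun i =>
      ((⟨2 * C * (c i - l) / (m + 1), codeLt _ (hc i).2.1⟩,
        ⟨2 * C * (d i - l) / (m + 1), codeLt _ (hd i).2.1⟩) :
        Fin (8 * C ^ 4 + 1) × Fin (8 * C ^ 4 + 1)) := by
    intro i j hij
    simp only [Prod.mk.injEq, Fin.mk.injEq] at hij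
    have hcij : c i = c j := by
      rcases lt_trichotomy (c i) (c j) with hlt | heq | hlt
      · exact (code i _ (hc i) _ (hc j) hlt hij.1).elim
      · exact heq
      · exact (code i _ (hc j) _ (hc i) hlt hij.1.symm).elim
    have hdij : d i = d j := by
      rcases lt_trichotomy (d i) (d j) with hlt | heq | hlt
      · exact (code i _ (hd i) _ (hd j) hlt hij.2).elim
      · exact heq
      · exact (code i _ (hd j) _ (hd i) hlt hij.2.symm).elim
    rcases le_total (o i) (o j) with hle | hle
    · exact hsuf _ _ (inj i j hcij hdij hle)
    · exact (hsuf _ _ (inj j i hcij.symm hdij.symm hle)).symm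
  have := Nat.card_le_card_of_injective _ hinj
  simpa [sq] using this

end Special

/-! ### Paths in directed graphs -/

namespace DirGraph

variable {G : DirGraph.{u}}

lemma IsDistributing.in_unique {x : G.V} (h : G.IsDistributing x) {e f : G.E} (he : G.tgt e = x)
    (hf : G.tgt f = x) : e = f := h.1.unique he hf

lemma IsCollecting.out_unique {x : G.V} (h : G.IsCollecting x) {e f : G.E} (he : G.src e = x)
    (hf : G.src f = x) : e = f := h.2.unique he hf

lemma IsCollecting.not_isDistributing {x : G.V} (h : G.IsCollecting x) : ¬ G.IsDistributing x := by
  rintro ⟨-, e, f, hne, he, hf⟩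
  exact hne (h.out_unique he hf)

lemma IsDistributing.not_isCollecting {x : G.V} (h : G.IsDistributing x) : ¬ G.IsCollecting x :=
  fun h' => h'.not_isDistributing h

@[simp] lemma startsIn_cons {P : G.V → Prop} {e : G.E} {p : List G.E} :
    G.StartsIn P (e :: p) ↔ P (G.src e) := by simp [StartsIn]

@[simp] lemma endsIn_concat {P : G.V → Prop} {e : G.E} {p : List G.E} :
    G.EndsIn P (p ++ [e]) ↔ P (G.tgt e) := by simp [EndsIn]

lemma startsIn_append {P : G.V → Prop} {p q : List G.E} (hp : p ≠ []) :
    G.StartsIn P (p ++ q) ↔ G.StartsIn P p := by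
  cases p with
  | nil => exact (hp rfl).elim
  | cons e p => simp

lemma endsIn_append {P : G.V → Prop} {p q : List G.E} (hq : q ≠ []) :
    G.EndsIn P (p ++ q) ↔ G.EndsIn P q := by
  simp [EndsIn, List.getLast?_append_of_ne_nil _ hq]

lemma IsPath.of_infix {p q : List G.E} (h : G.IsPath q) (hpq : p <:+: q) (hp : p ≠ []) :
    G.IsPath p := ⟨hp, h.2.infix hpq⟩

lemma IsPath.tgt_eq_src {p q : List G.E} {e f : G.E} (h : G.IsPath (p ++ e :: f :: q)) :
    G.tgt e = G.src f := by
  have h2 : List.IsChain (fun e f => G.tgt e = G.src f) [e, f] := h.2.infix ⟨p, q, by simp⟩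
  simpa using h2

lemma IsSymmetric.prefix {p t r : List G.E} (h : G.IsSymmetric (p ++ t ++ r))
    (ht : G.IsSymmetric t) : G.IsSymmetric (p ++ t) := by
  have hne : p ++ t ≠ [] := by simp [ht.1.1]
  exact ⟨h.1.of_infix (List.prefix_append _ _).isInfix hne, (startsIn_append hne).1 h.2.1,
    (endsIn_append ht.1.1).2 ht.2.2⟩

lemma IsSymmetric.suffix {p t r : List G.E} (h : G.IsSymmetric (p ++ t ++ r))
    (ht : G.IsSymmetric t) : G.IsSymmetric (t ++ r) := by
  have hne : t ++ r ≠ [] := by simp [ht.1.1]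
  rw [List.append_assoc] at h
  exact ⟨h.1.of_infix (List.suffix_append _ _).isInfix hne, (startsIn_append ht.1.1).2 ht.2.1,
    (endsIn_append hne).1 h.2.2⟩

lemma IsSupporting.isSymmetric {v : G.E} (hv : G.IsSupporting v) : G.IsSymmetric [v] :=
  ⟨⟨by simp, by simp⟩, by simpa using hv.1, by simpa [EndsIn] using hv.2⟩

/-- Every symmetric path passes through a supporting edge. -/
lemma IsSymmetric.exists_isSupporting (hG : ∀ x, G.IsDistributing x ∨ G.IsCollecting x) :
    ∀ {p : List G.E}, G.IsSymmetric p → ∃ v ∈ p, G.IsSupporting v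
  | [], h => (h.1.1 rfl).elim
  | [e], h => ⟨e, by simp, by simpa using h.2.1, by simpa [EndsIn] using h.2.2⟩
  | e :: f :: p, h => by
    have hsrc : G.IsCollecting (G.src e) := by simpa using h.2.1
    have htgt : G.tgt e = G.src f := by
      have := h.1.2
      rw [List.isChain_cons_cons] at this
      exact this.1
    rcases hG (G.tgt e) with hd | hc
    · exact ⟨e, by simp, hsrc, hd⟩
    · obtain ⟨v, hv, hv'⟩ := IsSymmetric.exists_isSupporting hG (p := f :: p)
        ⟨h.1.of_infix (List.suffix_cons e _).isInfix (by simp), by simpa [← htgt] using hc,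
          (endsIn_append (p := [e]) (by simp)).1 h.2.2⟩
      exact ⟨v, List.mem_cons_of_mem _ hv, hv'⟩

/-- The path `k` continues the edge `e` through collecting vertices up to the first distributing
vertex. -/
def IsRightTail (G : DirGraph.{u}) (e : G.E) (k : List G.E) : Prop :=
  G.IsPath (e :: k) ∧ (∀ f ∈ k, G.IsCollecting (G.src f)) ∧ G.EndsIn G.IsDistributing (e :: k)

/-- The path `l` continues the edge `e` backwards through distributing vertices up to the first
collecting vertex. -/
def IsLeftTail (G : DirGraph.{u}) (e : G.E) (l : List G.E) : Prop :=
  G.IsPath (l ++ [e]) ∧ (∀ f ∈ l, G.IsDistributing (G.tgt f)) ∧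
    G.StartsIn G.IsCollecting (l ++ [e])

lemma exists_isRightTail (hG : ∀ x, G.IsDistributing x ∨ G.IsCollecting x)
    (hconn : G.StronglyConnected) {d : G.V} (hd : G.IsDistributing d) (e : G.E) :
    ∃ k, G.IsRightTail e k := by
  suffices H : ∀ x, Relation.ReflTransGen (fun a b => ∃ e, G.src e = a ∧ G.tgt e = b) x d →
      ∀ e, G.tgt e = x → ∃ k, G.IsRightTail e k from H _ (hconn _ d) e rfl
  have halt : ∀ e, G.IsDistributing (G.tgt e) → ∃ k, G.IsRightTail e k := fun e he =>
    ⟨[], ⟨by simp, by simp⟩, by simp, by simpa [EndsIn] using he⟩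
  intro x hx
  induction hx using Relation.ReflTransGen.head_induction_on with
  | refl => rintro e rfl; exact halt e hd
  | head h _ ih =>
    rintro e rfl
    rcases hG (G.tgt e) with h' | h'
    · exact halt e h'
    · obtain ⟨e', he', rfl⟩ := h
      obtain ⟨k, hk⟩ := ih e' rfl
      refine ⟨e' :: k, ⟨by simp, List.isChain_cons_cons.2 ⟨he'.symm, hk.1.2⟩⟩, ?_, ?_⟩
      · simpa [he', h'] using hk.2.1
      · exact (endsIn_append (p := [e]) (by simp)).2 hk.2.2

lemma exists_isLeftTail (hG : ∀ x, G.IsDistributing x ∨ G.IsCollecting x)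
    (hconn : G.StronglyConnected) {c : G.V} (hc : G.IsCollecting c) (e : G.E) :
    ∃ l, G.IsLeftTail e l := by
  suffices H : ∀ x, Relation.ReflTransGen (fun a b => ∃ e, G.src e = a ∧ G.tgt e = b) c x →
      ∀ e, G.src e = x → ∃ l, G.IsLeftTail e l from H _ (hconn c _) e rfl
  have halt : ∀ e, G.IsCollecting (G.src e) → ∃ l, G.IsLeftTail e l := fun e he =>
    ⟨[], ⟨by simp, by simp⟩, by simp, by simpa using he⟩
  intro x hx
  induction hx with
  | refl => rintro e rfl; exact halt e hc
  | tail _ h ih =>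
    rintro e rfl
    rcases hG (G.src e) with h' | h'
    · obtain ⟨e', rfl, he'⟩ := h
      obtain ⟨l, hl⟩ := ih e' rfl
      refine ⟨l ++ [e'], ⟨by simp, ?_⟩, ?_, ?_⟩
      · rw [List.isChain_append]
        exact ⟨hl.1.2, by simp, by simpa using he'⟩
      · intro f hf
        rcases List.mem_append.1 hf with hf | hf
        · exact hl.2.1 f hf
        · rw [List.mem_singleton.1 hf, he']
          exact h'
      · exact (startsIn_append (by simp)).2 hl.2.2
    · exact halt e h'

/-- Up to the first distributing vertex a path has only one continuation. -/
lemma IsRightTail.prefix {e : G.E} {k k' : List G.E} (hk : G.IsRightTail e k)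
    (hp : G.IsPath (e :: k')) (he : G.EndsIn G.IsDistributing (e :: k')) : k <+: k' := by
  induction k generalizing e k' with
  | nil => exact List.nil_prefix
  | cons f k ih =>
    have hf := hk.2.1 f (by simp)
    have hc := List.isChain_cons_cons.1 hk.1.2
    cases k' with
    | nil =>
      have : G.IsDistributing (G.tgt e) := by simpa [EndsIn] using he
      rw [hc.1] at this
      exact (hf.not_isDistributing this).elim
    | cons f' k' =>
      have hc' := List.isChain_cons_cons.1 hp.2
      obtain rfl := hf.out_unique rfl (hc'.1.symm.trans hc.1)
      rw [List.cons_prefix_cons]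
      exact ⟨rfl, ih ⟨⟨by simp, hc.2⟩, fun g hg => hk.2.1 g (by simp [hg]),
        (endsIn_append (p := [e]) (by simp)).1 hk.2.2⟩ ⟨by simp, hc'.2⟩
        ((endsIn_append (p := [e]) (by simp)).1 he)⟩

/-- Back to the first collecting vertex a path has only one continuation backwards. -/
lemma IsLeftTail.suffix {e : G.E} {l l' : List G.E} (hl : G.IsLeftTail e l)
    (hp : G.IsPath (l' ++ [e])) (he : G.StartsIn G.IsCollecting (l' ++ [e])) : l <:+ l' := by
  induction l using List.reverseRecOn generalizing e l' with
  | nil => exact List.nil_suffix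
  | append_singleton l f ih =>
    have hf := hl.2.1 f (by simp)
    have hc := List.isChain_append.1 hl.1.2
    have hfe : G.tgt f = G.src e := by simpa using hc.2.2
    rcases List.eq_nil_or_concat' l' with rfl | ⟨l', f', rfl⟩
    · have : G.IsCollecting (G.src e) := by simpa using he
      rw [← hfe] at this
      exact (hf.not_isCollecting this).elim
    · have hc' := List.isChain_append.1 hp.2
      have hfe' : G.tgt f' = G.src e := by simpa using hc'.2.2
      obtain rfl := hf.in_unique rfl (hfe'.trans hfe.symm)
      have := ih (e := f) (l' := l') ⟨⟨by simp, hc.1⟩, fun g hg => hl.2.1 g (by simp [hg]),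
        (startsIn_append (by simp)).1 hl.2.2⟩ ⟨by simp, hc'.1⟩ ((startsIn_append (by simp)).1 he)
      obtain ⟨t, rfl⟩ := this
      exact ⟨t, by simp⟩

lemma IsRightTail.rightExtension_eq {e : G.E} {k : List G.E} (hk : G.IsRightTail e k) :
    G.rightExtension [e] = e :: k := by
  have cons : ∀ p', [e] <+: p' → ∃ k', p' = e :: k' := fun p' ⟨t, ht⟩ => ⟨t, ht.symm⟩
  have hmin : G.IsRightExtension [e] (e :: k) := by
    refine ⟨⟨hk.1, ⟨k, rfl⟩, hk.2.2⟩, fun p' hp' hpre hend => ?_⟩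
    obtain ⟨k', rfl⟩ := cons p' hpre
    simpa using (hk.prefix hp' hend).length_le
  have hex : ∃ p, G.IsRightExtension [e] p := ⟨_, hmin⟩
  have hch : G.IsRightExtension [e] (G.rightExtension [e]) := by
    rw [rightExtension, dif_pos hex]
    exact hex.choose_spec
  obtain ⟨k', hk'⟩ := cons _ hch.1.2.1
  rw [hk'] at hch ⊢
  have h1 := hk.prefix hch.1.1 hch.1.2.2
  have h2 := hch.2 _ hk.1 ⟨k, rfl⟩ hk.2.2
  rw [h1.eq_of_length_le (by simpa using h2)]

lemma IsLeftTail.leftExtension_eq {e : G.E} {l : List G.E} (hl : G.IsLeftTail e l) :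
    G.leftExtension [e] = l ++ [e] := by
  have cons : ∀ p', [e] <:+ p' → ∃ l', p' = l' ++ [e] := fun p' ⟨t, ht⟩ => ⟨t, ht.symm⟩
  have hmin : G.IsLeftExtension [e] (l ++ [e]) := by
    refine ⟨⟨hl.1, ⟨l, rfl⟩, hl.2.2⟩, fun p' hp' hpre hend => ?_⟩
    obtain ⟨l', rfl⟩ := cons p' hpre
    simpa using (hl.suffix hp' hend).length_le
  have hex : ∃ p, G.IsLeftExtension [e] p := ⟨_, hmin⟩
  have hch : G.IsLeftExtension [e] (G.leftExtension [e]) := by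
    rw [leftExtension, dif_pos hex]
    exact hex.choose_spec
  obtain ⟨l', hl'⟩ := cons _ hch.1.2.1
  rw [hl'] at hch ⊢
  have h1 := hl.suffix hch.1.1 hch.1.2.2
  have h2 := hch.2 _ hl.1 ⟨l, rfl⟩ hl.2.2
  rw [h1.eq_of_length_le (by simpa using h2)]

end DirGraph

/-! ### Words of paths -/

namespace WordGraph

variable {A : Type w} {S : WordGraph.{u, w} A} {W : ℕ → A}

open scoped Classical in
/-- The contribution of an edge that is not the first one to the front word of a path. -/
noncomputable def outLabel (S : WordGraph.{u, w} A) (e : S.E) : List A :=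
  if S.IsDistributing (S.src e) then S.front e else []

open scoped Classical in
/-- The contribution of an edge that is not the last one to the back word of a path. -/
noncomputable def inLabel (S : WordGraph.{u, w} A) (e : S.E) : List A :=
  if S.IsCollecting (S.tgt e) then S.back e else []

lemma outLabel_of_distributing {e : S.E} (h : S.IsDistributing (S.src e)) :
    S.outLabel e = S.front e := if_pos h

lemma outLabel_of_collecting {e : S.E} (h : S.IsCollecting (S.src e)) : S.outLabel e = [] :=
  if_neg h.not_isDistributing

lemma inLabel_of_collecting {e : S.E} (h : S.IsCollecting (S.tgt e)) :
    S.inLabel e = S.back e := if_pos h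

lemma inLabel_of_distributing {e : S.E} (h : S.IsDistributing (S.tgt e)) : S.inLabel e = [] :=
  if_neg h.not_isCollecting

lemma flatMap_filter_eq {α β : Type*} (P : α → Prop) [DecidablePred P] (g : α → List β)
    (p : List α) :
    (p.filter fun a => P a).flatMap g = p.flatMap fun a => if P a then g a else [] := by
  induction p with
  | nil => rfl
  | cons a p ih =>
    by_cases h : P a
    · simp [h, ih]
    · simp [h, ih]

lemma frontWord_cons (e : S.E) (p : List S.E) :
    S.frontWord (e :: p) = S.front e ++ p.flatMap S.outLabel := by
  simp only [frontWord, flatMap_filter_eq]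
  rfl

lemma backWord_concat (p : List S.E) (e : S.E) :
    S.backWord (p ++ [e]) = p.flatMap S.inLabel ++ S.back e := by
  simp only [backWord, flatMap_filter_eq]
  simp
  rfl

lemma frontWord_append {p : List S.E} (hp : p ≠ []) (q : List S.E) :
    S.frontWord (p ++ q) = S.frontWord p ++ q.flatMap S.outLabel := by
  cases p with
  | nil => exact (hp rfl).elim
  | cons e p => simp [frontWord_cons]

lemma backWord_append (p : List S.E) {q : List S.E} (hq : q ≠ []) :
    S.backWord (p ++ q) = p.flatMap S.inLabel ++ S.backWord q := by
  rcases List.eq_nil_or_concat' q with rfl | ⟨q, e, rfl⟩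
  · exact (hq rfl).elim
  · rw [← List.append_assoc, backWord_concat, backWord_concat]
    simp

lemma outLabel_flatMap_length_le (p : List S.E) :
    (p.flatMap S.outLabel).length ≤ (S.frontWord p).length := by
  cases p with
  | nil => simp
  | cons e p =>
    rw [frontWord_cons, List.flatMap_cons]
    simp only [List.length_append, add_le_add_iff_right]
    unfold outLabel
    split <;> simp

/-- The word of a symmetric path around a symmetric path in its middle: what precedes the middle is
read as back words, what follows it as front words. -/
lemma frontWord_append₃ (hS : ∀ p, S.IsSymmetric p → S.frontWord p = S.backWord p)
    {p t r : List S.E} (h : S.IsSymmetric (p ++ t ++ r)) (ht : S.IsSymmetric t) :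
    S.frontWord (p ++ t ++ r) =
      p.flatMap S.inLabel ++ S.frontWord t ++ r.flatMap S.outLabel := by
  rw [frontWord_append (by simp [ht.1.1]), hS _ (h.prefix ht), backWord_append _ ht.1.1, hS _ ht]

namespace IsRauzyScheme

variable (hS : S.IsRauzyScheme W)
include hS

/-- In a Rauzy scheme the occurrences of `F(t)` in `F(s)`, for symmetric paths `t` and `s`, come
from the occurrences of `t` in `s`: the latter inject into the former, and by the scheme axioms
there are not fewer of them. -/
theorem exists_of_frontWord_eq {s t : List S.E} (hs : S.IsSymmetric s) (ht : S.IsSymmetric t)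
    {a b : List A} (h : S.frontWord s = a ++ S.frontWord t ++ b) :
    ∃ p r, s = p ++ t ++ r ∧ a = p.flatMap S.inLabel ∧ b = r.flatMap S.outLabel := by
  classical
  set I := {i : ℕ | ∃ p r : List S.E, p.length = i ∧ s = p ++ t ++ r} with hI
  set J := {i : ℕ | ∃ p r : List A, p.length = i ∧ S.frontWord s = p ++ S.frontWord t ++ r} with hJ
  set φ : ℕ → ℕ := fun i => ((s.take i).flatMap S.inLabel).length with hφ
  have hJfin : J.Finite := by
    refine (Set.finite_Iic (S.frontWord s).length).subset ?_
    rintro i ⟨p, r, rfl, hp⟩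
    simp [hp]
  have hle : J.ncard ≤ I.ncard := hS.occurs t s ht hs J.ncard (le_refl _)
  have hsub : φ '' I ⊆ J := by
    rintro _ ⟨i, ⟨p, r, rfl, rfl⟩, rfl⟩
    refine ⟨p.flatMap S.inLabel, r.flatMap S.outLabel, ?_, frontWord_append₃ hS.front_eq_back hs ht⟩
    simp only [hφ]
    rw [List.append_assoc, List.take_left']
    rfl
  -- `φ` is strictly increasing, as the edge before an occurrence of `t` enters a collecting vertex
  -- and contributes a nonempty back word
  have hmono : ∀ i ∈ I, ∀ j ∈ I, i < j → φ i < φ j := by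
    rintro _ ⟨p, r, rfl, hp⟩ _ ⟨p', r', rfl, hp'⟩ hlt
    have e1 : s.take p.length = p := by rw [hp, List.append_assoc, List.take_left']; rfl
    have e2 : s.take p'.length = p' := by rw [hp', List.append_assoc, List.take_left']; rfl
    simp only [hφ, e1, e2]
    have hpp : p <+: p' := by
      refine List.prefix_of_prefix_length_le (l₃ := s) ?_ ?_ hlt.le
      · rw [hp, List.append_assoc]; exact List.prefix_append _ _
      · rw [hp', List.append_assoc]; exact List.prefix_append _ _
    obtain ⟨u, rfl⟩ := hpp
    rcases List.eq_nil_or_concat' u with rfl | ⟨u, e, rfl⟩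
    · simp at hlt
    · obtain ⟨f, t', rfl⟩ := List.exists_cons_of_ne_nil ht.1.1
      have hef : S.tgt e = S.src f := by
        have h1 := hs.1
        rw [hp'] at h1
        exact DirGraph.IsPath.tgt_eq_src (p := p ++ u) (q := t' ++ r') (by simpa using h1)
      have hc : S.IsCollecting (S.tgt e) := by rw [hef]; simpa using ht.2.1
      have := List.length_pos_iff.2 (hS.back_letters e hc).1
      simp [inLabel_of_collecting hc]
      omega
  have hinj : Set.InjOn φ I := by
    intro i hi j hj hij
    rcases lt_trichotomy i j with hlt | heq | hlt
    · exact absurd hij (hmono i hi j hj hlt).ne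
    · exact heq
    · exact absurd hij (hmono j hj i hi hlt).ne'
  have heq : φ '' I = J := by
    refine Set.eq_of_subset_of_ncard_le hsub ?_ hJfin
    rwa [hinj.ncard_image]
  have ha : a.length ∈ J := ⟨a, b, rfl, h⟩
  rw [← heq] at ha
  obtain ⟨_, ⟨p, r, rfl, hp⟩, hpa⟩ := ha
  have e1 : s.take p.length = p := by rw [hp, List.append_assoc, List.take_left']; rfl
  simp only [hφ, e1] at hpa
  have hs' := hs
  rw [hp] at hs'
  have h2 := frontWord_append₃ hS.front_eq_back hs' ht
  rw [← hp, h, List.append_assoc, List.append_assoc] at h2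
  have h3 := List.append_inj h2 hpa.symm
  exact ⟨p, r, hp, h3.1, (List.append_inj h3.2 rfl).2⟩

lemma infix_of_frontWord_infix {s t : List S.E} (hs : S.IsSymmetric s) (ht : S.IsSymmetric t)
    (h : S.frontWord t <:+: S.frontWord s) : t <:+: s := by
  obtain ⟨a, b, h⟩ := h
  obtain ⟨p, r, h, -, -⟩ := hS.exists_of_frontWord_eq hs ht h.symm
  exact ⟨p, r, h.symm⟩

lemma frontWord_infix {s t : List S.E} (hs : S.IsSymmetric s) (ht : S.IsSymmetric t)
    (h : t <:+: s) : S.frontWord t <:+: S.frontWord s := by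
  obtain ⟨p, r, rfl⟩ := h
  rw [frontWord_append₃ hS.front_eq_back hs ht]
  exact List.infix_append _ _ _

/-- Two symmetric paths whose words are factors of `W` are the beginning and the end of a third
one, which reads any given factor in between. -/
theorem exists_link (hW : IsRecurrentWord W) {t₁ t₂ : List S.E} (ht₁ : S.IsSymmetric t₁)
    (ht₂ : S.IsSymmetric t₂) (hf₁ : IsFactor W (S.frontWord t₁)) (hf₂ : IsFactor W (S.frontWord t₂))
    {x : List A} (hx : IsFactor W x) : ∃ m, S.IsSymmetric (t₁ ++ m ++ t₂) ∧
      IsFactor W (S.frontWord (t₁ ++ m ++ t₂)) ∧ x <:+: m.flatMap S.outLabel := by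
  obtain ⟨a, b, ha, hb, hX⟩ := hW.exists_link hf₁ hx hf₂
  obtain ⟨s, hs, u, u', hu⟩ := hS.covers _ hX
  obtain ⟨p, r, rfl, hp, hr⟩ := hS.exists_of_frontWord_eq hs ht₁ (a := u)
    (b := a ++ x ++ b ++ S.frontWord t₂ ++ u') (by simp [← hu])
  have hs' := hs.suffix ht₁
  obtain ⟨p₂, r₂, h₂, hp₂, hr₂⟩ := hS.exists_of_frontWord_eq hs' ht₂
    (a := S.frontWord t₁ ++ a ++ x ++ b) (b := u') (by
      rw [frontWord_append ht₁.1.1, ← hr]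
      simp)
  -- the occurrence of `t₂` begins after `t₁`, since the word before it is longer than `F(t₁)`
  obtain ⟨m, rfl⟩ : ∃ m, p₂ = t₁ ++ m := by
    rw [List.append_assoc, List.append_eq_append_iff] at h₂
    rcases h₂ with ⟨m, h, -⟩ | ⟨c, h, -⟩
    · exact ⟨m, h⟩
    · by_cases hc : c = []
      · exact ⟨[], by simp [h, hc]⟩
      · have h1 : S.frontWord t₁ = p₂.flatMap S.inLabel ++ S.backWord c := by
          rw [hS.front_eq_back _ ht₁, ← backWord_append _ hc, ← h]
        rw [← hp₂] at h1
        have h2 := congrArg List.length h1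
        have := List.length_pos_iff.2 ha
        simp only [List.length_append] at h2
        omega
  rw [h₂] at hs'
  have hsym := hs'.prefix ht₂
  have hF : S.frontWord (t₁ ++ m ++ t₂) = S.frontWord t₁ ++ a ++ x ++ b ++ S.frontWord t₂ := by
    rw [hS.front_eq_back _ hsym, backWord_append _ ht₂.1.1, ← hp₂, hS.front_eq_back _ ht₂]
  refine ⟨m, hsym, by rw [hF]; exact hX, ?_⟩
  rw [List.append_assoc, frontWord_append ht₁.1.1, List.flatMap_append] at hF
  simp only [List.append_assoc, List.append_cancel_left_eq] at hF
  have hlen := outLabel_flatMap_length_le (S := S) t₂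
  have hpre : a ++ (x ++ b) <+: m.flatMap S.outLabel := by
    refine List.prefix_of_prefix_length_le (l₃ := m.flatMap S.outLabel ++ t₂.flatMap S.outLabel)
      ?_ (List.prefix_append _ _) ?_
    · rw [hF]
      exact ⟨S.frontWord t₂, by simp⟩
    · have := congrArg List.length hF
      simp only [List.length_append] at this ⊢
      omega
  exact (List.infix_append _ _ _ |>.trans (by simpa using hpre.isInfix : a ++ x ++ b <:+: _))

lemma exists_isSupporting : ∃ v, S.IsSupporting v := by
  obtain ⟨p, hp, -⟩ := hS.covers [] ⟨0, 0, rfl⟩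
  obtain ⟨v, -, hv⟩ := hp.exists_isSupporting hS.vertex
  exact ⟨v, hv⟩

/-- Every edge is passed by a symmetric path whose word is a factor of `W`. -/
lemma exists_isSymmetric_mem (hW : IsRecurrentWord W) (e : S.E) :
    ∃ t, S.IsSymmetric t ∧ IsFactor W (S.frontWord t) ∧ e ∈ t := by
  obtain ⟨v, hv⟩ := hS.exists_isSupporting
  have hfac : IsFactor W (S.frontWord [v]) := by
    simpa [frontWord_cons] using hS.front_factor v
  obtain ⟨x, hx, hforce⟩ := hS.forces e
  obtain ⟨m, hm, hmf, hxm⟩ := hS.exists_link hW hv.isSymmetric hv.isSymmetric hfac hfac hx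
  refine ⟨_, hm, hmf, hforce _ hm (hxm.trans ?_)⟩
  rw [List.append_assoc, frontWord_append (by simp), List.flatMap_append]
  rw [← List.append_assoc]
  exact List.infix_append _ _ _

end IsRauzyScheme

end WordGraph

/-! ### The number of vertices of a Rauzy scheme -/

namespace WordGraph.IsRauzyScheme

open DirGraph

variable {A : Type w} {S : WordGraph.{u, w} A} {W : ℕ → A} (hS : S.IsRauzyScheme W)
include hS

/-- Every edge other than the supporting edge `v` lies on a path that begins and ends with `v`,
does not pass `v` in between, and whose word is a factor of `W`. -/
lemma exists_return (hW : IsRecurrentWord W) {v e : S.E} (hv : S.IsSupporting v) (he : e ≠ v) :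
    ∃ a b, S.IsSymmetric (v :: a ++ e :: b ++ [v]) ∧ v ∉ a ∧ v ∉ b ∧
      IsFactor W (S.frontWord (v :: a ++ e :: b ++ [v])) := by
  classical
  have hfac : IsFactor W (S.frontWord [v]) := by
    simpa [frontWord_cons] using hS.front_factor v
  obtain ⟨x, hx, hforce⟩ := hS.forces e
  obtain ⟨m, hm, hmf, hxm⟩ := hS.exists_link hW hv.isSymmetric hv.isSymmetric hfac hfac hx
  have hmem : e ∈ [v] ++ m ++ [v] := hforce _ hm (hxm.trans (by
    rw [List.append_assoc, frontWord_append (by simp), List.flatMap_append, ← List.append_assoc]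
    exact List.infix_append _ _ _))
  have hem : e ∈ m := by simpa [he] using hmem
  obtain ⟨α, β, rfl⟩ := List.append_of_mem hem
  -- cut the path at the last passage of `v` before `e` and at the first one after it
  obtain ⟨a, α', hα, hva⟩ := List.eq_append_cons_of_mem (a := v) (xs := ([v] ++ α).reverse)
    (by simp)
  obtain ⟨b, β', hβ, hvb⟩ := List.eq_append_cons_of_mem (a := v) (xs := β ++ [v]) (by simp)
  have hα' : [v] ++ α = α'.reverse ++ v :: a.reverse := by
    simpa using congrArg List.reverse hα
  have hinf : v :: a.reverse ++ e :: b ++ [v] <:+: [v] ++ (α ++ e :: β) ++ [v] := by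
    refine ⟨α'.reverse, β', ?_⟩
    have : [v] ++ (α ++ e :: β) ++ [v] = ([v] ++ α) ++ e :: (β ++ [v]) := by simp
    rw [this, hα', hβ]
    simp
  have hsym : S.IsSymmetric (v :: a.reverse ++ e :: b ++ [v]) :=
    ⟨hm.1.of_infix hinf (by simp), by simpa using hv.1, (endsIn_concat).2 hv.2⟩
  exact ⟨a.reverse, b, hsym, by simpa using hva, hvb,
    hmf.of_infix (hS.frontWord_infix hm hsym hinf)⟩

/-- The word of a return path to `v` meets `F(v)` only at its two ends, so its length is bounded
by the recurrence bound. -/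
lemma length_return_le {C : ℕ} (hC : IsRecurrenceBound W C) {v e : S.E} (hv : S.IsSupporting v)
    (he : e ≠ v) {a b : List S.E} (hsym : S.IsSymmetric (v :: a ++ e :: b ++ [v])) (ha : v ∉ a)
    (hb : v ∉ b) (hfac : IsFactor W (S.frontWord (v :: a ++ e :: b ++ [v]))) :
    (S.frontWord (v :: a ++ e :: b ++ [v])).length ≤ C * (S.front v).length + 1 := by
  by_contra! hlt
  set X := S.frontWord (v :: a ++ e :: b ++ [v]) with hX
  obtain ⟨x, Y, hxY⟩ := List.exists_cons_of_ne_nil (l := X) (by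
    rw [← List.length_pos_iff]; omega)
  rcases List.eq_nil_or_concat' Y with rfl | ⟨Z, y, rfl⟩
  · rw [hxY] at hlt
    simp at hlt
  have hXZ : X = [x] ++ Z ++ [y] := by simp [hxY]
  -- without its first and last letter, a longer word would still contain `F(v)`, which then would
  -- come from a passage of `v` inside the path
  have hinf : S.frontWord [v] <:+: Z := by
    have hv' : S.frontWord [v] = S.front v := by simp [frontWord_cons]
    rw [hv']
    refine hC.infix (hS.front_factor v) (hfac.of_infix ?_) ?_
    · rw [hXZ]; exact List.infix_append _ _ _
    · have := congrArg List.length hXZ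
      simp at this
      omega
  obtain ⟨c, d, rfl⟩ := hinf
  obtain ⟨p, r, hpr, hp, hr⟩ := hS.exists_of_frontWord_eq hsym hv.isSymmetric (a := [x] ++ c)
    (b := d ++ [y]) (by rw [← hX, hXZ]; simp)
  cases p with
  | nil => simp at hp
  | cons f p =>
    rcases List.eq_nil_or_concat' r with rfl | ⟨r, g, rfl⟩
    · simp at hr
    · have h1 : a ++ e :: b = p ++ v :: r := by
        have h2 : (v :: (a ++ e :: b)) ++ [v] = (f :: (p ++ v :: r)) ++ [g] := by
          simpa using hpr
        have h3 := (List.append_inj' h2 rfl).1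
        simpa using (List.cons_eq_cons.1 h3).2
      have h2 : v ∈ a ++ e :: b := by rw [h1]; simp
      simp [ha, hb, he.symm] at h2

/-- The shortest symmetric paths that end in the distributing vertices have right special words of
comparable lengths, none of which is a suffix of another. So there are boundedly many distributing
vertices. -/
theorem card_isDistributing_le {C : ℕ} (hC : IsRecurrenceBound W C) :
    Nat.card {x : S.V // S.IsDistributing x} ≤ (8 * C ^ 4 + 1) ^ 2 := by
  classical
  have hW := hC.isRecurrentWord
  have := hS.finite_E
  have := hS.finite_V
  -- `v` is a supporting edge with the shortest word
  obtain ⟨v, hv, hmin⟩ := Set.exists_min_image {v | S.IsSupporting v}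
    (fun v => (S.front v).length) (Set.toFinite _) hS.exists_isSupporting
  have hin : ∀ x : {x : S.V // S.IsDistributing x}, ∃ e, S.tgt e = x := fun x => x.2.1.exists
  choose e he using hin
  have htail := fun x => exists_isLeftTail hS.vertex hS.stronglyConnected hv.1 (e x)
  choose l hl using htail
  have hsym : ∀ x, S.IsSymmetric (l x ++ [e x]) := fun x =>
    ⟨(hl x).1, (hl x).2.2, endsIn_concat.2 (by rw [he]; exact x.2)⟩
  -- a return path to `v` that leaves `x` by `f` passes the shortest symmetric path to `x`
  have hret : ∀ x f, S.src f = x.1 → IsFactor W (S.frontWord (l x ++ [e x]) ++ S.front f) ∧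
      (S.frontWord (l x ++ [e x])).length ≤ C * (S.front v).length + 1 := by
    intro x f hf
    have hfv : f ≠ v := by
      rintro rfl
      exact hv.1.not_isDistributing (by rw [hf]; exact x.2)
    obtain ⟨a, b, hr, ha, hb, hfac⟩ := hS.exists_return hW hv hfv
    have hlen := hS.length_return_le hC hv hfv hr ha hb hfac
    obtain ⟨α, g, hαg⟩ : ∃ α g, v :: a = α ++ [g] := by
      rcases List.eq_nil_or_concat' (v :: a) with h | h
      · simp at h
      · exact h
    have hr' := hr
    rw [hαg] at hr'
    have hgf : S.tgt g = S.src f :=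
      IsPath.tgt_eq_src (p := α) (q := b ++ [v]) (by simpa using hr'.1)
    have hge : g = e x := x.2.in_unique (hgf.trans hf) (he x)
    subst hge
    have hpath : S.IsPath (α ++ [e x]) := by
      rw [← hαg]
      exact hr.1.of_infix ⟨[], f :: b ++ [v], by simp⟩ (by simp)
    have hstart : S.StartsIn S.IsCollecting (α ++ [e x]) := by
      rw [← hαg]
      simpa using hv.1
    obtain ⟨p, rfl⟩ := (hl x).suffix hpath hstart
    have hdec : v :: a ++ f :: b ++ [v] = p ++ (l x ++ [e x]) ++ (f :: (b ++ [v])) := by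
      rw [hαg]; simp
    have hd := hr
    rw [hdec] at hd
    have hF := frontWord_append₃ hS.front_eq_back hd (hsym x)
    rw [List.flatMap_cons, outLabel_of_distributing (by rw [hf]; exact x.2)] at hF
    rw [← hdec] at hF
    have hinf : S.frontWord (l x ++ [e x]) ++ S.front f <:+:
        S.frontWord (v :: a ++ f :: b ++ [v]) := by
      rw [hF]
      exact ⟨p.flatMap S.inLabel, (b ++ [v]).flatMap S.outLabel, by simp only [List.append_assoc]⟩
    refine ⟨hfac.of_infix hinf, ?_⟩
    have := hinf.length_le
    rw [List.length_append] at this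
    omega
  refine hC.card_special_le (S.front v).length (fun x => S.frontWord (l x ++ [e x])) ?_ ?_ ?_
  · intro x
    obtain ⟨f, g, hfg, hf, hg⟩ := x.2.2
    refine ⟨?_, (hret x f hf).2⟩
    obtain ⟨h, t, ht⟩ := List.exists_cons_of_ne_nil (hsym x).1.1
    -- the first edge of the path is a supporting one, so its word is not shorter than that of `v`
    have hh : S.IsSupporting h := by
      refine ⟨by simpa [ht] using (hl x).2.2, ?_⟩
      have hmem : h ∈ l x ++ [e x] := by rw [ht]; simp
      rcases List.mem_append.1 hmem with hm | hm
      · exact (hl x).2.1 h hm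
      · rw [List.mem_singleton.1 hm, he]
        exact x.2
    rw [ht, frontWord_cons, List.length_append]
    exact (hmin h hh).trans (Nat.le_add_right _ _)
  · intro x
    obtain ⟨f, g, hfg, hf, hg⟩ := x.2.2
    have hf' := hS.front_letters f (by rw [hf]; exact x.2)
    have hg' := hS.front_letters g (by rw [hg]; exact x.2)
    obtain ⟨a, y, hy⟩ := List.exists_cons_of_ne_nil hf'.1
    obtain ⟨b, z, hz⟩ := List.exists_cons_of_ne_nil hg'.1
    have hab := hf'.2 g (hg.trans hf.symm) hfg.symm
    refine ⟨a, b, ?_, ?_, ?_⟩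
    · rintro rfl
      simp [hy, hz] at hab
    · exact (hret x f hf).1.of_infix ⟨[], y, by simp [hy]⟩
    · exact (hret x g hg).1.of_infix ⟨[], z, by simp [hz]⟩
  · rintro x y ⟨u, hu⟩
    obtain ⟨p, r, hpr, -, hr⟩ := hS.exists_of_frontWord_eq (hsym y) (hsym x) (a := u) (b := [])
      (by simpa using hu.symm)
    have hr0 : r = [] := by
      cases r with
      | nil => rfl
      | cons f r =>
        have h1 := (hsym y).1
        rw [hpr] at h1
        have h2 : S.tgt (e x) = S.src f :=
          IsPath.tgt_eq_src (p := p ++ l x) (q := r) (by simpa using h1)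
        have h3 : S.IsDistributing (S.src f) := by rw [← h2, he]; exact x.2
        rw [List.flatMap_cons, outLabel_of_distributing h3] at hr
        simp [(hS.front_letters f h3).1] at hr
    subst hr0
    rw [List.append_nil, ← List.append_assoc] at hpr
    have := List.append_inj' hpr rfl
    have h1 : e y = e x := by simpa using this.2
    exact Subtype.ext ((he x).symm.trans ((congrArg S.tgt h1).symm.trans (he y)))

lemma card_out_le [Finite A] (x : S.V) (hx : S.IsDistributing x) :
    Nat.card {e // S.src e = x} ≤ Nat.card A := by
  have hne : ∀ e : {e // S.src e = x}, S.front e.1 ≠ [] := fun e =>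
    (hS.front_letters e.1 (by rw [e.2]; exact hx)).1
  refine Nat.card_le_card_of_injective (fun e : {e // S.src e = x} => (S.front e.1).head (hne e)) ?_
  intro e f hef
  by_contra hne'
  refine (hS.front_letters e.1 (by rw [e.2]; exact hx)).2 f.1 (f.2.trans e.2.symm)
    (fun h => hne' (Subtype.ext h.symm)) ?_
  rw [List.head?_eq_some_head (hne e), List.head?_eq_some_head (hne f)]
  exact congrArg some hef.symm

/-- Counting the edges by their beginnings and by their ends bounds the number of collecting
vertices. -/
theorem card_le [Finite A] {C : ℕ} (hC : IsRecurrenceBound W C) :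
    Nat.card S.V ≤ (Nat.card A + 1) * (8 * C ^ 4 + 1) ^ 2 ∧
      Nat.card S.E ≤ 2 * Nat.card A * (8 * C ^ 4 + 1) ^ 2 := by
  classical
  have := hS.finite_E
  have := hS.finite_V
  have := Fintype.ofFinite S.V
  have := Fintype.ofFinite S.E
  have hD := hS.card_isDistributing_le hC
  set K := (8 * C ^ 4 + 1) ^ 2
  set q := Nat.card A
  have hsub : ∀ P : S.E → Prop, (Finset.univ.filter P).card = Nat.card {e // P e} := fun P => by
    rw [Nat.card_eq_fintype_card, Fintype.card_subtype]
  have hout : Nat.card S.E = ∑ x : S.V, Nat.card {e // S.src e = x} := by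
    rw [Nat.card_eq_fintype_card, ← Finset.card_univ,
      Finset.card_eq_sum_card_fiberwise (f := S.src) (t := Finset.univ) (fun _ _ => by simp)]
    simp [hsub]
  have hin : Nat.card S.E = ∑ x : S.V, Nat.card {e // S.tgt e = x} := by
    rw [Nat.card_eq_fintype_card, ← Finset.card_univ,
      Finset.card_eq_sum_card_fiberwise (f := S.tgt) (t := Finset.univ) (fun _ _ => by simp)]
    simp [hsub]
  set d := (Finset.univ.filter fun x : S.V => S.IsDistributing x).card with hd
  set c := (Finset.univ.filter fun x : S.V => ¬ S.IsDistributing x).card with hc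
  have hdc : Nat.card S.V = d + c := by
    rw [Nat.card_eq_fintype_card, ← Finset.card_univ, hd, hc,
      Finset.card_filter_add_card_filter_not]
  have hdK : d ≤ K := by
    rw [hd, ← Fintype.card_subtype, ← Nat.card_eq_fintype_card]
    exact hD
  -- at most `q` edges leave a distributing vertex, one edge leaves a collecting vertex
  have hout' : Nat.card S.E ≤ d * q + c := by
    rw [hout, ← Finset.sum_filter_add_sum_filter_not _ (fun x : S.V => S.IsDistributing x)]
    refine add_le_add ?_ ?_
    · rw [hd, ← smul_eq_mul]
      exact Finset.sum_le_card_nsmul _ _ _ fun x hx => hS.card_out_le x (by simpa using hx)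
    · rw [hc, ← mul_one (Finset.card _), ← smul_eq_mul]
      refine Finset.sum_le_card_nsmul _ _ _ fun x hx => ?_
      have hx' : S.IsCollecting x := (hS.vertex x).resolve_left (by simpa using hx)
      rw [Finite.card_le_one_iff_subsingleton]
      exact ⟨fun e f => Subtype.ext (hx'.out_unique e.2 f.2)⟩
  -- at least two edges enter a collecting vertex
  have hin' : d + c * 2 ≤ Nat.card S.E := by
    rw [hin, ← Finset.sum_filter_add_sum_filter_not _ (fun x : S.V => S.IsDistributing x)]
    refine add_le_add ?_ ?_
    · rw [hd, ← mul_one (Finset.card _), ← smul_eq_mul]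
      refine Finset.card_nsmul_le_sum _ _ _ fun x hx => ?_
      have hx' : S.IsDistributing x := by simpa using hx
      obtain ⟨e, he⟩ := hx'.1.exists
      have : Nonempty {e // S.tgt e = x} := ⟨⟨e, he⟩⟩
      exact Nat.card_pos
    · rw [hc, ← smul_eq_mul]
      refine Finset.card_nsmul_le_sum _ _ _ fun x hx => ?_
      have hx' : S.IsCollecting x := (hS.vertex x).resolve_left (by simpa using hx)
      obtain ⟨e, f, hef, he, hf⟩ := hx'.1
      have : Nontrivial {e // S.tgt e = x} :=
        ⟨⟨e, he⟩, ⟨f, hf⟩, fun h => hef (congrArg Subtype.val h)⟩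
      exact Finite.one_lt_card
  have hdq : d * q ≤ K * q := Nat.mul_le_mul_right _ hdK
  constructor
  · rw [hdc, add_mul, one_mul, mul_comm q]
    omega
  · have : 2 * q * K = K * q + K * q := by ring
    omega

end WordGraph.IsRauzyScheme

/-! ### The graph with a split supporting edge -/

/-- Two labellings of the same edges that differ by a carry, handed over from each edge to the next
one, read the same word along a path, up to the carries at its two ends. -/
lemma List.IsChain.flatMap_telescope {α β : Type*} {R : α → α → Prop} {f f' i o : α → List β}
    (h : ∀ a, i a ++ f' a = f a ++ o a) (hR : ∀ a b, R a b → o a = i b) :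
    ∀ {a : α} {p : List α}, (a :: p).IsChain R →
      i a ++ (a :: p).flatMap f' =
        (a :: p).flatMap f ++ o ((a :: p).getLast (List.cons_ne_nil a p))
  | a, [], _ => by simp [h]
  | a, b :: p, hp => by
    rw [List.isChain_cons_cons] at hp
    rw [List.flatMap_cons, ← List.append_assoc, h, List.append_assoc, hR a b hp.1,
      List.IsChain.flatMap_telescope h hR hp.2, List.flatMap_cons (f := f)]
    simp

/-- An infix of a list that neither begins nor ends with `v` is not affected by letters `v` put at
the ends of the list. -/
lemma List.exists_of_append_eq_pad {α : Type*} {v : α} {p q r a m b : List α} (hq : q ≠ [])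
    (hh : q.head hq ≠ v) (hl : q.getLast hq ≠ v) (ha : a = [] ∨ a = [v]) (hb : b = [] ∨ b = [v])
    (h : p ++ q ++ r = a ++ m ++ b) : ∃ c d, p = a ++ c ∧ r = d ++ b ∧ m = c ++ q ++ d := by
  obtain ⟨c, rfl⟩ : ∃ c, p = a ++ c := by
    rcases ha with rfl | rfl
    · exact ⟨p, rfl⟩
    · cases p with
      | nil =>
        obtain ⟨x, q, rfl⟩ := List.exists_cons_of_ne_nil hq
        simp at h
        exact (hh h.1).elim
      | cons x p =>
        simp at h
        exact ⟨p, by simp [h.1]⟩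
  obtain ⟨d, rfl⟩ : ∃ d, r = d ++ b := by
    rcases hb with rfl | rfl
    · exact ⟨r, by simp⟩
    · rcases List.eq_nil_or_concat' r with rfl | ⟨r, x, rfl⟩
      · rcases List.eq_nil_or_concat' q with rfl | ⟨q, x, rfl⟩
        · exact (hq rfl).elim
        · rw [List.append_nil, ← List.append_assoc] at h
          have := (List.append_inj' h rfl).2
          simp at this
          simp [this] at hl
      · rw [← List.append_assoc] at h
        have := (List.append_inj' h rfl).2
        exact ⟨r, by rw [this]⟩
  refine ⟨c, d, rfl, rfl, ?_⟩
  have : a ++ (c ++ q ++ d) ++ b = a ++ m ++ b := by rw [← h]; simp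
  exact (List.append_cancel_left (List.append_cancel_right this)).symm

namespace WordGraph

open DirGraph

variable {A : Type w} {S : WordGraph.{u, w} A} {W : ℕ → A} {v : S.E} (hv : S.IsSupporting v)

lemma InEdge.ne (hv : S.IsSupporting v) (x : S.InEdge v) : x.1 ≠ v := by
  intro h
  refine hv.1.not_isDistributing ?_
  rw [← x.2, h]
  exact hv.2

lemma OutEdge.ne (hv : S.IsSupporting v) (y : S.OutEdge v) : y.1 ≠ v := by
  intro h
  refine hv.1.not_isDistributing ?_
  rw [← h, y.2]
  exact hv.2

lemma eq_of_tgt_eq_tgt (hv : S.IsSupporting v) {e : S.E} (h : S.tgt e = S.tgt v) : e = v :=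
  hv.2.in_unique h rfl

lemma eq_of_src_eq_src (hv : S.IsSupporting v) {e : S.E} (h : S.src e = S.src v) : e = v :=
  hv.1.out_unique h rfl

/-- An edge of `S` other than `v`, as an edge of `S'`. -/
def oldEdge (e : {e : S.E // e ≠ v}) : (S.split v hv).E := Sum.inl e

/-- The edge `vᵢⱼ` of `S'`. -/
def newEdge (x : S.InEdge v) (y : S.OutEdge v) : (S.split v hv).E := Sum.inr (x, y)

/-- A vertex of `S` that is not an end of `v`, as a vertex of `S'`. -/
def oldVertex (z : {x : S.V // x ≠ S.src v ∧ x ≠ S.tgt v}) : (S.split v hv).V := Sum.inl z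

/-- The vertex `Aᵢ` of `S'`. -/
def inVertex (x : S.InEdge v) : (S.split v hv).V := Sum.inr (Sum.inl x)

/-- The vertex `Bⱼ` of `S'`. -/
def outVertex (y : S.OutEdge v) : (S.split v hv).V := Sum.inr (Sum.inr y)

/-- A function on the edges of `S'`, given on the old and on the new edges. -/
def splitElim {β : Type*} (f : {e : S.E // e ≠ v} → β) (g : S.InEdge v → S.OutEdge v → β) :
    (S.split v hv).E → β := Sum.elim f fun xy => g xy.1 xy.2

@[simp] lemma splitElim_old {β : Type*} (f : {e : S.E // e ≠ v} → β)
    (g : S.InEdge v → S.OutEdge v → β) (e) : splitElim hv f g (oldEdge hv e) = f e := rfl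

@[simp] lemma splitElim_new {β : Type*} (f : {e : S.E // e ≠ v} → β)
    (g : S.InEdge v → S.OutEdge v → β) (x y) : splitElim hv f g (newEdge hv x y) = g x y := rfl

lemma split_edge_cases (g : (S.split v hv).E) :
    (∃ e, g = oldEdge hv e) ∨ ∃ x y, g = newEdge hv x y := by
  rcases g with e | ⟨x, y⟩
  exacts [Or.inl ⟨e, rfl⟩, Or.inr ⟨x, y, rfl⟩]

lemma oldEdge_injective : Function.Injective (oldEdge hv) := Sum.inl_injective

lemma newEdge_inj {x x' : S.InEdge v} {y y' : S.OutEdge v} :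
    newEdge hv x y = newEdge hv x' y' ↔ x = x' ∧ y = y' :=
  ⟨fun h => Prod.ext_iff.1 (Sum.inr.inj h), fun h => by rw [h.1, h.2]⟩

lemma oldVertex_injective : Function.Injective (oldVertex hv) := Sum.inl_injective

lemma inVertex_injective : Function.Injective (inVertex hv) :=
  fun _ _ h => Sum.inl.inj (Sum.inr.inj h)

lemma outVertex_injective : Function.Injective (outVertex hv) :=
  fun _ _ h => Sum.inr.inj (Sum.inr.inj h)

lemma oldVertex_ne_inVertex {z x} : oldVertex hv z ≠ inVertex hv x := Sum.inl_ne_inr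

lemma oldVertex_ne_outVertex {z y} : oldVertex hv z ≠ outVertex hv y := Sum.inl_ne_inr

lemma inVertex_ne_outVertex {x y} : inVertex hv x ≠ outVertex hv y :=
  fun h => Sum.inl_ne_inr (Sum.inr.inj h)

lemma split_src_old_pos {e : {e : S.E // e ≠ v}} (h : S.src e.1 = S.tgt v) :
    (S.split v hv).src (oldEdge hv e) = outVertex hv ⟨e.1, h⟩ := dif_pos h

lemma split_src_old_neg {e : {e : S.E // e ≠ v}} (h : S.src e.1 ≠ S.tgt v) :
    (S.split v hv).src (oldEdge hv e) =
      oldVertex hv ⟨S.src e.1, fun h' => e.2 (eq_of_src_eq_src hv h'), h⟩ := dif_neg h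

lemma split_tgt_old_pos {e : {e : S.E // e ≠ v}} (h : S.tgt e.1 = S.src v) :
    (S.split v hv).tgt (oldEdge hv e) = inVertex hv ⟨e.1, h⟩ := dif_pos h

lemma split_tgt_old_neg {e : {e : S.E // e ≠ v}} (h : S.tgt e.1 ≠ S.src v) :
    (S.split v hv).tgt (oldEdge hv e) =
      oldVertex hv ⟨S.tgt e.1, h, fun h' => e.2 (eq_of_tgt_eq_tgt hv h')⟩ := dif_neg h

lemma split_src_old_eq_old {e : {e : S.E // e ≠ v}} {z} :
    (S.split v hv).src (oldEdge hv e) = oldVertex hv z ↔ S.src e.1 = z.1 := by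
  by_cases h : S.src e.1 = S.tgt v
  · rw [split_src_old_pos hv h]
    exact ⟨fun h' => (oldVertex_ne_outVertex hv h'.symm).elim,
      fun h' => (z.2.2 (h'.symm.trans h)).elim⟩
  · rw [split_src_old_neg hv h, (oldVertex_injective hv).eq_iff, Subtype.ext_iff]

lemma split_tgt_old_eq_old {e : {e : S.E // e ≠ v}} {z} :
    (S.split v hv).tgt (oldEdge hv e) = oldVertex hv z ↔ S.tgt e.1 = z.1 := by
  by_cases h : S.tgt e.1 = S.src v
  · rw [split_tgt_old_pos hv h]
    exact ⟨fun h' => (oldVertex_ne_inVertex hv h'.symm).elim,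
      fun h' => (z.2.1 (h'.symm.trans h)).elim⟩
  · rw [split_tgt_old_neg hv h, (oldVertex_injective hv).eq_iff, Subtype.ext_iff]

lemma split_src_old_eq_out {e : {e : S.E // e ≠ v}} {y} :
    (S.split v hv).src (oldEdge hv e) = outVertex hv y ↔ e.1 = y.1 := by
  by_cases h : S.src e.1 = S.tgt v
  · rw [split_src_old_pos hv h, (outVertex_injective hv).eq_iff, Subtype.ext_iff]
  · rw [split_src_old_neg hv h]
    exact ⟨fun h' => (oldVertex_ne_outVertex hv h').elim,
      fun h' => (h (by rw [h']; exact y.2)).elim⟩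

lemma split_tgt_old_eq_in {e : {e : S.E // e ≠ v}} {x} :
    (S.split v hv).tgt (oldEdge hv e) = inVertex hv x ↔ e.1 = x.1 := by
  by_cases h : S.tgt e.1 = S.src v
  · rw [split_tgt_old_pos hv h, (inVertex_injective hv).eq_iff, Subtype.ext_iff]
  · rw [split_tgt_old_neg hv h]
    exact ⟨fun h' => (oldVertex_ne_inVertex hv h').elim,
      fun h' => (h (by rw [h']; exact x.2)).elim⟩

lemma split_src_old_ne_in {e : {e : S.E // e ≠ v}} {x} :
    (S.split v hv).src (oldEdge hv e) ≠ inVertex hv x := by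
  by_cases h : S.src e.1 = S.tgt v
  · rw [split_src_old_pos hv h]
    exact (inVertex_ne_outVertex hv).symm
  · rw [split_src_old_neg hv h]
    exact oldVertex_ne_inVertex hv

lemma split_tgt_old_ne_out {e : {e : S.E // e ≠ v}} {y} :
    (S.split v hv).tgt (oldEdge hv e) ≠ outVertex hv y := by
  by_cases h : S.tgt e.1 = S.src v
  · rw [split_tgt_old_pos hv h]
    exact inVertex_ne_outVertex hv
  · rw [split_tgt_old_neg hv h]
    exact oldVertex_ne_outVertex hv

lemma split_adj_old_old {e f : {e : S.E // e ≠ v}} :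
    (S.split v hv).tgt (oldEdge hv e) = (S.split v hv).src (oldEdge hv f) ↔
      S.tgt e.1 = S.src f.1 := by
  by_cases h : S.tgt e.1 = S.src v
  · rw [split_tgt_old_pos hv h]
    exact ⟨fun h' => (split_src_old_ne_in hv h'.symm).elim,
      fun h' => (f.2 (eq_of_src_eq_src hv (h'.symm.trans h))).elim⟩
  · rw [split_tgt_old_neg hv h, eq_comm, split_src_old_eq_old hv, eq_comm]

lemma split_adj_old_new {e : {e : S.E // e ≠ v}} {x : S.InEdge v} {y : S.OutEdge v} :
    (S.split v hv).tgt (oldEdge hv e) = (S.split v hv).src (newEdge hv x y) ↔ e.1 = x.1 :=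
  split_tgt_old_eq_in hv

lemma split_adj_new_old {f : {e : S.E // e ≠ v}} {x : S.InEdge v} {y : S.OutEdge v} :
    (S.split v hv).tgt (newEdge hv x y) = (S.split v hv).src (oldEdge hv f) ↔ f.1 = y.1 := by
  rw [eq_comm]
  exact split_src_old_eq_out hv

lemma split_adj_new_new {x x' : S.InEdge v} {y y' : S.OutEdge v} :
    (S.split v hv).tgt (newEdge hv x y) ≠ (S.split v hv).src (newEdge hv x' y') :=
  (inVertex_ne_outVertex hv).symm

lemma split_isDistributing_old {z : {x : S.V // x ≠ S.src v ∧ x ≠ S.tgt v}}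
    (h : S.IsDistributing z.1) : (S.split v hv).IsDistributing (oldVertex hv z) := by
  obtain ⟨⟨g, hg, hgu⟩, e, f, hef, he, hf⟩ := h
  have ne : ∀ e, S.src e = z.1 → e ≠ v := fun e he hev => z.2.1 (by rw [← he, hev])
  refine ⟨⟨oldEdge hv ⟨g, fun h => z.2.2 (by rw [← hg, h])⟩, (split_tgt_old_eq_old hv).2 hg, ?_⟩,
    oldEdge hv ⟨e, ne e he⟩, oldEdge hv ⟨f, ne f hf⟩,
    fun h => hef (congrArg Subtype.val (oldEdge_injective hv h)),
    (split_src_old_eq_old hv).2 he, (split_src_old_eq_old hv).2 hf⟩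
  intro g' h
  rcases split_edge_cases hv g' with ⟨g', rfl⟩ | ⟨x, y, rfl⟩
  · exact congrArg _ (Subtype.ext (hgu _ ((split_tgt_old_eq_old hv).1 h)))
  · exact (oldVertex_ne_outVertex hv h.symm).elim

lemma split_isCollecting_old {z : {x : S.V // x ≠ S.src v ∧ x ≠ S.tgt v}}
    (h : S.IsCollecting z.1) : (S.split v hv).IsCollecting (oldVertex hv z) := by
  obtain ⟨⟨e, f, hef, he, hf⟩, g, hg, hgu⟩ := h
  have ne : ∀ e, S.tgt e = z.1 → e ≠ v := fun e he hev => z.2.2 (by rw [← he, hev])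
  refine ⟨⟨oldEdge hv ⟨e, ne e he⟩, oldEdge hv ⟨f, ne f hf⟩,
    fun h => hef (congrArg Subtype.val (oldEdge_injective hv h)),
    (split_tgt_old_eq_old hv).2 he, (split_tgt_old_eq_old hv).2 hf⟩,
    oldEdge hv ⟨g, fun h => z.2.1 (by rw [← hg, h])⟩, (split_src_old_eq_old hv).2 hg, ?_⟩
  intro g' h
  rcases split_edge_cases hv g' with ⟨g', rfl⟩ | ⟨x, y, rfl⟩
  · exact congrArg _ (Subtype.ext (hgu _ ((split_src_old_eq_old hv).1 h)))
  · exact (oldVertex_ne_inVertex hv h.symm).elim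

lemma split_isDistributing_in (x : S.InEdge v) :
    (S.split v hv).IsDistributing (inVertex hv x) := by
  obtain ⟨e, f, hef, he, hf⟩ := hv.2.2
  refine ⟨⟨oldEdge hv ⟨x.1, x.ne hv⟩, (split_tgt_old_eq_in hv).2 rfl, ?_⟩,
    newEdge hv x ⟨e, he⟩, newEdge hv x ⟨f, hf⟩,
    fun h => hef (congrArg Subtype.val ((newEdge_inj hv).1 h).2), rfl, rfl⟩
  intro g' h
  rcases split_edge_cases hv g' with ⟨g', rfl⟩ | ⟨x, y, rfl⟩
  · exact congrArg _ (Subtype.ext ((split_tgt_old_eq_in hv).1 h))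
  · exact (inVertex_ne_outVertex hv h.symm).elim

lemma split_isCollecting_out (y : S.OutEdge v) :
    (S.split v hv).IsCollecting (outVertex hv y) := by
  obtain ⟨e, f, hef, he, hf⟩ := hv.1.1
  refine ⟨⟨newEdge hv ⟨e, he⟩ y, newEdge hv ⟨f, hf⟩ y,
    fun h => hef (congrArg Subtype.val ((newEdge_inj hv).1 h).1), rfl, rfl⟩,
    oldEdge hv ⟨y.1, y.ne hv⟩, (split_src_old_eq_out hv).2 rfl, ?_⟩
  intro g' h
  rcases split_edge_cases hv g' with ⟨g', rfl⟩ | ⟨x, y, rfl⟩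
  · exact congrArg _ (Subtype.ext ((split_src_old_eq_out hv).1 h))
  · exact (inVertex_ne_outVertex hv h).elim

lemma split_vertex (hS : ∀ x, S.IsDistributing x ∨ S.IsCollecting x) :
    ∀ z, (S.split v hv).IsDistributing z ∨ (S.split v hv).IsCollecting z
  | Sum.inl z => (hS z.1).imp (split_isDistributing_old hv) (split_isCollecting_old hv)
  | Sum.inr (Sum.inl x) => Or.inl (split_isDistributing_in hv x)
  | Sum.inr (Sum.inr y) => Or.inr (split_isCollecting_out hv y)

/-- The edge of `S` that an edge of `S'` comes from; the edges `vᵢⱼ` come from `v`. -/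
def splitProj : (S.split v hv).E → S.E := splitElim hv Subtype.val fun _ _ => v

@[simp] lemma splitProj_old (e : {e : S.E // e ≠ v}) : splitProj hv (oldEdge hv e) = e.1 := rfl

@[simp] lemma splitProj_new (x : S.InEdge v) (y : S.OutEdge v) :
    splitProj hv (newEdge hv x y) = v := rfl

lemma eq_old_of_splitProj {g : (S.split v hv).E} {e : S.E} (he : e ≠ v)
    (h : splitProj hv g = e) : g = oldEdge hv ⟨e, he⟩ := by
  rcases split_edge_cases hv g with ⟨f, rfl⟩ | ⟨x, y, rfl⟩
  · exact congrArg _ (Subtype.ext h)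
  · exact (he h.symm).elim

lemma exists_old_of_src_collecting {g : (S.split v hv).E}
    (h : (S.split v hv).IsCollecting ((S.split v hv).src g)) : ∃ e, g = oldEdge hv e := by
  rcases split_edge_cases hv g with ⟨e, rfl⟩ | ⟨x, y, rfl⟩
  · exact ⟨e, rfl⟩
  · exact (h.not_isDistributing (split_isDistributing_in hv x)).elim

lemma exists_old_of_tgt_distributing {g : (S.split v hv).E}
    (h : (S.split v hv).IsDistributing ((S.split v hv).tgt g)) : ∃ e, g = oldEdge hv e := by
  rcases split_edge_cases hv g with ⟨e, rfl⟩ | ⟨x, y, rfl⟩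
  · exact ⟨e, rfl⟩
  · exact (h.not_isCollecting (split_isCollecting_out hv y)).elim

lemma splitProj_adj {g h : (S.split v hv).E} (hgh : (S.split v hv).tgt g = (S.split v hv).src h) :
    S.tgt (splitProj hv g) = S.src (splitProj hv h) := by
  rcases split_edge_cases hv g with ⟨e, rfl⟩ | ⟨x, y, rfl⟩ <;>
    rcases split_edge_cases hv h with ⟨f, rfl⟩ | ⟨x', y', rfl⟩
  · exact (split_adj_old_old hv).1 hgh
  · have := (split_adj_old_new hv).1 hgh
    simp only [splitProj_old, splitProj_new, this]
    exact x'.2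
  · have := (split_adj_new_old hv).1 hgh
    simp only [splitProj_old, splitProj_new, this]
    exact y.2.symm
  · exact (split_adj_new_new hv hgh).elim

lemma isPath_map_splitProj {p : List (S.split v hv).E} (hp : (S.split v hv).IsPath p) :
    S.IsPath (p.map (splitProj hv)) :=
  ⟨by simpa using hp.1, (List.isChain_map _).2 (hp.2.imp fun _ _ h => splitProj_adj hv h)⟩

lemma split_outLabel_old_pos {e : {e : S.E // e ≠ v}} (h : S.src e.1 = S.tgt v) :
    (S.split v hv).outLabel (oldEdge hv e) = [] := by
  refine outLabel_of_collecting ?_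
  rw [split_src_old_pos hv h]
  exact split_isCollecting_out hv _

lemma split_outLabel_old_neg (hS : ∀ x, S.IsDistributing x ∨ S.IsCollecting x)
    {e : {e : S.E // e ≠ v}} (h : S.src e.1 ≠ S.tgt v) :
    (S.split v hv).outLabel (oldEdge hv e) = S.outLabel e.1 := by
  rcases hS (S.src e.1) with hd | hc
  · rw [outLabel_of_distributing hd, outLabel_of_distributing]
    · exact if_neg h
    · rw [split_src_old_neg hv h]
      exact split_isDistributing_old hv hd
  · rw [outLabel_of_collecting hc, outLabel_of_collecting]
    rw [split_src_old_neg hv h]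
    exact split_isCollecting_old hv hc

lemma split_inLabel_old_pos {e : {e : S.E // e ≠ v}} (h : S.tgt e.1 = S.src v) :
    (S.split v hv).inLabel (oldEdge hv e) = [] := by
  refine inLabel_of_distributing ?_
  rw [split_tgt_old_pos hv h]
  exact split_isDistributing_in hv _

lemma split_inLabel_old_neg (hS : ∀ x, S.IsDistributing x ∨ S.IsCollecting x)
    {e : {e : S.E // e ≠ v}} (h : S.tgt e.1 ≠ S.src v) :
    (S.split v hv).inLabel (oldEdge hv e) = S.inLabel e.1 := by
  rcases hS (S.tgt e.1) with hd | hc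
  · rw [inLabel_of_distributing hd, inLabel_of_distributing]
    rw [split_tgt_old_neg hv h]
    exact split_isDistributing_old hv hd
  · rw [inLabel_of_collecting hc, inLabel_of_collecting]
    · exact if_neg h
    · rw [split_tgt_old_neg hv h]
      exact split_isCollecting_old hv hc

lemma split_outLabel_new (x : S.InEdge v) (y : S.OutEdge v) :
    (S.split v hv).outLabel (newEdge hv x y) = S.front y.1 :=
  outLabel_of_distributing (split_isDistributing_in hv x)

lemma split_inLabel_new (x : S.InEdge v) (y : S.OutEdge v) :
    (S.split v hv).inLabel (newEdge hv x y) = S.back x.1 :=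
  inLabel_of_collecting (split_isCollecting_out hv y)

open scoped Classical in
/-- The copy of `v` to be put before a path of `S'` that begins with `g`, to make its image in `S`
symmetric. -/
noncomputable def splitPre : (S.split v hv).E → List S.E :=
  splitElim hv (fun e => if S.src e.1 = S.tgt v then [v] else []) fun _ _ => []

open scoped Classical in
/-- The copy of `v` to be put after a path of `S'` that ends with `g`. -/
noncomputable def splitPost : (S.split v hv).E → List S.E :=
  splitElim hv (fun e => if S.tgt e.1 = S.src v then [v] else []) fun _ _ => []

/-- The symmetric path of `S` that a symmetric path of `S'` comes from: its image, with `v` added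
at the ends where it would otherwise begin at the end of `v` or end at the beginning of `v`. -/
noncomputable def unsplit (p : List (S.split v hv).E) : List S.E :=
  p.head?.toList.flatMap (splitPre hv) ++ p.map (splitProj hv) ++
    p.getLast?.toList.flatMap (splitPost hv)

lemma splitPre_eq (g : (S.split v hv).E) : splitPre hv g = [] ∨ splitPre hv g = [v] := by
  rcases split_edge_cases hv g with ⟨e, rfl⟩ | ⟨x, y, rfl⟩
  · by_cases h : S.src e.1 = S.tgt v <;> simp [splitPre, h]
  · exact Or.inl rfl

lemma splitPost_eq (g : (S.split v hv).E) : splitPost hv g = [] ∨ splitPost hv g = [v] := by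
  rcases split_edge_cases hv g with ⟨e, rfl⟩ | ⟨x, y, rfl⟩
  · by_cases h : S.tgt e.1 = S.src v <;> simp [splitPost, h]
  · exact Or.inl rfl

lemma unsplit_eq {p : List (S.split v hv).E} (hp : p ≠ []) :
    unsplit hv p = splitPre hv (p.head hp) ++ p.map (splitProj hv) ++
      splitPost hv (p.getLast hp) := by
  simp [unsplit, List.head?_eq_some_head hp, List.getLast?_eq_some_getLast hp]

/-- A symmetric path begins and ends with edges that are edges of `S`. -/
lemma symmetric_ends {p : List (S.split v hv).E} (hp : (S.split v hv).IsSymmetric p) :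
    (∃ e, p.head hp.1.1 = oldEdge hv e) ∧ ∃ f, p.getLast hp.1.1 = oldEdge hv f := by
  obtain ⟨hp, ⟨g, hg, hgc⟩, ⟨h, hh, hhd⟩⟩ := hp
  rw [List.head?_eq_some_head hp.1] at hg
  rw [List.getLast?_eq_some_getLast hp.1] at hh
  cases hg
  cases hh
  exact ⟨exists_old_of_src_collecting hv hgc, exists_old_of_tgt_distributing hv hhd⟩

lemma unsplit_isSymmetric (hS : ∀ x, S.IsDistributing x ∨ S.IsCollecting x)
    {p : List (S.split v hv).E} (hp : (S.split v hv).IsSymmetric p) :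
    S.IsSymmetric (unsplit hv p) := by
  obtain ⟨⟨e, he⟩, ⟨f, hf⟩⟩ := symmetric_ends hv hp
  obtain ⟨hp, ⟨g, hg, hgc⟩, ⟨h, hh, hhd⟩⟩ := hp
  rw [List.head?_eq_some_head hp.1, he] at hg
  rw [List.getLast?_eq_some_getLast hp.1, hf] at hh
  cases hg
  cases hh
  rw [unsplit_eq hv hp.1, he, hf]
  have hmap := isPath_map_splitProj hv hp
  have hhead : (p.map (splitProj hv)).head? = some e.1 := by
    rw [List.head?_map, List.head?_eq_some_head hp.1, he]; rfl
  have hlast : (p.map (splitProj hv)).getLast? = some f.1 := by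
    rw [List.getLast?_map, List.getLast?_eq_some_getLast hp.1, hf]; rfl
  have h1 : S.IsPath (splitPre hv (oldEdge hv e) ++ p.map (splitProj hv)) ∧
      S.StartsIn S.IsCollecting (splitPre hv (oldEdge hv e) ++ p.map (splitProj hv)) := by
    by_cases h : S.src e.1 = S.tgt v
    · have e1 : splitPre hv (oldEdge hv e) = [v] := by simp [splitPre, h]
      rw [e1]
      refine ⟨⟨by simp, ?_⟩, by simpa using hv.1⟩
      rw [List.isChain_append]
      refine ⟨by simp, hmap.2, ?_⟩
      rw [hhead]
      simpa using h.symm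
    · have e1 : splitPre hv (oldEdge hv e) = [] := by simp [splitPre, h]
      rw [e1, List.nil_append]
      refine ⟨hmap, e.1, hhead, (hS _).resolve_left fun hd => ?_⟩
      rw [split_src_old_neg hv h] at hgc
      exact hgc.not_isDistributing (split_isDistributing_old hv hd)
  have hne := h1.1.1
  have hlast' : (splitPre hv (oldEdge hv e) ++ p.map (splitProj hv)).getLast? = some f.1 := by
    rw [List.getLast?_append_of_ne_nil _ hmap.1, hlast]
  by_cases h : S.tgt f.1 = S.src v
  · have e1 : splitPost hv (oldEdge hv f) = [v] := by simp [splitPost, h]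
    rw [e1]
    refine ⟨⟨by simp, ?_⟩, (startsIn_append hne).2 h1.2, endsIn_concat.2 hv.2⟩
    rw [List.isChain_append, hlast']
    exact ⟨h1.1.2, by simp, by simpa using h⟩
  · have e1 : splitPost hv (oldEdge hv f) = [] := by simp [splitPost, h]
    rw [e1, List.append_nil]
    refine ⟨h1.1, h1.2, f.1, hlast', (hS _).resolve_right fun hc => ?_⟩
    rw [split_tgt_old_neg hv h] at hhd
    exact hhd.not_isCollecting (split_isCollecting_old hv hc)

open scoped Classical in
/-- A symmetric path of `S'` has the front word of the path of `S` that it comes from. -/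
lemma split_frontWord (hS : ∀ x, S.IsDistributing x ∨ S.IsCollecting x)
    {p : List (S.split v hv).E} (hp : (S.split v hv).IsSymmetric p) :
    (S.split v hv).frontWord p = S.frontWord (unsplit hv p) := by
  obtain ⟨⟨e, he⟩, ⟨f, hf⟩⟩ := symmetric_ends hv hp
  rw [unsplit_eq hv hp.1.1, he, hf]
  obtain ⟨g, p, rfl⟩ := List.exists_cons_of_ne_nil hp.1.1
  obtain rfl : g = oldEdge hv e := he
  have hsrc : (S.split v hv).IsCollecting ((S.split v hv).src (oldEdge hv e)) := by
    simpa using hp.2.1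
  -- the front word of `yⱼ` is read at `vᵢⱼ` in `S'` and at `yⱼ` in `S`
  have tele := hp.1.2.flatMap_telescope (f := fun g => S.outLabel (splitProj hv g))
    (f' := (S.split v hv).outLabel)
    (i := splitElim hv (fun e => if S.src e.1 = S.tgt v then S.front e.1 else []) fun _ _ => [])
    (o := splitElim hv (fun _ => []) fun _ y => S.front y.1)
    (by
      intro g
      rcases split_edge_cases hv g with ⟨e, rfl⟩ | ⟨x, y, rfl⟩
      · by_cases h : S.src e.1 = S.tgt v
        · have : S.IsDistributing (S.src e.1) := by rw [h]; exact hv.2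
          simp [h, split_outLabel_old_pos hv h, outLabel_of_distributing this]
        · simp [h, split_outLabel_old_neg hv hS h]
      · simp [split_outLabel_new, outLabel_of_collecting hv.1])
    (by
      intro g h hgh
      rcases split_edge_cases hv g with ⟨e, rfl⟩ | ⟨x, y, rfl⟩ <;>
        rcases split_edge_cases hv h with ⟨f, rfl⟩ | ⟨x', y', rfl⟩
      · have h1 := (split_adj_old_old hv).1 hgh
        have h2 : S.src f.1 ≠ S.tgt v := fun h2 => e.2 (eq_of_tgt_eq_tgt hv (h1.trans h2))
        simp [h2]
      · rfl
      · have h1 := (split_adj_new_old hv).1 hgh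
        simp [h1, y.2]
      · exact (split_adj_new_new hv hgh).elim)
  rw [hf] at tele
  have hpost : (splitPost hv (oldEdge hv f)).flatMap S.outLabel = [] := by
    rcases splitPost_eq hv (oldEdge hv f) with h | h <;> simp [h, outLabel_of_collecting hv.1]
  rw [List.flatMap_cons (f := (S.split v hv).outLabel), outLabel_of_collecting hsrc] at tele
  rw [frontWord_cons, frontWord_append (by simp), hpost, List.append_nil]
  by_cases h : S.src e.1 = S.tgt v
  · have e1 : splitPre hv (oldEdge hv e) = [v] := by simp [splitPre, h]
    have e2 : (S.split v hv).front (oldEdge hv e) = S.front v ++ S.front e.1 := if_pos h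
    rw [e1, e2, List.singleton_append, frontWord_cons, List.flatMap_map, List.append_assoc]
    congr 1
    simpa [h] using tele
  · have e1 : splitPre hv (oldEdge hv e) = [] := by simp [splitPre, h]
    have e2 : (S.split v hv).front (oldEdge hv e) = S.front e.1 := if_neg h
    have e3 : S.IsCollecting (S.src e.1) := (hS _).resolve_left fun hd => by
      rw [split_src_old_neg hv h] at hsrc
      exact hsrc.not_isDistributing (split_isDistributing_old hv hd)
    rw [e1, e2, List.nil_append, List.map_cons, splitProj_old, frontWord_cons, List.flatMap_map]
    congr 1
    simpa [h, outLabel_of_collecting e3] using tele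

open scoped Classical in
/-- A symmetric path of `S'` has the back word of the path of `S` that it comes from. -/
lemma split_backWord (hS : ∀ x, S.IsDistributing x ∨ S.IsCollecting x)
    (hvw : S.front v = S.back v) {p : List (S.split v hv).E} (hp : (S.split v hv).IsSymmetric p) :
    (S.split v hv).backWord p = S.backWord (unsplit hv p) := by
  obtain ⟨⟨e, he⟩, ⟨f, hf⟩⟩ := symmetric_ends hv hp
  rw [unsplit_eq hv hp.1.1, he, hf]
  -- the back word of `xᵢ` is read at `vᵢⱼ` in `S'` and at `xᵢ` in `S`
  have tele : ∀ g p', p = g :: p' → _ := fun g p' h =>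
    List.IsChain.flatMap_telescope (a := g) (p := p')
    (f := (S.split v hv).inLabel) (f' := fun g => S.inLabel (splitProj hv g))
    (o := splitElim hv (fun e => if S.tgt e.1 = S.src v then S.back e.1 else []) fun _ _ => [])
    (i := splitElim hv (fun _ => []) fun x _ => S.back x.1)
    (by
      intro g
      rcases split_edge_cases hv g with ⟨e, rfl⟩ | ⟨x, y, rfl⟩
      · by_cases h : S.tgt e.1 = S.src v
        · have : S.IsCollecting (S.tgt e.1) := by rw [h]; exact hv.1
          simp [h, split_inLabel_old_pos hv h, inLabel_of_collecting this]
        · simp [h, split_inLabel_old_neg hv hS h]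
      · simp [split_inLabel_new, inLabel_of_distributing hv.2])
    (by
      intro g h hgh
      rcases split_edge_cases hv g with ⟨e, rfl⟩ | ⟨x, y, rfl⟩ <;>
        rcases split_edge_cases hv h with ⟨f, rfl⟩ | ⟨x', y', rfl⟩
      · have h1 := (split_adj_old_old hv).1 hgh
        have h2 : S.tgt e.1 ≠ S.src v := fun h2 => f.2 (eq_of_src_eq_src hv (h1.symm.trans h2))
        simp [h2]
      · have h1 := (split_adj_old_new hv).1 hgh
        simp [h1, x'.2]
      · rfl
      · exact (split_adj_new_new hv hgh).elim)
    (h ▸ hp.1.2)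
  obtain ⟨g, p', hgp⟩ := List.exists_cons_of_ne_nil hp.1.1
  have htele := tele g p' hgp
  have hge : g = oldEdge hv e := by
    subst hgp
    exact he
  have hlast : (g :: p').getLast (List.cons_ne_nil g p') = oldEdge hv f := by
    subst hgp
    exact hf
  rw [hlast, hge, ← hge, ← hgp] at htele
  rcases List.eq_nil_or_concat' p with rfl | ⟨q, g', rfl⟩
  · exact (hp.1.1 rfl).elim
  obtain rfl : g' = oldEdge hv f := by simpa using hf
  have htgt : (S.split v hv).IsDistributing ((S.split v hv).tgt (oldEdge hv f)) := by
    simpa using hp.2.2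
  have hpre : (splitPre hv (oldEdge hv e)).flatMap S.inLabel = [] := by
    rcases splitPre_eq hv (oldEdge hv e) with h | h <;> simp [h, inLabel_of_distributing hv.2]
  rw [List.flatMap_append (f := (S.split v hv).inLabel), List.flatMap_singleton,
    inLabel_of_distributing htgt, List.append_nil, hge] at htele
  rw [backWord_concat, List.append_assoc, backWord_append _ (by simp), hpre, List.nil_append]
  by_cases h : S.tgt f.1 = S.src v
  · have e1 : splitPost hv (oldEdge hv f) = [v] := by simp [splitPost, h]
    have e2 : (S.split v hv).back (oldEdge hv f) = S.back f.1 ++ S.front v := if_pos h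
    rw [e1, e2, backWord_concat, List.flatMap_map, ← List.append_assoc, hvw]
    congr 1
    simpa [h] using htele.symm
  · have e1 : splitPost hv (oldEdge hv f) = [] := by simp [splitPost, h]
    have e2 : (S.split v hv).back (oldEdge hv f) = S.back f.1 := if_neg h
    have e3 : S.IsDistributing (S.tgt f.1) := (hS _).resolve_right fun hc => by
      rw [split_tgt_old_neg hv h] at htgt
      exact htgt.not_isCollecting (split_isCollecting_old hv hc)
    rw [e1, e2, List.append_nil, List.map_append, List.map_singleton, splitProj_old,
      backWord_concat, List.flatMap_map]
    congr 1
    simpa [h, inLabel_of_distributing e3] using htele.symm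

end WordGraph

/-! ### Lifting paths to the split graph -/

namespace WordGraph

open DirGraph

variable {A : Type w} {S : WordGraph.{u, w} A} {W : ℕ → A} {v : S.E} (hv : S.IsSupporting v)

lemma isGood_old (e : {e : S.E // e ≠ v}) : S.IsGood W v hv (oldEdge hv e) := trivial

lemma isGood_new {x : S.InEdge v} {y : S.OutEdge v} : S.IsGood W v hv (newEdge hv x y) ↔
    IsFactor W (S.back x.1 ++ S.front v ++ S.front y.1) := Iff.rfl

/-- A path of `S` lifts to a path of good edges of `S'` if `v` is not at its ends and if the words
around its passages of `v` are factors of `W`. -/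
lemma exists_lift : ∀ {s : List S.E} (hs : S.IsPath s), s.head hs.1 ≠ v → s.getLast hs.1 ≠ v →
    (∀ x y, [x, v, y] <:+: s → IsFactor W (S.back x ++ S.front v ++ S.front y)) →
    ∃ p, (S.split v hv).IsPath p ∧ p.map (splitProj hv) = s ∧ ∀ g ∈ p, S.IsGood W v hv g
  | [], hs, _, _, _ => (hs.1 rfl).elim
  | [e], _, he, _, _ => ⟨[oldEdge hv ⟨e, he⟩], ⟨by simp, by simp⟩, by simp, by simp [isGood_old]⟩
  | e :: f :: s, hs, he, hl, hgood => by
    have hef := List.isChain_cons_cons.1 hs.2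
    by_cases hf : f = v
    · have hf' := hf.symm
      subst hf'
      cases s with
      | nil => simp at hl
      | cons y s =>
        have hfy := List.isChain_cons_cons.1 hef.2
        have hy : y ≠ v := OutEdge.ne hv ⟨y, hfy.1.symm⟩
        obtain ⟨p, hp, hps, hpg⟩ := exists_lift (s := y :: s) ⟨by simp, hfy.2⟩ hy
          (by simpa using hl) (fun x z h => hgood x z (h.trans ⟨[e, v], [], by simp⟩))
        obtain ⟨g, p, rfl⟩ := List.exists_cons_of_ne_nil hp.1
        simp only [List.map_cons, List.cons.injEq] at hps
        obtain rfl := eq_old_of_splitProj hv hy hps.1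
        refine ⟨oldEdge hv ⟨e, he⟩ :: newEdge hv ⟨e, hef.1⟩ ⟨y, hfy.1.symm⟩ ::
          oldEdge hv ⟨y, hy⟩ :: p, ⟨by simp, ?_⟩, by simp [hps.2], ?_⟩
        · exact List.isChain_cons_cons.2 ⟨(split_adj_old_new hv).2 rfl,
            List.isChain_cons_cons.2 ⟨(split_adj_new_old hv).2 rfl, hp.2⟩⟩
        · intro g hg
          rcases List.mem_cons.1 hg with rfl | hg
          · exact isGood_old hv _
          · rcases List.mem_cons.1 hg with rfl | hg
            · exact (isGood_new hv).2 (hgood e y ⟨[], s, by simp⟩)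
            · exact hpg g hg
    · obtain ⟨p, hp, hps, hpg⟩ := exists_lift (s := f :: s) ⟨by simp, hef.2⟩ hf
        (by simpa using hl) (fun x z h => hgood x z (h.trans ⟨[e], [], by simp⟩))
      obtain ⟨g, p, rfl⟩ := List.exists_cons_of_ne_nil hp.1
      simp only [List.map_cons, List.cons.injEq] at hps
      obtain rfl := eq_old_of_splitProj hv hf hps.1
      refine ⟨oldEdge hv ⟨e, he⟩ :: oldEdge hv ⟨f, hf⟩ :: p, ⟨by simp, ?_⟩, by simp [hps.2], ?_⟩
      · rw [List.isChain_cons_cons]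
        exact ⟨(split_adj_old_old hv).2 hef.1, hp.2⟩
      · intro g hg
        rcases List.mem_cons.1 hg with rfl | hg
        · exact isGood_old hv _
        · exact hpg g hg

/-- A path of `S'` whose last edge is old is determined by its image in `S` and its first edge. -/
lemma lift_unique : ∀ {p q : List (S.split v hv).E} {g : (S.split v hv).E},
    (S.split v hv).IsPath (g :: p) → (S.split v hv).IsPath (g :: q) →
    p.map (splitProj hv) = q.map (splitProj hv) →
    (∃ f, (g :: p).getLast (List.cons_ne_nil g p) = oldEdge hv f) → p = q
  | [], q, g, _, _, h, _ => by
    rw [List.map_nil, eq_comm, List.map_eq_nil_iff] at h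
    exact h.symm
  | k :: p, q, g, hp, hq, h, hl => by
    obtain ⟨k', q, rfl⟩ : ∃ k' q', q = k' :: q' := List.exists_cons_of_ne_nil (by
      rintro rfl
      simp at h)
    have hp1 := List.isChain_cons_cons.1 hp.2
    have hq1 := List.isChain_cons_cons.1 hq.2
    simp only [List.map_cons, List.cons.injEq] at h
    have hl' : ∃ f, (k :: p).getLast (List.cons_ne_nil k p) = oldEdge hv f := by simpa using hl
    obtain rfl : k = k' := by
      rcases split_edge_cases hv k with ⟨e, rfl⟩ | ⟨x, y, rfl⟩
      · exact (eq_old_of_splitProj hv e.2 h.1.symm).symm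
      · rcases split_edge_cases hv k' with ⟨e', rfl⟩ | ⟨x', y', rfl⟩
        · exact (e'.2 h.1.symm).elim
        · have hx : x = x' := inVertex_injective hv (hp1.1.symm.trans hq1.1)
          cases p with
          | nil =>
            obtain ⟨f, hf⟩ := hl'
            exact (Sum.inr_ne_inl hf).elim
          | cons m p =>
            obtain ⟨m', q, rfl⟩ : ∃ m' q', q = m' :: q' := List.exists_cons_of_ne_nil (by
              rintro rfl
              simp at h)
            have hp2 := List.isChain_cons_cons.1 hp1.2
            have hq2 := List.isChain_cons_cons.1 hq1.2
            simp only [List.map_cons, List.cons.injEq] at h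
            rcases split_edge_cases hv m with ⟨e, rfl⟩ | ⟨a, b, rfl⟩
            · obtain rfl := eq_old_of_splitProj hv e.2 h.2.1.symm
              have h1 := (split_adj_new_old hv).1 hp2.1
              have h2 := (split_adj_new_old hv).1 hq2.1
              rw [hx, show y = y' from Subtype.ext (h1.symm.trans h2)]
            · exact (split_adj_new_new hv hp2.1).elim
    rw [lift_unique ⟨by simp, hp1.2⟩ ⟨by simp, hq1.2⟩ h.2 hl']

lemma symmetric_head_ne {p : List (S.split v hv).E} (hp : (S.split v hv).IsSymmetric p)
    (h : p.map (splitProj hv) ≠ []) : (p.map (splitProj hv)).head h ≠ v ∧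
      (p.map (splitProj hv)).getLast h ≠ v := by
  obtain ⟨⟨e, he⟩, ⟨f, hf⟩⟩ := symmetric_ends hv hp
  rw [List.head_map, List.getLast_map, he, hf]
  exact ⟨e.2, f.2⟩

/-- The occurrences of a symmetric path of `S'` in another one correspond, up to a shift, to the
occurrences of the paths of `S` that they come from. -/
lemma exists_of_unsplit {p q : List (S.split v hv).E} (hp : (S.split v hv).IsSymmetric p)
    (hq : (S.split v hv).IsPath q) {a b : List S.E} (h : unsplit hv q = a ++ unsplit hv p ++ b) :
    ∃ c d, q = c ++ p ++ d ∧ a.length + (splitPre hv (p.head hp.1.1)).length =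
      (splitPre hv (q.head hq.1)).length + c.length := by
  rw [unsplit_eq hv hp.1.1, unsplit_eq hv hq.1] at h
  have hne : p.map (splitProj hv) ≠ [] := by simpa using hp.1.1
  obtain ⟨c, d, h1, h2, h3⟩ := List.exists_of_append_eq_pad
    (p := a ++ splitPre hv (p.head hp.1.1)) (r := splitPost hv (p.getLast hp.1.1) ++ b) hne
    (symmetric_head_ne hv hp hne).1 (symmetric_head_ne hv hp hne).2 (splitPre_eq hv _)
    (splitPost_eq hv _) (by rw [h]; simp)
  rw [List.map_eq_append_iff] at h3
  obtain ⟨cp, d', rfl, h4, rfl⟩ := h3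
  rw [List.map_eq_append_iff] at h4
  obtain ⟨c', p', rfl, rfl, h5⟩ := h4
  obtain ⟨⟨e, he⟩, ⟨f, hf⟩⟩ := symmetric_ends hv hp
  have hp' : p' = p := by
    obtain ⟨g, p, rfl⟩ := List.exists_cons_of_ne_nil hp.1.1
    obtain ⟨g', p', rfl⟩ : ∃ g' q', p' = g' :: q' := List.exists_cons_of_ne_nil (by
      rintro rfl
      simp at h5)
    obtain rfl : g = oldEdge hv e := he
    simp only [List.map_cons, List.cons.injEq] at h5
    obtain rfl := eq_old_of_splitProj hv e.2 h5.1
    rw [lift_unique hv hp.1 (hq.of_infix ⟨c', d', by simp⟩ (by simp)) h5.2.symm ⟨f, hf⟩]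
  subst hp'
  refine ⟨c', d', rfl, ?_⟩
  have := congrArg List.length h1
  simpa using this

end WordGraph

namespace WordGraph.IsRauzyScheme

open DirGraph

variable {A : Type w} {S : WordGraph.{u, w} A} {W : ℕ → A} {v : S.E} (hS : S.IsRauzyScheme W)
  (hv : S.IsSupporting v)
include hS

lemma front_eq_back_of_isSupporting (hv : S.IsSupporting v) : S.front v = S.back v := by
  have := hS.front_eq_back _ hv.isSymmetric
  have h1 : S.frontWord [v] = S.front v := by simp [frontWord_cons]
  have h2 : S.backWord ([] ++ [v]) = S.back v := by simp only [backWord_concat]; simp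
  rw [h1] at this
  exact this.trans h2

/-- The word around a passage of `v` is read along every symmetric path with that passage. -/
lemma triple_infix (hv : S.IsSupporting v) {s : List S.E} (hs : S.IsSymmetric s) {x y : S.E}
    (h : [x, v, y] <:+: s) : S.back x ++ S.front v ++ S.front y <:+: S.frontWord s := by
  obtain ⟨p, r, rfl⟩ := h
  have hxv : S.tgt x = S.src v := IsPath.tgt_eq_src (p := p) (q := y :: r) (by simpa using hs.1)
  have hvy : S.tgt v = S.src y := IsPath.tgt_eq_src (p := p ++ [x]) (q := r) (by simpa using hs.1)
  have hsym : S.IsSymmetric (p ++ [x] ++ [v]) := by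
    have : p ++ [x, v, y] ++ r = (p ++ [x]) ++ [v] ++ (y :: r) := by simp
    rw [this] at hs
    exact hs.prefix hv.isSymmetric
  have h1 : S.frontWord (p ++ [x, v, y] ++ r) = p.flatMap S.inLabel ++
      (S.back x ++ S.front v ++ S.front y) ++ r.flatMap S.outLabel := by
    have e1 : p ++ [x, v, y] ++ r = (p ++ [x] ++ [v]) ++ (y :: r) := by simp
    rw [e1, frontWord_append (by simp), hS.front_eq_back _ hsym, backWord_concat,
      ← hS.front_eq_back_of_isSupporting hv, List.flatMap_append,
      List.flatMap_cons (f := S.outLabel),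
      outLabel_of_distributing (by rw [← hvy]; exact hv.2), List.flatMap_singleton,
      inLabel_of_collecting (by rw [hxv]; exact hv.1)]
    simp
  rw [h1]
  exact List.infix_append _ _ _

/-- Any two old edges of `S'` are joined by a path of good edges that reads a given factor of
`W`. If that path is symmetric, its word is a factor of `W`. -/
theorem exists_good_link (hW : IsRecurrentWord W) (e f : {e : S.E // e ≠ v}) {x : List A}
    (hx : IsFactor W x) : ∃ p, (S.split v hv).IsPath (oldEdge hv e :: p ++ [oldEdge hv f]) ∧
      (∀ g ∈ oldEdge hv e :: p ++ [oldEdge hv f], S.IsGood W v hv g) ∧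
      ((S.split v hv).IsSymmetric (oldEdge hv e :: p ++ [oldEdge hv f]) →
        IsFactor W ((S.split v hv).frontWord (oldEdge hv e :: p ++ [oldEdge hv f])) ∧
        x <:+: (S.split v hv).frontWord (oldEdge hv e :: p ++ [oldEdge hv f])) := by
  obtain ⟨t₁, ht₁, hf₁, hm₁⟩ := hS.exists_isSymmetric_mem hW e.1
  obtain ⟨t₂, ht₂, hf₂, hm₂⟩ := hS.exists_isSymmetric_mem hW f.1
  obtain ⟨m, hm, hmf, hxm⟩ := hS.exists_link hW ht₁ ht₂ hf₁ hf₂ hx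
  obtain ⟨a₁, b₁, rfl⟩ := List.append_of_mem hm₁
  obtain ⟨a₂, b₂, rfl⟩ := List.append_of_mem hm₂
  set k := b₁ ++ m ++ a₂ with hk
  set s := a₁ ++ e.1 :: b₁ ++ m ++ (a₂ ++ f.1 :: b₂) with hs
  have hsk : s = a₁ ++ (e.1 :: k ++ [f.1]) ++ b₂ := by simp [hs, hk]
  have hpath : S.IsPath (e.1 :: k ++ [f.1]) := hm.1.of_infix ⟨a₁, b₂, hsk.symm⟩ (by simp)
  obtain ⟨p, hp, hpk, hpg⟩ := exists_lift (W := W) hv hpath (by simpa using e.2)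
    (by simpa using f.2) (fun x y h => hmf.of_infix
      (hS.triple_infix hv hm (h.trans ⟨a₁, b₂, hsk.symm⟩)))
  have hp' : ∃ q, p = oldEdge hv e :: q ++ [oldEdge hv f] := by
    rw [List.map_eq_append_iff] at hpk
    obtain ⟨p₁, p₂, rfl, h1, h2⟩ := hpk
    rw [List.map_eq_cons_iff] at h1 h2
    obtain ⟨g, q, rfl, h3, -⟩ := h1
    obtain ⟨g', q', rfl, h4, h5⟩ := h2
    rw [List.map_eq_nil_iff] at h5
    rw [eq_old_of_splitProj hv e.2 h3, eq_old_of_splitProj hv f.2 h4, h5]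
    exact ⟨q, rfl⟩
  obtain ⟨q, rfl⟩ := hp'
  refine ⟨q, hp, hpg, fun hsym => ?_⟩
  have hun := unsplit_isSymmetric hv hS.vertex hsym
  rw [split_frontWord hv hS.vertex hsym]
  have hpk' : unsplit hv (oldEdge hv e :: q ++ [oldEdge hv f]) =
      splitPre hv (oldEdge hv e) ++ (e.1 :: k ++ [f.1]) ++ splitPost hv (oldEdge hv f) := by
    rw [unsplit_eq hv hp.1, hpk]
    simp
  have hpath' := hm.1
  rw [hsk] at hpath'
  -- the copies of `v` that are added to the path are present in `s`
  have hpre : ∃ a, a₁ = a ++ splitPre hv (oldEdge hv e) := by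
    by_cases h : S.src e.1 = S.tgt v
    · have e1 : splitPre hv (oldEdge hv e) = [v] := by simp [splitPre, h]
      rw [e1]
      rcases List.eq_nil_or_concat' a₁ with rfl | ⟨a, g, rfl⟩
      · have h1 : S.IsCollecting (S.src e.1) := by simpa [hs] using hm.2.1
        rw [h] at h1
        exact (h1.not_isDistributing hv.2).elim
      · have h1 : S.tgt g = S.src e.1 :=
          IsPath.tgt_eq_src (p := a) (q := k ++ [f.1] ++ b₂) (by simpa using hpath')
        exact ⟨a, by rw [eq_of_tgt_eq_tgt hv (h1.trans h)]⟩
    · exact ⟨a₁, by simp [splitPre, h]⟩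
  have hpost : ∃ b, b₂ = splitPost hv (oldEdge hv f) ++ b := by
    by_cases h : S.tgt f.1 = S.src v
    · have e1 : splitPost hv (oldEdge hv f) = [v] := by simp [splitPost, h]
      rw [e1]
      cases b₂ with
      | nil =>
        have h1 : S.IsDistributing (S.tgt f.1) := by
          have := hm.2.2
          rw [hsk, List.append_nil, ← List.append_assoc] at this
          exact endsIn_concat.1 this
        rw [h] at h1
        exact (h1.not_isCollecting hv.1).elim
      | cons g b =>
        have h1 : S.tgt f.1 = S.src g :=
          IsPath.tgt_eq_src (p := a₁ ++ e.1 :: k) (q := b) (by simpa using hpath')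
        exact ⟨b, by rw [eq_of_src_eq_src hv (h1.symm.trans h)]; rfl⟩
    · exact ⟨b₂, by simp [splitPost, h]⟩
  obtain ⟨a, ha⟩ := hpre
  obtain ⟨b, hb⟩ := hpost
  have hinf : unsplit hv (oldEdge hv e :: q ++ [oldEdge hv f]) <:+: s := by
    refine ⟨a, b, ?_⟩
    rw [hpk', hsk, ha, hb]
    simp
  refine ⟨hmf.of_infix (hS.frontWord_infix hm hun hinf), hxm.trans ?_⟩
  have hdec : unsplit hv (oldEdge hv e :: q ++ [oldEdge hv f]) =
      (splitPre hv (oldEdge hv e) ++ e.1 :: b₁) ++ m ++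
        (a₂ ++ f.1 :: splitPost hv (oldEdge hv f)) := by
    rw [hpk', hk]
    simp
  rw [hdec, List.append_assoc, frontWord_append (by simp), List.flatMap_append,
    ← List.append_assoc]
  exact List.infix_append _ _ _

/-- Any two good edges are the first and the last edge of a path of good edges. -/
theorem exists_good_path (hW : IsRecurrentWord W) {g h : (S.split v hv).E}
    (hg : S.IsGood W v hv g) (hh : S.IsGood W v hv h) :
    ∃ p, (S.split v hv).IsPath (g :: p ++ [h]) ∧ ∀ k ∈ g :: p ++ [h], S.IsGood W v hv k := by
  have step1 : ∀ f : {e : S.E // e ≠ v}, ∃ p, (S.split v hv).IsPath (g :: p ++ [oldEdge hv f]) ∧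
      ∀ k ∈ g :: p ++ [oldEdge hv f], S.IsGood W v hv k := by
    intro f
    rcases split_edge_cases hv g with ⟨e, rfl⟩ | ⟨x, y, rfl⟩
    · obtain ⟨p, hp, hpg, -⟩ := hS.exists_good_link hv hW e f (x := []) ⟨0, 0, rfl⟩
      exact ⟨p, hp, hpg⟩
    · obtain ⟨p, hp, hpg, -⟩ := hS.exists_good_link hv hW ⟨y.1, y.ne hv⟩ f (x := []) ⟨0, 0, rfl⟩
      refine ⟨oldEdge hv ⟨y.1, y.ne hv⟩ :: p, ⟨by simp, ?_⟩, ?_⟩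
      · rw [List.cons_append, List.cons_append, List.isChain_cons_cons]
        exact ⟨(split_adj_new_old hv).2 rfl, hp.2⟩
      · intro k hk
        rcases List.mem_cons.1 hk with rfl | hk
        · exact hg
        · exact hpg k hk
  rcases split_edge_cases hv h with ⟨f, rfl⟩ | ⟨x, y, rfl⟩
  · exact step1 f
  · obtain ⟨p, hp, hpg⟩ := step1 ⟨x.1, x.ne hv⟩
    refine ⟨p ++ [oldEdge hv ⟨x.1, x.ne hv⟩], ⟨by simp, ?_⟩, ?_⟩
    · rw [← List.cons_append, List.isChain_append]
      refine ⟨hp.2, by simp, fun a ha b hb => ?_⟩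
      rw [List.getLast?_concat, Option.mem_some_iff] at ha
      rw [List.head?_cons, Option.mem_some_iff] at hb
      subst ha hb
      exact (split_adj_old_new hv).2 rfl
    · intro k hk
      rw [← List.cons_append, List.mem_append, List.mem_singleton] at hk
      rcases hk with hk | rfl
      · exact hpg k hk
      · exact hh

/-- Every good edge of `S'` is forced by a factor of `W`. -/
theorem exists_forcing {g : (S.split v hv).E} (hg : S.IsGood W v hv g) :
    ∃ x, IsFactor W x ∧ ∀ p, (S.split v hv).IsSymmetric p →
      x <:+: (S.split v hv).frontWord p → g ∈ p := by
  rcases split_edge_cases hv g with ⟨e, rfl⟩ | ⟨x, y, rfl⟩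
  · obtain ⟨x, hx, hforce⟩ := hS.forces e.1
    refine ⟨x, hx, fun p hp hxp => ?_⟩
    rw [split_frontWord hv hS.vertex hp] at hxp
    have hmem := hforce _ (unsplit_isSymmetric hv hS.vertex hp) hxp
    rw [unsplit_eq hv hp.1.1] at hmem
    have hpre : e.1 ∉ splitPre hv (p.head hp.1.1) := by
      rcases splitPre_eq hv (p.head hp.1.1) with h | h <;> simp [h, e.2]
    have hpost : e.1 ∉ splitPost hv (p.getLast hp.1.1) := by
      rcases splitPost_eq hv (p.getLast hp.1.1) with h | h <;> simp [h, e.2]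
    have : e.1 ∈ p.map (splitProj hv) := by
      simpa only [List.mem_append, hpre, hpost, false_or, or_false] using hmem
    obtain ⟨g, hg, hge⟩ := List.mem_map.1 this
    rw [← eq_old_of_splitProj hv e.2 hge]
    exact hg
  · refine ⟨_, (isGood_new hv).1 hg, fun p hp hxp => ?_⟩
    obtain ⟨l, hl⟩ := exists_isLeftTail hS.vertex hS.stronglyConnected hv.1 x.1
    obtain ⟨r, hr⟩ := exists_isRightTail hS.vertex hS.stronglyConnected hv.2 y.1
    set t := l ++ [x.1] ++ [v] ++ (y.1 :: r) with ht
    have hxv : S.IsSymmetric (l ++ [x.1] ++ [v]) := by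
      refine ⟨⟨by simp, ?_⟩, (startsIn_append (by simp)).2 hl.2.2, endsIn_concat.2 hv.2⟩
      rw [List.isChain_append]
      exact ⟨hl.1.2, by simp, by simpa using x.2⟩
    have htsym : S.IsSymmetric t := by
      refine ⟨⟨by simp [ht], ?_⟩, (startsIn_append (by simp)).2 hxv.2.1,
        (endsIn_append (by simp)).2 hr.2.2⟩
      rw [ht, List.isChain_append]
      exact ⟨hxv.1.2, hr.1.2, by simpa using y.2.symm⟩
    have hword : S.frontWord t = S.back x.1 ++ S.front v ++ S.front y.1 := by
      have h1 : l.flatMap S.inLabel = [] := by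
        rw [List.flatMap_eq_nil_iff]
        exact fun f hf => inLabel_of_distributing (hl.2.1 f hf)
      have h2 : r.flatMap S.outLabel = [] := by
        rw [List.flatMap_eq_nil_iff]
        exact fun f hf => outLabel_of_collecting (hr.2.1 f hf)
      rw [ht, frontWord_append (by simp), hS.front_eq_back _ hxv, backWord_concat,
        ← hS.front_eq_back_of_isSupporting hv, List.flatMap_append,
      List.flatMap_cons (f := S.outLabel),
        outLabel_of_distributing (by rw [y.2]; exact hv.2), List.flatMap_singleton,
        inLabel_of_collecting (by rw [x.2]; exact hv.1), h1, h2]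
      simp
    rw [split_frontWord hv hS.vertex hp, ← hword] at hxp
    obtain ⟨a, b, hab⟩ :=
      hS.infix_of_frontWord_infix (unsplit_isSymmetric hv hS.vertex hp) htsym hxp
    rw [unsplit_eq hv hp.1.1] at hab
    obtain ⟨c, d, -, -, hcd⟩ := List.exists_of_append_eq_pad (p := a ++ l)
      (q := [x.1, v, y.1]) (r := r ++ b) (by simp) (by simpa using x.ne hv)
      (by simpa using y.ne hv) (splitPre_eq hv _) (splitPost_eq hv _)
      (by rw [← hab, ht]; simp)
    rw [List.map_eq_append_iff] at hcd
    obtain ⟨p', d', rfl, hcd, rfl⟩ := hcd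
    rw [List.map_eq_append_iff] at hcd
    obtain ⟨c', q, rfl, rfl, hq⟩ := hcd
    rw [List.map_eq_cons_iff] at hq
    obtain ⟨g₁, q, rfl, h1, hq⟩ := hq
    rw [List.map_eq_cons_iff] at hq
    obtain ⟨g₂, q, rfl, h2, hq⟩ := hq
    rw [List.map_eq_cons_iff] at hq
    obtain ⟨g₃, q, rfl, h3, hq⟩ := hq
    rw [eq_old_of_splitProj hv (x.ne hv) h1, eq_old_of_splitProj hv (y.ne hv) h3] at hp ⊢
    have adj1 := IsPath.tgt_eq_src (p := c') (q := oldEdge hv ⟨y.1, y.ne hv⟩ :: q ++ d')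
      (by simpa using hp.1)
    have adj2 := IsPath.tgt_eq_src (p := c' ++ [oldEdge hv ⟨x.1, x.ne hv⟩]) (q := q ++ d')
      (by simpa using hp.1)
    rcases split_edge_cases hv g₂ with ⟨e, rfl⟩ | ⟨x', y', rfl⟩
    · exact (e.2 h2).elim
    · have hx' := (split_adj_old_new hv).1 adj1
      have hy' := (split_adj_new_old hv).1 adj2
      rw [show x = x' from Subtype.ext hx', show y = y' from Subtype.ext hy']
      simp

end WordGraph.IsRauzyScheme

/-! ### The evolved graph -/

/-- A path is determined by its first element if the elements on it before the last one have at
most one continuation each and the last one is the first at which one may stop. -/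
lemma List.IsChain.eq_of_halt {α : Type*} {R : α → α → Prop} {halt ok : α → Prop}
    (huniq : ∀ a b c, ok b → ok c → R a b → R a c → ¬ halt a → b = c) :
    ∀ {a : α} {p q : List α}, (a :: p).IsChain R → (a :: q).IsChain R →
      (∀ b ∈ p, ok b) → (∀ b ∈ q, ok b) →
      (∀ b ∈ (a :: p).dropLast, ¬ halt b) → (∀ b ∈ (a :: q).dropLast, ¬ halt b) →
      halt ((a :: p).getLast (List.cons_ne_nil a p)) →
      halt ((a :: q).getLast (List.cons_ne_nil a q)) → p = q
  | a, [], [], _, _, _, _, _, _, _, _ => rfl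
  | a, [], c :: q, _, _, _, _, _, hq, hp, _ => (hq a (by simp) hp).elim
  | a, b :: p, [], _, _, _, _, hp, _, _, hq => (hp a (by simp) hq).elim
  | a, b :: p, c :: q, h1, h2, h3, h4, h5, h6, h7, h8 => by
    rw [List.isChain_cons_cons] at h1 h2
    obtain rfl := huniq a b c (h3 b (by simp)) (h4 c (by simp)) h1.1 h2.1 (h5 a (by simp))
    rw [List.IsChain.eq_of_halt huniq h1.2 h2.2 (fun x hx => h3 x (by simp [hx]))
      (fun x hx => h4 x (by simp [hx])) (fun x hx => h5 x (by simp [hx]))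
      (fun x hx => h6 x (by simp [hx])) (by simpa using h7) (by simpa using h8)]

/-- On a finite type, a relation in which every element has a successor and at most one predecessor
is the graph of a function. -/
lemma Finite.succ_unique {α : Type*} [Finite α] {R : α → α → Prop} (h : ∀ a, ∃ b, R a b)
    (hR : ∀ a b c, R a c → R b c → a = b) (a b c : α) (hb : R a b) (hc : R a c) : b = c := by
  choose f hf using h
  have hinj : Function.Injective f := fun x y hxy => hR x y (f x) (hf x) (hxy ▸ hf y)
  obtain ⟨x, rfl⟩ := Finite.surjective_of_injective hinj b
  obtain ⟨y, rfl⟩ := Finite.surjective_of_injective hinj c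
  rw [hR x a _ (hf x) hb, hR y a _ (hf y) hc]

namespace WordGraph

open DirGraph

variable {A : Type w} {S : WordGraph.{u, w} A} {W : ℕ → A} {v : S.E} {hv : S.IsSupporting v}

/-- The path of `S'` that forms an edge of `S''`. -/
def edgePath (e : (S.evolved W v hv).E) : List (S.split v hv).E :=
  Subtype.val (p := fun p => S.IsEvolvedEdge W v hv p) e

/-- A path of `S'` as an edge of `S''`. -/
def evolvedEdge (p : List (S.split v hv).E) (hp : S.IsEvolvedEdge W v hv p) :
    (S.evolved W v hv).E := ⟨p, hp⟩

@[simp] lemma edgePath_evolvedEdge (p : List (S.split v hv).E) (hp : S.IsEvolvedEdge W v hv p) :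
    edgePath (evolvedEdge p hp) = p := rfl

lemma edgePath_injective : Function.Injective (edgePath (W := W) (hv := hv)) :=
  Subtype.val_injective

/-- A vertex of `S''` as a vertex of `S'`. -/
def evolvedVal (z : (S.evolved W v hv).V) : (S.split v hv).V :=
  Subtype.val (p := fun z => S.NonVanishing W v hv z) z

/-- A non-vanishing vertex of `S'` as a vertex of `S''`. -/
def evolvedVertex (z : (S.split v hv).V) (hz : S.NonVanishing W v hv z) :
    (S.evolved W v hv).V := ⟨z, hz⟩

lemma evolvedVal_injective : Function.Injective (evolvedVal (W := W) (hv := hv)) :=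
  Subtype.val_injective

lemma nonVanishing_evolvedVal (z : (S.evolved W v hv).V) : S.NonVanishing W v hv (evolvedVal z) :=
  Subtype.property (p := fun z => S.NonVanishing W v hv z) z

lemma isEvolvedEdge (e : (S.evolved W v hv).E) : S.IsEvolvedEdge W v hv (edgePath e) :=
  Subtype.property (p := fun p => S.IsEvolvedEdge W v hv p) e

lemma isPath_edgePath (e : (S.evolved W v hv).E) : (S.split v hv).IsPath (edgePath e) :=
  (isEvolvedEdge e).choose

lemma edgePath_ne_nil (e : (S.evolved W v hv).E) : edgePath e ≠ [] := (isPath_edgePath e).1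

/-- The first edge, in `S'`, of the path that forms an edge of `S''`. -/
def edgeHead (e : (S.evolved W v hv).E) : (S.split v hv).E := (edgePath e).head (edgePath_ne_nil e)

/-- The last edge, in `S'`, of the path that forms an edge of `S''`. -/
def edgeLast (e : (S.evolved W v hv).E) : (S.split v hv).E :=
  (edgePath e).getLast (edgePath_ne_nil e)

lemma edgePath_eq_cons (e : (S.evolved W v hv).E) :
    edgePath e = edgeHead e :: (edgePath e).tail := (List.cons_head_tail (edgePath_ne_nil e)).symm

lemma edgePath_eq_concat (e : (S.evolved W v hv).E) :
    edgePath e = (edgePath e).dropLast ++ [edgeLast e] :=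
  (List.dropLast_append_getLast (edgePath_ne_nil e)).symm

lemma isGood_of_mem_edgePath {e : (S.evolved W v hv).E} {g : (S.split v hv).E}
    (hg : g ∈ edgePath e) : S.IsGood W v hv g := (isEvolvedEdge e).choose_spec.1 g hg

lemma evolvedVal_src (e : (S.evolved W v hv).E) :
    evolvedVal ((S.evolved W v hv).src e) = (S.split v hv).src (edgeHead e) := rfl

lemma evolvedVal_tgt (e : (S.evolved W v hv).E) :
    evolvedVal ((S.evolved W v hv).tgt e) = (S.split v hv).tgt (edgeLast e) := rfl

lemma nonVanishing_src_edgeHead (e : (S.evolved W v hv).E) :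
    S.NonVanishing W v hv ((S.split v hv).src (edgeHead e)) := (isEvolvedEdge e).choose_spec.2.1

lemma nonVanishing_tgt_edgeLast (e : (S.evolved W v hv).E) :
    S.NonVanishing W v hv ((S.split v hv).tgt (edgeLast e)) := (isEvolvedEdge e).choose_spec.2.2.1

lemma not_nonVanishing_tgt {e : (S.evolved W v hv).E} {g : (S.split v hv).E}
    (hg : g ∈ (edgePath e).dropLast) : ¬ S.NonVanishing W v hv ((S.split v hv).tgt g) :=
  (isEvolvedEdge e).choose_spec.2.2.2 g hg

lemma not_nonVanishing_src {e : (S.evolved W v hv).E} {g : (S.split v hv).E}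
    (hg : g ∈ (edgePath e).tail) : ¬ S.NonVanishing W v hv ((S.split v hv).src g) := by
  obtain ⟨a, b, hab⟩ := List.append_of_mem hg
  have h1 := edgePath_eq_cons e
  rw [hab] at h1
  rcases List.eq_nil_or_concat' (edgeHead e :: a) with h | ⟨c, k, hk⟩
  · simp at h
  · have h2 : edgePath e = c ++ k :: g :: b := by
      rw [h1, ← List.cons_append, hk]
      simp
    have h3 := isPath_edgePath e
    rw [h2] at h3
    rw [← IsPath.tgt_eq_src h3]
    apply not_nonVanishing_tgt (e := e)
    rw [h2, List.dropLast_append_of_ne_nil (by simp), List.dropLast_cons_of_ne_nil (by simp)]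
    simp

lemma evolved_adj {e f : (S.evolved W v hv).E} :
    (S.evolved W v hv).tgt e = (S.evolved W v hv).src f ↔
      (S.split v hv).tgt (edgeLast e) = (S.split v hv).src (edgeHead f) := by
  rw [← (evolvedVal_injective (W := W) (hv := hv)).eq_iff, evolvedVal_tgt, evolvedVal_src]

section Determinism

variable (hS : ∀ x, S.IsDistributing x ∨ S.IsCollecting x)
include hS

lemma good_src_unique {g h : (S.split v hv).E} (hg : S.IsGood W v hv g) (hh : S.IsGood W v hv h)
    (heq : (S.split v hv).src g = (S.split v hv).src h)
    (hz : ¬ S.NonVanishing W v hv ((S.split v hv).src g)) : g = h := by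
  by_contra hne
  rcases split_vertex hv hS ((S.split v hv).src g) with hd | hc
  · exact hz (Or.inl ⟨hd, g, h, hne, hg, hh, rfl, heq.symm⟩)
  · exact hne (hc.out_unique rfl heq.symm)

lemma good_tgt_unique {g h : (S.split v hv).E} (hg : S.IsGood W v hv g) (hh : S.IsGood W v hv h)
    (heq : (S.split v hv).tgt g = (S.split v hv).tgt h)
    (hz : ¬ S.NonVanishing W v hv ((S.split v hv).tgt g)) : g = h := by
  by_contra hne
  rcases split_vertex hv hS ((S.split v hv).tgt g) with hd | hc
  · exact hne (hd.in_unique rfl heq.symm)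
  · exact hz (Or.inr ⟨hc, g, h, hne, hg, hh, rfl, heq.symm⟩)

/-- Up to the next non-vanishing vertex a path of good edges has only one continuation, so an edge of
`S''` is determined by the first edge of its path. -/
lemma edgeHead_injective : Function.Injective (edgeHead (W := W) (hv := hv)) := by
  intro e f hef
  apply edgePath_injective
  rw [edgePath_eq_cons e, edgePath_eq_cons f, hef]
  congr 1
  refine List.IsChain.eq_of_halt (R := fun g h => (S.split v hv).tgt g = (S.split v hv).src h)
    (halt := fun g => S.NonVanishing W v hv ((S.split v hv).tgt g)) (ok := S.IsGood W v hv)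
    (a := edgeHead f) ?_ ?_ ?_ (fun b hb => isGood_of_mem_edgePath (List.mem_of_mem_tail hb))
    (fun b hb => isGood_of_mem_edgePath (List.mem_of_mem_tail hb)) ?_ ?_ ?_ ?_
  · intro a b c hb hc hab hac hz
    exact good_src_unique hS hb hc (hab.symm.trans hac) (by rwa [← hab])
  · rw [← hef, ← edgePath_eq_cons]
    exact (isPath_edgePath e).2
  · rw [← edgePath_eq_cons]
    exact (isPath_edgePath f).2
  · rw [← hef, ← edgePath_eq_cons]
    exact fun b hb => not_nonVanishing_tgt hb
  · rw [← edgePath_eq_cons]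
    exact fun b hb => not_nonVanishing_tgt hb
  · simp only [← hef, ← edgePath_eq_cons]
    exact nonVanishing_tgt_edgeLast e
  · simp only [← edgePath_eq_cons]
    exact nonVanishing_tgt_edgeLast f

/-- An edge of `S''` is determined by the last edge of its path, too. -/
lemma edgeLast_injective : Function.Injective (edgeLast (W := W) (hv := hv)) := by
  intro e f hef
  apply edgePath_injective
  have rev : ∀ e : (S.evolved W v hv).E,
      edgeLast e :: (edgePath e).dropLast.reverse = (edgePath e).reverse := by
    intro e
    conv_rhs => rw [edgePath_eq_concat e]
    simp
  have drop : ∀ e : (S.evolved W v hv).E,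
      ∀ b ∈ (edgePath e).reverse.dropLast, b ∈ (edgePath e).tail := by
    intro e b hb
    rw [List.dropLast_reverse] at hb
    simpa using hb
  rw [← List.reverse_inj, ← rev, ← rev, hef]
  congr 1
  refine List.IsChain.eq_of_halt (R := fun g h => (S.split v hv).tgt h = (S.split v hv).src g)
    (halt := fun g => S.NonVanishing W v hv ((S.split v hv).src g)) (ok := S.IsGood W v hv)
    (a := edgeLast f) ?_ ?_ ?_
    (fun b hb => isGood_of_mem_edgePath (List.mem_of_mem_dropLast (List.mem_reverse.1 hb)))
    (fun b hb => isGood_of_mem_edgePath (List.mem_of_mem_dropLast (List.mem_reverse.1 hb)))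
    ?_ ?_ ?_ ?_
  · intro a b c hb hc hab hac hz
    exact good_tgt_unique hS hb hc (hab.trans hac.symm) (by rwa [hab])
  · rw [← hef, rev, List.isChain_reverse]
    exact (isPath_edgePath e).2
  · rw [rev, List.isChain_reverse]
    exact (isPath_edgePath f).2
  · rw [← hef, rev]
    exact fun b hb => not_nonVanishing_src (drop e b hb)
  · rw [rev]
    exact fun b hb => not_nonVanishing_src (drop f b hb)
  · simp only [← hef, rev, List.getLast_reverse]
    exact nonVanishing_src_edgeHead e
  · simp only [rev, List.getLast_reverse]
    exact nonVanishing_src_edgeHead f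

end Determinism

/-- The path of `S'` that corresponds to a path of `S''`; it is `expand`, for the edges of
`evolved`. -/
def expansion (s : List (S.evolved W v hv).E) : List (S.split v hv).E := s.flatMap edgePath

@[simp] lemma expansion_nil : expansion ([] : List (S.evolved W v hv).E) = [] := rfl

@[simp] lemma expansion_cons (e : (S.evolved W v hv).E) (s : List (S.evolved W v hv).E) :
    expansion (e :: s) = edgePath e ++ expansion s := rfl

@[simp] lemma expansion_append (s t : List (S.evolved W v hv).E) :
    expansion (s ++ t) = expansion s ++ expansion t := List.flatMap_append

lemma expansion_ne_nil {s : List (S.evolved W v hv).E} (hs : s ≠ []) : expansion s ≠ [] := by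
  obtain ⟨e, s, rfl⟩ := List.exists_cons_of_ne_nil hs
  simp [edgePath_ne_nil]

lemma expansion_head? (e : (S.evolved W v hv).E) (s : List (S.evolved W v hv).E) :
    (expansion (e :: s)).head? = some (edgeHead e) := by
  rw [expansion_cons, edgePath_eq_cons]
  rfl

lemma expansion_getLast? (s : List (S.evolved W v hv).E) (e : (S.evolved W v hv).E) :
    (expansion (s ++ [e])).getLast? = some (edgeLast e) := by
  rw [expansion_append, expansion_cons, expansion_nil, List.append_nil, edgePath_eq_concat,
    ← List.append_assoc, List.getLast?_concat]

lemma isPath_expansion : ∀ {s : List (S.evolved W v hv).E}, (S.evolved W v hv).IsPath s →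
    (S.split v hv).IsPath (expansion s)
  | [], h => (h.1 rfl).elim
  | [e], _ => by simpa using isPath_edgePath e
  | e :: f :: s, h => by
    have h1 := List.isChain_cons_cons.1 h.2
    have ih := isPath_expansion (s := f :: s) ⟨by simp, h1.2⟩
    refine ⟨expansion_ne_nil (by simp), ?_⟩
    rw [expansion_cons, List.isChain_append]
    refine ⟨(isPath_edgePath e).2, ih.2, ?_⟩
    rw [expansion_head?, edgePath_eq_concat, List.getLast?_concat]
    intro a ha b hb
    rw [Option.mem_some_iff] at ha hb
    subst ha hb
    exact evolved_adj.1 h1.1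

/-- Every path of good edges of `S'` between non-vanishing vertices comes from a path of `S''`. -/
lemma exists_expansion {p : List (S.split v hv).E} (hp : (S.split v hv).IsPath p)
    (hg : ∀ g ∈ p, S.IsGood W v hv g)
    (hh : S.NonVanishing W v hv ((S.split v hv).src (p.head hp.1)))
    (hl : S.NonVanishing W v hv ((S.split v hv).tgt (p.getLast hp.1))) :
    ∃ s, (S.evolved W v hv).IsPath s ∧ expansion s = p := by
  classical
  -- cut off the piece of the path before the first non-vanishing vertex
  have cut : ∀ (k : List (S.split v hv).E) (g : (S.split v hv).E),
      (S.split v hv).IsPath (g :: k) → (∀ h ∈ g :: k, S.IsGood W v hv h) →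
      S.NonVanishing W v hv ((S.split v hv).tgt ((g :: k).getLast (by simp))) →
      ∃ (p : List (S.split v hv).E) (s : List (S.evolved W v hv).E), k = p ++ expansion s ∧
        (∀ h ∈ (g :: p).dropLast, ¬ S.NonVanishing W v hv ((S.split v hv).tgt h)) ∧
        S.NonVanishing W v hv ((S.split v hv).tgt ((g :: p).getLast (by simp))) ∧
        s.IsChain (fun e f => (S.evolved W v hv).tgt e = (S.evolved W v hv).src f) ∧
        ∀ e ∈ s.head?, (S.split v hv).tgt ((g :: p).getLast (by simp)) =
          (S.split v hv).src (edgeHead e) := by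
    intro k
    induction k with
    | nil => exact fun g _ _ hl => ⟨[], [], by simp, by simp, hl, by simp, by simp⟩
    | cons h k ih =>
      intro g hp hg hl
      have h1 := List.isChain_cons_cons.1 hp.2
      obtain ⟨p, s, rfl, hp1, hp2, hs, hps⟩ := ih h ⟨by simp, h1.2⟩
        (fun k hk => hg k (List.mem_cons_of_mem _ hk)) (by simpa using hl)
      by_cases hz : S.NonVanishing W v hv ((S.split v hv).tgt g)
      · have hedge : S.IsEvolvedEdge W v hv (h :: p) :=
          ⟨⟨by simp, h1.2.infix ⟨[], expansion s, by simp⟩⟩,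
            fun k hk => hg k (List.mem_cons_of_mem _ (by
              rw [← List.cons_append]; exact List.mem_append_left _ hk)),
            by rw [List.head_cons, ← h1.1]; exact hz, hp2, hp1⟩
        refine ⟨[], evolvedEdge _ hedge :: s, by simp, by simp, hz, ?_, ?_⟩
        · rw [List.isChain_cons]
          exact ⟨fun e he => evolved_adj.2 (hps e he), hs⟩
        · rintro e he
          rw [List.head?_cons, Option.mem_some_iff] at he
          subst he
          exact h1.1
      · refine ⟨h :: p, s, by simp, ?_, by simpa using hp2, hs, by simpa using hps⟩
        intro k hk
        rw [List.dropLast_cons_of_ne_nil (by simp)] at hk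
        rcases List.mem_cons.1 hk with rfl | hk
        · exact hz
        · exact hp1 k hk
  obtain ⟨g, k, rfl⟩ := List.exists_cons_of_ne_nil hp.1
  obtain ⟨p, s, rfl, hp1, hp2, hs, hps⟩ := cut k g hp hg hl
  have hedge : S.IsEvolvedEdge W v hv (g :: p) :=
    ⟨⟨by simp, hp.2.infix ⟨[], expansion s, by simp⟩⟩,
      fun k hk => hg k (by rw [← List.cons_append]; exact List.mem_append_left _ hk),
      hh, hp2, hp1⟩
  refine ⟨evolvedEdge _ hedge :: s, ⟨by simp, ?_⟩, by simp⟩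
  rw [List.isChain_cons]
  exact ⟨fun e he => evolved_adj.2 (hps e he), hs⟩

lemma NonVanishing.exists_out {z : (S.split v hv).V} (hz : S.NonVanishing W v hv z) :
    ∃ g, S.IsGood W v hv g ∧ (S.split v hv).src g = z := by
  rcases hz with ⟨-, e, -, -, he, -, h, -⟩ | ⟨hc, -⟩
  · exact ⟨e, he, h⟩
  · obtain ⟨g, hg⟩ := hc.2.exists
    obtain ⟨e, rfl⟩ := exists_old_of_src_collecting hv (by rw [hg]; exact hc)
    exact ⟨_, isGood_old hv e, hg⟩

lemma NonVanishing.exists_in {z : (S.split v hv).V} (hz : S.NonVanishing W v hv z) :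
    ∃ g, S.IsGood W v hv g ∧ (S.split v hv).tgt g = z := by
  rcases hz with ⟨hd, -⟩ | ⟨-, e, -, -, he, -, h, -⟩
  · obtain ⟨g, hg⟩ := hd.1.exists
    obtain ⟨e, rfl⟩ := exists_old_of_tgt_distributing hv (by rw [hg]; exact hd)
    exact ⟨_, isGood_old hv e, hg⟩
  · exact ⟨e, he, h⟩

namespace IsRauzyScheme

variable (hS : S.IsRauzyScheme W) (hW : IsRecurrentWord W)
include hS hW

lemma exists_edgeHead_eq {g : (S.split v hv).E} (hg : S.IsGood W v hv g)
    (hz : S.NonVanishing W v hv ((S.split v hv).src g)) :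
    ∃ e : (S.evolved W v hv).E, edgeHead e = g := by
  obtain ⟨h, hh, hhz⟩ := hz.exists_in
  obtain ⟨p, hp, hpg⟩ := hS.exists_good_path hv hW hg hh
  obtain ⟨s, hs, hsp⟩ := exists_expansion hp hpg hz (by
    rw [List.getLast_append_of_ne_nil _ (by simp), List.getLast_singleton, hhz]
    exact hz)
  obtain ⟨e, s, rfl⟩ := List.exists_cons_of_ne_nil hs.1
  refine ⟨e, ?_⟩
  have := expansion_head? e s
  rw [hsp] at this
  simpa using this.symm

lemma exists_edgeLast_eq {g : (S.split v hv).E} (hg : S.IsGood W v hv g)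
    (hz : S.NonVanishing W v hv ((S.split v hv).tgt g)) :
    ∃ e : (S.evolved W v hv).E, edgeLast e = g := by
  obtain ⟨h, hh, hhz⟩ := hz.exists_out
  obtain ⟨p, hp, hpg⟩ := hS.exists_good_path hv hW hh hg
  obtain ⟨s, hs, hsp⟩ := exists_expansion hp hpg (by rw [List.head_append_of_ne_nil (by simp)]
                                                     simpa [hhz] using hz) (by
    rw [List.getLast_append_of_ne_nil _ (by simp), List.getLast_singleton]
    exact hz)
  rcases List.eq_nil_or_concat' s with rfl | ⟨s, e, rfl⟩
  · exact (hs.1 rfl).elim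
  refine ⟨e, ?_⟩
  have := expansion_getLast? s e
  rw [hsp, List.getLast?_concat] at this
  simpa using this.symm

lemma evolved_isDistributing {z : (S.evolved W v hv).V}
    (hz : (S.split v hv).IsDistributing (evolvedVal z)) :
    (S.evolved W v hv).IsDistributing z := by
  have hnv := nonVanishing_evolvedVal z
  obtain ⟨g, hg, hgz⟩ := hnv.exists_in
  rcases hnv with ⟨-, h₁, h₂, hne, hh₁, hh₂, hz₁, hz₂⟩ | ⟨hc, -⟩
  · have hnv := nonVanishing_evolvedVal z
    obtain ⟨e, rfl⟩ := hS.exists_edgeLast_eq hW hg (by rw [hgz]; exact hnv)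
    obtain ⟨e₁, rfl⟩ := hS.exists_edgeHead_eq hW hh₁ (by rw [hz₁]; exact hnv)
    obtain ⟨e₂, rfl⟩ := hS.exists_edgeHead_eq hW hh₂ (by rw [hz₂]; exact hnv)
    refine ⟨⟨e, evolvedVal_injective hgz, fun f hf => ?_⟩, e₁, e₂, fun h => hne (by rw [h]),
      evolvedVal_injective hz₁, evolvedVal_injective hz₂⟩
    subst hf
    exact edgeLast_injective hS.vertex (hz.in_unique rfl hgz)
  · exact (hc.not_isDistributing hz).elim

lemma evolved_isCollecting {z : (S.evolved W v hv).V}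
    (hz : (S.split v hv).IsCollecting (evolvedVal z)) :
    (S.evolved W v hv).IsCollecting z := by
  have hnv := nonVanishing_evolvedVal z
  obtain ⟨g, hg, hgz⟩ := hnv.exists_out
  rcases hnv with ⟨hd, -⟩ | ⟨-, h₁, h₂, hne, hh₁, hh₂, hz₁, hz₂⟩
  · exact (hz.not_isDistributing hd).elim
  · have hnv := nonVanishing_evolvedVal z
    obtain ⟨e, rfl⟩ := hS.exists_edgeHead_eq hW hg (by rw [hgz]; exact hnv)
    obtain ⟨e₁, rfl⟩ := hS.exists_edgeLast_eq hW hh₁ (by rw [hz₁]; exact hnv)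
    obtain ⟨e₂, rfl⟩ := hS.exists_edgeLast_eq hW hh₂ (by rw [hz₂]; exact hnv)
    refine ⟨⟨e₁, e₂, fun h => hne (by rw [h]), evolvedVal_injective hz₁,
      evolvedVal_injective hz₂⟩, e, evolvedVal_injective hgz, fun f hf => ?_⟩
    subst hf
    exact edgeHead_injective hS.vertex (hz.out_unique rfl hgz)

lemma evolved_vertex (z : (S.evolved W v hv).V) :
    (S.evolved W v hv).IsDistributing z ∨ (S.evolved W v hv).IsCollecting z :=
  (split_vertex hv hS.vertex (evolvedVal z)).imp (hS.evolved_isDistributing hW)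
    (hS.evolved_isCollecting hW)

lemma evolved_isDistributing_iff {z : (S.evolved W v hv).V} :
    (S.evolved W v hv).IsDistributing z ↔ (S.split v hv).IsDistributing (evolvedVal z) := by
  refine ⟨fun h => (split_vertex hv hS.vertex (evolvedVal z)).resolve_right fun h' => ?_,
    hS.evolved_isDistributing hW⟩
  exact h.not_isCollecting (hS.evolved_isCollecting hW h')

lemma evolved_isCollecting_iff {z : (S.evolved W v hv).V} :
    (S.evolved W v hv).IsCollecting z ↔ (S.split v hv).IsCollecting (evolvedVal z) := by
  refine ⟨fun h => (split_vertex hv hS.vertex (evolvedVal z)).resolve_left fun h' => ?_,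
    hS.evolved_isCollecting hW⟩
  exact h.not_isDistributing (hS.evolved_isDistributing hW h')

lemma evolved_stronglyConnected : (S.evolved W v hv).StronglyConnected := by
  intro z z'
  obtain ⟨g, hg, hgz⟩ := (nonVanishing_evolvedVal z).exists_out
  obtain ⟨h, hh, hhz⟩ := (nonVanishing_evolvedVal z').exists_in
  obtain ⟨p, hp, hpg⟩ := hS.exists_good_path hv hW hg hh
  obtain ⟨s, hs, hsp⟩ := exists_expansion hp hpg
    (by simpa [hgz] using nonVanishing_evolvedVal z)
    (by
      rw [List.getLast_append_of_ne_nil _ (by simp), List.getLast_singleton, hhz]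
      exact nonVanishing_evolvedVal z')
  have walk : ∀ (s : List (S.evolved W v hv).E) (e : (S.evolved W v hv).E),
      (S.evolved W v hv).IsPath (e :: s) → Relation.ReflTransGen
        (fun a b => ∃ e, (S.evolved W v hv).src e = a ∧ (S.evolved W v hv).tgt e = b)
        ((S.evolved W v hv).src e)
        ((S.evolved W v hv).tgt ((e :: s).getLast (List.cons_ne_nil e s))) := by
    intro s
    induction s with
    | nil => exact fun e _ => Relation.ReflTransGen.single ⟨e, rfl, rfl⟩
    | cons f s ih =>
      intro e he
      have h1 := List.isChain_cons_cons.1 he.2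
      have := ih f ⟨by simp, h1.2⟩
      rw [← h1.1] at this
      refine Relation.ReflTransGen.head ⟨e, rfl, rfl⟩ ?_
      simpa using this
  obtain ⟨e, s, rfl⟩ := List.exists_cons_of_ne_nil hs.1
  have h1 : edgeHead e = g := by
    have := expansion_head? e s
    rw [hsp] at this
    simpa using this.symm
  have h2 : edgeLast ((e :: s).getLast (List.cons_ne_nil e s)) = h := by
    have := expansion_getLast? ((e :: s).dropLast) ((e :: s).getLast (List.cons_ne_nil e s))
    rw [List.dropLast_append_getLast, hsp, List.getLast?_concat] at this
    simpa using this.symm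
  have h3 : (S.evolved W v hv).src e = z := evolvedVal_injective (by rw [evolvedVal_src, h1, hgz])
  have h4 : (S.evolved W v hv).tgt ((e :: s).getLast (List.cons_ne_nil e s)) = z' :=
    evolvedVal_injective (by rw [evolvedVal_tgt, h2, hhz])
  rw [← h3, ← h4]
  exact walk s e hs

omit hW in
lemma split_finite : Finite (S.split v hv).V ∧ Finite (S.split v hv).E := by
  have := hS.finite_V
  have := hS.finite_E
  refine ⟨?_, ?_⟩
  · change Finite ({x : S.V // x ≠ S.src v ∧ x ≠ S.tgt v} ⊕ (S.InEdge v ⊕ S.OutEdge v))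
    infer_instance
  · change Finite ({e : S.E // e ≠ v} ⊕ (S.InEdge v × S.OutEdge v))
    infer_instance

/-- If some vertex does not vanish, then both a distributing and a collecting one do not: otherwise
following the good edges backwards, or forwards, would be injective, so it would be a permutation
of the good edges. -/
lemma evolved_exists_vertices (hper : ¬ S.RevealsPeriodicity W v hv) :
    (∃ z, (S.evolved W v hv).IsDistributing z) ∧ ∃ z, (S.evolved W v hv).IsCollecting z := by
  have hfin := (hS.split_finite (hv := hv)).2
  obtain ⟨z⟩ : Nonempty (S.evolved W v hv).V := not_isEmpty_iff.1 hper
  set R : {g // S.IsGood W v hv g} → {g // S.IsGood W v hv g} → Prop :=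
    fun g h => (S.split v hv).tgt g.1 = (S.split v hv).src h.1 with hR
  have hsucc : ∀ g, ∃ h, R g h := by
    intro g
    obtain ⟨p, hp, hpg⟩ := hS.exists_good_path hv hW g.2 g.2
    cases p with
    | nil => exact ⟨g, IsPath.tgt_eq_src (p := []) (q := []) hp⟩
    | cons h p => exact ⟨⟨h, hpg h (by simp)⟩, IsPath.tgt_eq_src (p := []) hp⟩
  have hpred : ∀ g, ∃ h, R h g := by
    intro g
    obtain ⟨p, hp, hpg⟩ := hS.exists_good_path hv hW g.2 g.2
    rcases List.eq_nil_or_concat' p with rfl | ⟨p, h, rfl⟩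
    · exact ⟨g, IsPath.tgt_eq_src (p := []) (q := []) hp⟩
    · exact ⟨⟨h, hpg h (by simp)⟩, IsPath.tgt_eq_src (p := g :: p) (q := []) (by simpa using hp)⟩
  rcases hS.evolved_vertex hW z with hz | hz
  · refine ⟨⟨z, hz⟩, ?_⟩
    by_contra! hno
    rcases nonVanishing_evolvedVal z with ⟨-, h₁, h₂, hne, hh₁, hh₂, hz₁, hz₂⟩ | ⟨hc, -⟩
    · obtain ⟨g, hg, hgz⟩ := (nonVanishing_evolvedVal z).exists_in
      have := Finite.succ_unique hsucc (fun a b c hac hbc => by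
        by_contra hab
        have htgt := hac.trans hbc.symm
        rcases split_vertex hv hS.vertex ((S.split v hv).tgt a.1) with hd | hc
        · exact hab (Subtype.ext (hd.in_unique rfl htgt.symm))
        · have hnv : S.NonVanishing W v hv ((S.split v hv).tgt a.1) :=
            Or.inr ⟨hc, a.1, b.1, fun h => hab (Subtype.ext h), a.2, b.2, rfl, htgt.symm⟩
          exact hno (evolvedVertex _ hnv) (hS.evolved_isCollecting hW hc))
        ⟨g, hg⟩ ⟨h₁, hh₁⟩ ⟨h₂, hh₂⟩ (hgz.trans hz₁.symm) (hgz.trans hz₂.symm)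
      exact hne (congrArg Subtype.val this)
    · exact hz.not_isCollecting (hS.evolved_isCollecting hW hc)
  · refine ⟨?_, ⟨z, hz⟩⟩
    by_contra! hno
    rcases nonVanishing_evolvedVal z with ⟨hd, -⟩ | ⟨-, h₁, h₂, hne, hh₁, hh₂, hz₁, hz₂⟩
    · exact hz.not_isDistributing (hS.evolved_isDistributing hW hd)
    · obtain ⟨g, hg, hgz⟩ := (nonVanishing_evolvedVal z).exists_out
      have := Finite.succ_unique (R := flip R) hpred (fun a b c hac hbc => by
        by_contra hab
        have hsrc : (S.split v hv).src a.1 = (S.split v hv).src b.1 := Eq.trans (Eq.symm hac) hbc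
        rcases split_vertex hv hS.vertex ((S.split v hv).src a.1) with hd | hc
        · have hnv : S.NonVanishing W v hv ((S.split v hv).src a.1) :=
            Or.inl ⟨hd, a.1, b.1, fun h => hab (Subtype.ext h), a.2, b.2, rfl, hsrc.symm⟩
          exact hno (evolvedVertex _ hnv) (hS.evolved_isDistributing hW hd)
        · exact hab (Subtype.ext (hc.out_unique rfl hsrc.symm)))
        ⟨g, hg⟩ ⟨h₁, hh₁⟩ ⟨h₂, hh₂⟩ (hz₁.trans hgz.symm) (hz₂.trans hgz.symm)
      exact hne (congrArg Subtype.val this)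

omit hW in
lemma evolved_finite : Finite (S.evolved W v hv).V ∧ Finite (S.evolved W v hv).E := by
  obtain ⟨h1, h2⟩ := hS.split_finite (hv := hv)
  exact ⟨Finite.of_injective _ (evolvedVal_injective (W := W) (hv := hv)),
    Finite.of_injective _ (edgeHead_injective (W := W) (hv := hv) hS.vertex)⟩

end IsRauzyScheme

end WordGraph

/-! ### The words of the evolved graph -/

lemma occCount_le_of_map {α β : Type*} {x y : List α} {x' y' : List β} (φ : ℕ → ℕ)
    (hφ : ∀ p r, y = p ++ x ++ r → ∃ p' r', y' = p' ++ x' ++ r' ∧ p'.length = φ p.length)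
    (hinj : ∀ p q r s, y = p ++ x ++ r → y = q ++ x ++ s → φ p.length = φ q.length →
      p.length = q.length) : occCount x y ≤ occCount x' y' := by
  refine Set.ncard_le_ncard_of_injOn φ ?_ ?_ ?_
  · rintro _ ⟨p, r, rfl, h⟩
    obtain ⟨p', r', h', hl⟩ := hφ p r h
    exact ⟨p', r', hl, h'⟩
  · rintro _ ⟨p, r, rfl, h⟩ _ ⟨q, s, rfl, h'⟩ hpq
    exact hinj p q r s h h' hpq
  · refine (Set.finite_Iic y'.length).subset ?_
    rintro _ ⟨p, r, rfl, h⟩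
    simp [h]

namespace WordGraph

open DirGraph

section General

variable {A : Type w} {S : WordGraph.{u, w} A}

lemma frontWord_of_distributing {e : S.E} {p : List S.E} (he : S.IsDistributing (S.src e)) :
    S.frontWord (e :: p) = (e :: p).flatMap S.outLabel := by
  rw [frontWord_cons, List.flatMap_cons, outLabel_of_distributing he]

lemma frontWord_of_collecting {e : S.E} {p : List S.E} (he : S.IsCollecting (S.src e)) :
    S.frontWord (e :: p) = S.front e ++ (e :: p).flatMap S.outLabel := by
  rw [frontWord_cons, List.flatMap_cons, outLabel_of_collecting he, List.nil_append]

lemma backWord_of_collecting {e : S.E} {p : List S.E} (he : S.IsCollecting (S.tgt e)) :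
    S.backWord (p ++ [e]) = (p ++ [e]).flatMap S.inLabel := by
  rw [backWord_concat, List.flatMap_append, List.flatMap_singleton, inLabel_of_collecting he]

lemma backWord_of_distributing {e : S.E} {p : List S.E} (he : S.IsDistributing (S.tgt e)) :
    S.backWord (p ++ [e]) = (p ++ [e]).flatMap S.inLabel ++ S.back e := by
  rw [backWord_concat, List.flatMap_append, List.flatMap_singleton, inLabel_of_distributing he,
    List.append_nil]

/-- The words of the edges of a symmetric path are factors of its word. -/
lemma edge_words_infix (hG : ∀ x, S.IsDistributing x ∨ S.IsCollecting x)
    (hS : ∀ p, S.IsSymmetric p → S.frontWord p = S.backWord p) {s : List S.E}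
    (hs : S.IsSymmetric s) {e : S.E} (he : e ∈ s) :
    S.front e <:+: S.frontWord s ∧ S.back e <:+: S.frontWord s := by
  obtain ⟨a, b, rfl⟩ := List.append_of_mem he
  constructor
  · rcases hG (S.src e) with hd | hc
    · have ha : a ≠ [] := by
        rintro rfl
        exact hd.not_isCollecting (by simpa using hs.2.1)
      rw [frontWord_append ha, List.flatMap_cons, outLabel_of_distributing hd,
        ← List.append_assoc]
      exact List.infix_append _ _ _
    · have hsym : S.IsSymmetric (e :: b) :=
        ⟨hs.1.of_infix (List.suffix_append _ _).isInfix (by simp), by simpa using hc,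
          (endsIn_append (by simp)).1 hs.2.2⟩
      rw [hS _ hs, backWord_append _ (by simp), ← hS _ hsym, frontWord_cons, ← List.append_assoc]
      exact List.infix_append _ _ _
  · rcases hG (S.tgt e) with hd | hc
    · have hdec : a ++ e :: b = a ++ [e] ++ b := by simp
      have hsym : S.IsSymmetric (a ++ [e]) :=
        ⟨hs.1.of_infix (by rw [hdec]; exact (List.prefix_append _ _).isInfix) (by simp), by
          rw [hdec] at hs
          exact (startsIn_append (by simp)).1 hs.2.1, endsIn_concat.2 hd⟩
      rw [hdec, frontWord_append (by simp), hS _ hsym, backWord_concat]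
      exact List.infix_append _ _ _
    · have hb : b ≠ [] := by
        rintro rfl
        exact hc.not_isDistributing (endsIn_concat.1 hs.2.2)
      have hdec : a ++ e :: b = a ++ [e] ++ b := by simp
      rw [hS _ hs, hdec, backWord_append _ hb, List.flatMap_append, List.flatMap_singleton,
        inLabel_of_collecting hc]
      exact List.infix_append _ _ _

end General

variable {A : Type w} {S : WordGraph.{u, w} A} {W : ℕ → A} {v : S.E} {hv : S.IsSupporting v}

lemma evolved_front (e : (S.evolved W v hv).E) : (S.evolved W v hv).front e =
    (S.split v hv).frontWord (expansion ((S.evolved W v hv).rightExtension [e])) := rfl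

lemma evolved_back (e : (S.evolved W v hv).E) : (S.evolved W v hv).back e =
    (S.split v hv).backWord (expansion ((S.evolved W v hv).leftExtension [e])) := rfl

lemma flatMap_expansion {β : Type*} (f : (S.split v hv).E → List β)
    (s : List (S.evolved W v hv).E) :
    (expansion s).flatMap f = s.flatMap fun e => (edgePath e).flatMap f := by
  rw [expansion, List.flatMap_assoc]

namespace IsRauzyScheme

variable (hS : S.IsRauzyScheme W)
include hS

lemma split_front_letters {g : (S.split v hv).E}
    (hg : (S.split v hv).IsDistributing ((S.split v hv).src g)) :
    (S.split v hv).front g ≠ [] ∧ ∀ h, (S.split v hv).src h = (S.split v hv).src g → h ≠ g →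
      ((S.split v hv).front h).head? ≠ ((S.split v hv).front g).head? := by
  rcases split_edge_cases hv g with ⟨e, rfl⟩ | ⟨x, y, rfl⟩
  · have hne : ∀ e : {e : S.E // e ≠ v}, (S.split v hv).IsDistributing
        ((S.split v hv).src (oldEdge hv e)) → S.src e.1 ≠ S.tgt v := by
      intro e he h
      rw [split_src_old_pos hv h] at he
      exact he.not_isCollecting (split_isCollecting_out hv _)
    have hfront : ∀ e : {e : S.E // e ≠ v}, (S.split v hv).IsDistributing
        ((S.split v hv).src (oldEdge hv e)) → (S.split v hv).front (oldEdge hv e) = S.front e.1 :=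
      fun e he => if_neg (hne e he)
    have hd : S.IsDistributing (S.src e.1) := (hS.vertex _).resolve_right fun hc => by
      rw [split_src_old_neg hv (hne e hg)] at hg
      exact hg.not_isCollecting (split_isCollecting_old hv hc)
    refine ⟨by rw [hfront e hg]; exact (hS.front_letters _ hd).1, fun h hh hhe => ?_⟩
    rw [split_src_old_neg hv (hne e hg)] at hh
    rcases split_edge_cases hv h with ⟨f, rfl⟩ | ⟨x, y, rfl⟩
    · rw [hfront e hg, hfront f (by rw [hh, ← split_src_old_neg hv (hne e hg)]; exact hg)]
      exact (hS.front_letters _ hd).2 f.1 ((split_src_old_eq_old hv).1 hh)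
        fun h => hhe (congrArg _ (Subtype.ext h))
    · exact (oldVertex_ne_inVertex hv hh.symm).elim
  · have hd : S.IsDistributing (S.src y.1) := by rw [y.2]; exact hv.2
    refine ⟨(hS.front_letters _ hd).1, fun h hh hhe => ?_⟩
    rcases split_edge_cases hv h with ⟨f, rfl⟩ | ⟨x', y', rfl⟩
    · exact (split_src_old_ne_in hv hh).elim
    · have hx : x' = x := inVertex_injective hv hh
      exact (hS.front_letters _ hd).2 y'.1 (y'.2.trans y.2.symm)
        fun h => hhe ((newEdge_inj hv).2 ⟨hx, Subtype.ext h⟩)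

lemma split_back_letters {g : (S.split v hv).E}
    (hg : (S.split v hv).IsCollecting ((S.split v hv).tgt g)) :
    (S.split v hv).back g ≠ [] ∧ ∀ h, (S.split v hv).tgt h = (S.split v hv).tgt g → h ≠ g →
      ((S.split v hv).back h).getLast? ≠ ((S.split v hv).back g).getLast? := by
  rcases split_edge_cases hv g with ⟨e, rfl⟩ | ⟨x, y, rfl⟩
  · have hne : ∀ e : {e : S.E // e ≠ v}, (S.split v hv).IsCollecting
        ((S.split v hv).tgt (oldEdge hv e)) → S.tgt e.1 ≠ S.src v := by
      intro e he h
      rw [split_tgt_old_pos hv h] at he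
      exact he.not_isDistributing (split_isDistributing_in hv _)
    have hback : ∀ e : {e : S.E // e ≠ v}, (S.split v hv).IsCollecting
        ((S.split v hv).tgt (oldEdge hv e)) → (S.split v hv).back (oldEdge hv e) = S.back e.1 :=
      fun e he => if_neg (hne e he)
    have hd : S.IsCollecting (S.tgt e.1) := (hS.vertex _).resolve_left fun hc => by
      rw [split_tgt_old_neg hv (hne e hg)] at hg
      exact hg.not_isDistributing (split_isDistributing_old hv hc)
    refine ⟨by rw [hback e hg]; exact (hS.back_letters _ hd).1, fun h hh hhe => ?_⟩
    rw [split_tgt_old_neg hv (hne e hg)] at hh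
    rcases split_edge_cases hv h with ⟨f, rfl⟩ | ⟨x, y, rfl⟩
    · rw [hback e hg, hback f (by rw [hh, ← split_tgt_old_neg hv (hne e hg)]; exact hg)]
      exact (hS.back_letters _ hd).2 f.1 ((split_tgt_old_eq_old hv).1 hh)
        fun h => hhe (congrArg _ (Subtype.ext h))
    · exact (oldVertex_ne_outVertex hv hh.symm).elim
  · have hd : S.IsCollecting (S.tgt x.1) := by rw [x.2]; exact hv.1
    refine ⟨(hS.back_letters _ hd).1, fun h hh hhe => ?_⟩
    rcases split_edge_cases hv h with ⟨f, rfl⟩ | ⟨x', y', rfl⟩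
    · exact (split_tgt_old_ne_out hv hh).elim
    · have hy : y' = y := outVertex_injective hv hh
      exact (hS.back_letters _ hd).2 x'.1 (x'.2.trans x.2.symm)
        fun h => hhe ((newEdge_inj hv).2 ⟨Subtype.ext h, hy⟩)

variable (hW : IsRecurrentWord W)
include hW

lemma expansion_isSymmetric {s : List (S.evolved W v hv).E}
    (hs : (S.evolved W v hv).IsSymmetric s) :
    (S.split v hv).IsSymmetric (expansion s) := by
  refine ⟨isPath_expansion hs.1, ?_, ?_⟩
  · obtain ⟨e, s, rfl⟩ := List.exists_cons_of_ne_nil hs.1.1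
    refine ⟨_, expansion_head? e s, ?_⟩
    rw [← evolvedVal_src]
    exact (hS.evolved_isCollecting_iff hW).1 (by simpa using hs.2.1)
  · rcases List.eq_nil_or_concat' s with rfl | ⟨s, e, rfl⟩
    · exact (hs.1.1 rfl).elim
    refine ⟨_, expansion_getLast? s e, ?_⟩
    rw [← evolvedVal_tgt]
    exact (hS.evolved_isDistributing_iff hW).1 (endsIn_concat.1 hs.2.2)

lemma src_edgeHead_distributing {e : (S.evolved W v hv).E} :
    (S.split v hv).IsDistributing ((S.split v hv).src (edgeHead e)) ↔
      (S.evolved W v hv).IsDistributing ((S.evolved W v hv).src e) := by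
  rw [hS.evolved_isDistributing_iff hW, evolvedVal_src]

lemma src_edgeHead_collecting {e : (S.evolved W v hv).E} :
    (S.split v hv).IsCollecting ((S.split v hv).src (edgeHead e)) ↔
      (S.evolved W v hv).IsCollecting ((S.evolved W v hv).src e) := by
  rw [hS.evolved_isCollecting_iff hW, evolvedVal_src]

lemma tgt_edgeLast_distributing {e : (S.evolved W v hv).E} :
    (S.split v hv).IsDistributing ((S.split v hv).tgt (edgeLast e)) ↔
      (S.evolved W v hv).IsDistributing ((S.evolved W v hv).tgt e) := by
  rw [hS.evolved_isDistributing_iff hW, evolvedVal_tgt]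

lemma tgt_edgeLast_collecting {e : (S.evolved W v hv).E} :
    (S.split v hv).IsCollecting ((S.split v hv).tgt (edgeLast e)) ↔
      (S.evolved W v hv).IsCollecting ((S.evolved W v hv).tgt e) := by
  rw [hS.evolved_isCollecting_iff hW, evolvedVal_tgt]

variable (hper : ¬ S.RevealsPeriodicity W v hv)
include hper

/-- The front word of a symmetric path of `S''` is that of the corresponding path of `S'`. The part
of a path of `S'` that belongs to an edge leaving a collecting vertex is read, in `S''`, at the edge
that leaves the distributing vertex before it. -/
lemma evolved_frontWord {s : List (S.evolved W v hv).E} (hs : (S.evolved W v hv).IsSymmetric s) :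
    (S.evolved W v hv).frontWord s = (S.split v hv).frontWord (expansion s) := by
  classical
  obtain ⟨⟨d, hd⟩, -⟩ := hS.evolved_exists_vertices hW hper
  have hvert := hS.evolved_vertex hW (hv := hv)
  choose k hk using exists_isRightTail hvert (hS.evolved_stronglyConnected hW) hd
  have hfront : ∀ e, (S.evolved W v hv).front e =
      (S.split v hv).frontWord (expansion (e :: k e)) := fun e => by
    rw [evolved_front, (hk e).rightExtension_eq]
  have hknil : ∀ e, (S.evolved W v hv).IsDistributing ((S.evolved W v hv).tgt e) → k e = [] :=
    fun e he => List.prefix_nil.1 ((hk e).prefix (k' := []) ⟨by simp, by simp⟩ ⟨e, rfl, he⟩)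
  have hkcons : ∀ e f, (S.evolved W v hv).tgt e = (S.evolved W v hv).src f →
      (S.evolved W v hv).IsCollecting ((S.evolved W v hv).src f) → k e = f :: k f := by
    intro e f hef hf
    have h1 : (S.evolved W v hv).IsRightTail e (f :: k f) := by
      refine ⟨⟨by simp, List.isChain_cons_cons.2 ⟨hef, (hk f).1.2⟩⟩, ?_,
        (endsIn_append (p := [e]) (by simp)).2 (hk f).2.2⟩
      simpa [hf] using (hk f).2.1
    have h2 := (hk e).rightExtension_eq
    rw [h1.rightExtension_eq] at h2
    simpa using h2.symm
  -- `i` carries the word of the natural extension of an edge that leaves a collecting vertex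
  set i : (S.evolved W v hv).E → List A := fun e =>
    if (S.evolved W v hv).IsCollecting ((S.evolved W v hv).src e) then
      (expansion (e :: k e)).flatMap (S.split v hv).outLabel else [] with hi
  have tele := @List.IsChain.flatMap_telescope _ _
    (fun e f => (S.evolved W v hv).tgt e = (S.evolved W v hv).src f)
    (fun e => (edgePath e).flatMap (S.split v hv).outLabel) (S.evolved W v hv).outLabel i
    (fun e => (expansion (k e)).flatMap (S.split v hv).outLabel)
    (by
      intro e
      rcases hvert ((S.evolved W v hv).src e) with he | he
      · have h1 := (hS.src_edgeHead_distributing hW).2 he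
        rw [hi]
        simp only [if_neg he.not_isCollecting, outLabel_of_distributing he, List.nil_append,
          hfront, expansion_cons]
        rw [edgePath_eq_cons e, List.cons_append, frontWord_of_distributing h1,
          ← List.cons_append, List.flatMap_append]
      · rw [hi]
        simp only [if_pos he, outLabel_of_collecting he, List.append_nil, expansion_cons]
        rw [List.flatMap_append])
    (by
      intro e f hef
      rcases hvert ((S.evolved W v hv).src f) with hf | hf
      · rw [hi]
        simp [if_neg hf.not_isCollecting, hknil e (by rw [hef]; exact hf)]
      · rw [hi]
        simp only [if_pos hf, hkcons e f hef hf])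
  obtain ⟨e, s, rfl⟩ := List.exists_cons_of_ne_nil hs.1.1
  have hc : (S.evolved W v hv).IsCollecting ((S.evolved W v hv).src e) := by simpa using hs.2.1
  have hlast : (S.evolved W v hv).IsDistributing
      ((S.evolved W v hv).tgt ((e :: s).getLast (List.cons_ne_nil e s))) := by
    obtain ⟨f, hf, hf'⟩ := hs.2.2
    rw [List.getLast?_eq_some_getLast (List.cons_ne_nil e s), Option.some.injEq] at hf
    rw [hf]
    exact hf'
  have h1 := tele hs.1.2
  rw [hknil _ hlast, expansion_nil, List.flatMap_nil, List.append_nil,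
    List.flatMap_cons (f := (S.evolved W v hv).outLabel), outLabel_of_collecting hc,
    List.nil_append, ← flatMap_expansion] at h1
  have hic : i e = (expansion (e :: k e)).flatMap (S.split v hv).outLabel := if_pos hc
  have h2 := (hS.src_edgeHead_collecting hW).2 hc
  have hword : ∀ t : List (S.evolved W v hv).E, (S.split v hv).frontWord (expansion (e :: t)) =
      (S.split v hv).front (edgeHead e) ++
        (expansion (e :: t)).flatMap (S.split v hv).outLabel := by
    intro t
    rw [expansion_cons, edgePath_eq_cons e, List.cons_append, frontWord_of_collecting h2]
  rw [frontWord_cons, hfront, hword, hword, ← h1, hic, List.append_assoc]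

/-- The back word of a symmetric path of `S''` is that of the corresponding path of `S'`. -/
lemma evolved_backWord {s : List (S.evolved W v hv).E} (hs : (S.evolved W v hv).IsSymmetric s) :
    (S.evolved W v hv).backWord s = (S.split v hv).backWord (expansion s) := by
  classical
  obtain ⟨-, c, hc⟩ := hS.evolved_exists_vertices hW hper
  have hvert := hS.evolved_vertex hW (hv := hv)
  choose l hl using exists_isLeftTail hvert (hS.evolved_stronglyConnected hW) hc
  have hback : ∀ e, (S.evolved W v hv).back e =
      (S.split v hv).backWord (expansion (l e ++ [e])) := fun e => by
    rw [evolved_back, (hl e).leftExtension_eq]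
  have hlnil : ∀ e, (S.evolved W v hv).IsCollecting ((S.evolved W v hv).src e) → l e = [] :=
    fun e he => List.suffix_nil.1 ((hl e).suffix (l' := []) ⟨by simp, by simp⟩ ⟨e, rfl, he⟩)
  have hlconcat : ∀ e f, (S.evolved W v hv).tgt e = (S.evolved W v hv).src f →
      (S.evolved W v hv).IsDistributing ((S.evolved W v hv).tgt e) → l f = l e ++ [e] := by
    intro e f hef he
    have h1 : (S.evolved W v hv).IsLeftTail f (l e ++ [e]) := by
      refine ⟨⟨by simp, ?_⟩, ?_, (startsIn_append (by simp)).2 (hl e).2.2⟩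
      · rw [List.isChain_append]
        exact ⟨(hl e).1.2, by simp, by simpa using hef⟩
      · intro g hg
        rcases List.mem_append.1 hg with hg | hg
        · exact (hl e).2.1 g hg
        · rw [List.mem_singleton.1 hg]
          exact he
    have h2 := (hl f).leftExtension_eq
    rw [h1.leftExtension_eq] at h2
    exact (List.append_inj' h2 rfl).1.symm
  -- `o` carries the word of the natural extension of an edge that enters a distributing vertex
  set o : (S.evolved W v hv).E → List A := fun e =>
    if (S.evolved W v hv).IsDistributing ((S.evolved W v hv).tgt e) then
      (expansion (l e ++ [e])).flatMap (S.split v hv).inLabel else [] with ho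
  have tele := @List.IsChain.flatMap_telescope _ _
    (fun e f => (S.evolved W v hv).tgt e = (S.evolved W v hv).src f)
    (S.evolved W v hv).inLabel (fun e => (edgePath e).flatMap (S.split v hv).inLabel)
    (fun e => (expansion (l e)).flatMap (S.split v hv).inLabel) o
    (by
      intro e
      rcases hvert ((S.evolved W v hv).tgt e) with he | he
      · rw [ho]
        simp only [if_pos he, inLabel_of_distributing he, List.nil_append, expansion_append,
          expansion_cons, expansion_nil, List.append_nil]
        rw [List.flatMap_append]
      · have h1 := (hS.tgt_edgeLast_collecting hW).2 he
        rw [ho]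
        simp only [if_neg he.not_isDistributing, inLabel_of_collecting he, List.append_nil,
          hback, expansion_append, expansion_cons, expansion_nil]
        rw [edgePath_eq_concat e, ← List.append_assoc, backWord_of_collecting h1]
        simp only [List.flatMap_append, List.append_assoc])
    (by
      intro e f hef
      rcases hvert ((S.evolved W v hv).tgt e) with he | he
      · rw [ho]
        simp only [if_pos he, hlconcat e f hef he]
      · rw [ho]
        simp [if_neg he.not_isDistributing, hlnil f (by rw [← hef]; exact he)])
  have hne := hs.1.1
  obtain ⟨e₀, s₀, hs₀⟩ := List.exists_cons_of_ne_nil hne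
  have hc₀ : (S.evolved W v hv).IsCollecting ((S.evolved W v hv).src e₀) := by
    simpa [hs₀] using hs.2.1
  have hchain := hs.1.2
  rw [hs₀] at hchain
  have h1 := tele hchain
  rw [hlnil _ hc₀, expansion_nil, List.flatMap_nil, List.nil_append, ← flatMap_expansion] at h1
  simp only [← hs₀] at h1
  rcases List.eq_nil_or_concat' s with rfl | ⟨s, e, rfl⟩
  · exact (hne rfl).elim
  have hd : (S.evolved W v hv).IsDistributing ((S.evolved W v hv).tgt e) := endsIn_concat.1 hs.2.2
  rw [List.flatMap_append (f := (S.evolved W v hv).inLabel), List.flatMap_singleton,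
    inLabel_of_distributing hd, List.append_nil, List.getLast_append_of_ne_nil _ (by simp),
    List.getLast_singleton] at h1
  have hoe : o e = (expansion (l e ++ [e])).flatMap (S.split v hv).inLabel := if_pos hd
  have h2 := (hS.tgt_edgeLast_distributing hW).2 hd
  have hword : ∀ t : List (S.evolved W v hv).E, (S.split v hv).backWord (expansion (t ++ [e])) =
      (expansion (t ++ [e])).flatMap (S.split v hv).inLabel ++
        (S.split v hv).back (edgeLast e) := by
    intro t
    rw [expansion_append, expansion_cons, expansion_nil, List.append_nil, edgePath_eq_concat e,
      ← List.append_assoc, backWord_of_distributing h2]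
  rw [backWord_concat, hback, hword, hword, h1, hoe, List.append_assoc]

lemma evolved_frontWord_unsplit {s : List (S.evolved W v hv).E}
    (hs : (S.evolved W v hv).IsSymmetric s) :
    (S.evolved W v hv).frontWord s = S.frontWord (unsplit hv (expansion s)) := by
  rw [hS.evolved_frontWord hW hper hs,
    split_frontWord hv hS.vertex (hS.expansion_isSymmetric hW hs)]

lemma evolved_front_eq_back {s : List (S.evolved W v hv).E}
    (hs : (S.evolved W v hv).IsSymmetric s) :
    (S.evolved W v hv).frontWord s = (S.evolved W v hv).backWord s := by
  have hsym := hS.expansion_isSymmetric hW hs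
  rw [hS.evolved_frontWord_unsplit hW hper hs, hS.evolved_backWord hW hper hs,
    split_backWord hv hS.vertex (hS.front_eq_back_of_isSupporting hv) hsym]
  exact hS.front_eq_back _ (unsplit_isSymmetric hv hS.vertex hsym)

omit hW hper in
/-- The path of `S''` is recovered from the corresponding path of `S'` by the edges that leave
non-vanishing vertices, so occurrences of the latter give occurrences of the former. -/
lemma occCount_expansion_le (s t : List (S.evolved W v hv).E) (hs : s ≠ []) :
    occCount (expansion s) (expansion t) ≤ occCount s t := by
  classical
  set P : (S.split v hv).E → Bool := fun g => decide (S.NonVanishing W v hv ((S.split v hv).src g))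
    with hP
  have hfilter : ∀ s : List (S.evolved W v hv).E,
      (expansion s).filter P = s.map edgeHead := by
    intro s
    induction s with
    | nil => rfl
    | cons e s ih =>
      rw [expansion_cons, List.filter_append, ih, List.map_cons, edgePath_eq_cons e,
        List.filter_cons_of_pos (by simpa [hP] using nonVanishing_src_edgeHead e),
        List.filter_eq_nil_iff.2 (by
          intro g hg
          simpa [hP] using not_nonVanishing_src hg)]
      rfl
  -- an occurrence of the expansion is shifted to the number of edges of `t` that begin before it
  refine occCount_le_of_map (fun n => (((expansion t).take n).filter P).length) ?_ ?_
  · intro p r h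
    have h1 := hfilter t
    rw [h, List.filter_append, List.filter_append, hfilter s, eq_comm, List.map_eq_append_iff]
      at h1
    obtain ⟨q, r', rfl, hq, -⟩ := h1
    rw [List.map_eq_append_iff] at hq
    obtain ⟨p', s', rfl, hp', hs'⟩ := hq
    have := (List.map_injective_iff.2 (edgeHead_injective hS.vertex)) hs'
    subst this
    refine ⟨p', r', rfl, ?_⟩
    have h2 : (expansion (p' ++ s' ++ r')).take p.length = p := by
      rw [h, List.append_assoc, List.take_left']
      rfl
    rw [h2, ← hp', List.length_map]
  · have key : ∀ p q r u, expansion t = p ++ expansion s ++ r →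
        expansion t = q ++ expansion s ++ u → p.length < q.length → (((expansion t).take p.length).filter P).length <
          (((expansion t).take q.length).filter P).length := by
      intro p q r u h h' hlt
      obtain ⟨e, s, rfl⟩ := List.exists_cons_of_ne_nil hs
      have h2 : (expansion t).take p.length = p := by
        rw [h, List.append_assoc, List.take_left']
        rfl
      have h3 : (expansion t).take q.length = q := by
        rw [h', List.append_assoc, List.take_left']
        rfl
      have hpre : p ++ [edgeHead e] <+: q := by
        refine List.prefix_of_prefix_length_le (l₃ := expansion t) ?_ ?_ ?_
        · rw [h, expansion_cons, edgePath_eq_cons e]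
          exact ⟨(edgePath e).tail ++ expansion s ++ r, by simp⟩
        · rw [h', List.append_assoc]
          exact List.prefix_append _ _
        · simpa using hlt
      obtain ⟨z, rfl⟩ := hpre
      rw [h2, h3, List.filter_append, List.filter_append,
        List.filter_cons_of_pos (by simpa [hP] using nonVanishing_src_edgeHead e)]
      simp
    intro p q r u h h' heq
    rcases lt_trichotomy p.length q.length with hlt | h0 | hlt
    · exact absurd heq (key p q r u h h' hlt).ne
    · exact h0
    · exact absurd heq (key q p u r h' h hlt).ne'

/-- Every factor of `W` is read along a symmetric path of `S''` whose word is a factor of `W`. -/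
lemma evolved_covers {x : List A} (hx : IsFactor W x) : ∃ s, (S.evolved W v hv).IsSymmetric s ∧
    IsFactor W ((S.evolved W v hv).frontWord s) ∧ x <:+: (S.evolved W v hv).frontWord s := by
  obtain ⟨⟨d, hd⟩, c, hc⟩ := hS.evolved_exists_vertices hW hper
  have hd' := (hS.evolved_isDistributing_iff hW).1 hd
  have hc' := (hS.evolved_isCollecting_iff hW).1 hc
  obtain ⟨g, hg⟩ := hc'.2.exists
  obtain ⟨e, rfl⟩ := exists_old_of_src_collecting hv (by rw [hg]; exact hc')
  obtain ⟨h, hh⟩ := hd'.1.exists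
  obtain ⟨f, rfl⟩ := exists_old_of_tgt_distributing hv (by rw [hh]; exact hd')
  obtain ⟨p, hp, hpg, hpw⟩ := hS.exists_good_link hv hW e f hx
  obtain ⟨s, hs, hsp⟩ := exists_expansion hp hpg
    (by simpa [hg] using nonVanishing_evolvedVal c)
    (by
      rw [List.getLast_append_of_ne_nil _ (by simp), List.getLast_singleton, hh]
      exact nonVanishing_evolvedVal d)
  have hsym : (S.evolved W v hv).IsSymmetric s := by
    refine ⟨hs, ?_, ?_⟩
    · obtain ⟨e', s, rfl⟩ := List.exists_cons_of_ne_nil hs.1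
      have h1 := expansion_head? e' s
      rw [hsp] at h1
      simp only [List.cons_append, List.head?_cons, Option.some.injEq] at h1
      rw [startsIn_cons, ← hS.src_edgeHead_collecting hW, ← h1, hg]
      exact hc'
    · rcases List.eq_nil_or_concat' s with rfl | ⟨s, e', rfl⟩
      · exact (hs.1 rfl).elim
      have h1 := expansion_getLast? s e'
      rw [hsp, List.getLast?_concat, Option.some.injEq] at h1
      rw [endsIn_concat, ← hS.tgt_edgeLast_distributing hW, ← h1, hh]
      exact hd'
  have hw := hS.evolved_frontWord hW hper hsym
  rw [hsp] at hw
  have := hpw (hsp ▸ hS.expansion_isSymmetric hW hsym)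
  rw [← hw] at this
  exact ⟨s, hsym, this⟩

lemma evolved_forces (e : (S.evolved W v hv).E) : ∃ x, IsFactor W x ∧
    ∀ s, (S.evolved W v hv).IsSymmetric s → x <:+: (S.evolved W v hv).frontWord s → e ∈ s := by
  have hmem : edgeHead e ∈ edgePath e := by
    rw [edgePath_eq_cons e]
    simp
  obtain ⟨x, hx, hforce⟩ := hS.exists_forcing hv (isGood_of_mem_edgePath hmem)
  refine ⟨x, hx, fun s hs hxs => ?_⟩
  rw [hS.evolved_frontWord hW hper hs] at hxs
  have h1 := hforce _ (hS.expansion_isSymmetric hW hs) hxs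
  obtain ⟨f, hf, hef⟩ := List.mem_flatMap.1 h1
  rw [edgePath_eq_cons f] at hef
  rcases List.mem_cons.1 hef with h | h
  · rw [edgeHead_injective hS.vertex h]
    exact hf
  · exact (not_nonVanishing_src h (nonVanishing_src_edgeHead e)).elim

/-- The elementary evolution of a Rauzy scheme of a recurrent word is a Rauzy scheme again, unless it
reveals periodicity. -/
theorem evolved_isRauzyScheme : (S.evolved W v hv).IsRauzyScheme W := by
  have hvert := hS.evolved_vertex hW (hv := hv)
  -- an edge forced by a factor lies on a symmetric path whose word is a factor
  have hedge : ∀ e : (S.evolved W v hv).E, IsFactor W ((S.evolved W v hv).front e) ∧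
      IsFactor W ((S.evolved W v hv).back e) := by
    intro e
    obtain ⟨x, hx, hforce⟩ := hS.evolved_forces hW hper e
    obtain ⟨s, hs, hsf, hxs⟩ := hS.evolved_covers hW hper hx
    have := edge_words_infix hvert (fun p hp => hS.evolved_front_eq_back hW hper hp) hs
      (hforce s hs hxs)
    exact ⟨hsf.of_infix this.1, hsf.of_infix this.2⟩
  obtain ⟨⟨d, hd⟩, c, hc⟩ := hS.evolved_exists_vertices hW hper
  refine
    { finite_V := hS.evolved_finite.1
      finite_E := hS.evolved_finite.2
      stronglyConnected := hS.evolved_stronglyConnected hW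
      vertex := hvert
      nontrivial_E := ?_
      front_letters := ?_
      back_letters := ?_
      front_eq_back := fun p hp => hS.evolved_front_eq_back hW hper hp
      occurs := ?_
      front_factor := fun e => (hedge e).1
      back_factor := fun e => (hedge e).2
      covers := ?_
      forces := hS.evolved_forces hW hper }
  · obtain ⟨-, e, f, hef, -, -⟩ := hd
    exact ⟨e, f, hef⟩
  · have hword : ∀ e : (S.evolved W v hv).E, ∃ y, (S.evolved W v hv).front e =
        (S.split v hv).front (edgeHead e) ++ y := by
      intro e
      obtain ⟨k, hk⟩ := exists_isRightTail hvert (hS.evolved_stronglyConnected hW) hd e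
      rw [evolved_front, hk.rightExtension_eq, expansion_cons, edgePath_eq_cons e,
        List.cons_append, frontWord_cons]
      exact ⟨_, rfl⟩
    intro e he
    have hl := hS.split_front_letters ((hS.src_edgeHead_distributing hW).2 he)
    obtain ⟨y, hy⟩ := hword e
    refine ⟨by simp [hy, hl.1], fun f hf hfe => ?_⟩
    obtain ⟨z, hz⟩ := hword f
    have hsrc : (S.split v hv).src (edgeHead f) = (S.split v hv).src (edgeHead e) := by
      rw [← evolvedVal_src, ← evolvedVal_src, hf]
    have hl' := hS.split_front_letters (g := edgeHead f)
      (by rw [hsrc]; exact (hS.src_edgeHead_distributing hW).2 he)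
    rw [hy, hz, List.head?_append_of_ne_nil _ hl.1, List.head?_append_of_ne_nil _ hl'.1]
    exact hl.2 _ hsrc fun h => hfe (edgeHead_injective hS.vertex h)
  · have hword : ∀ e : (S.evolved W v hv).E, ∃ y, (S.evolved W v hv).back e =
        y ++ (S.split v hv).back (edgeLast e) := by
      intro e
      obtain ⟨l, hl⟩ := exists_isLeftTail hvert (hS.evolved_stronglyConnected hW) hc e
      rw [evolved_back, hl.leftExtension_eq, expansion_append, expansion_cons, expansion_nil,
        List.append_nil, edgePath_eq_concat e, ← List.append_assoc, backWord_concat]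
      exact ⟨_, rfl⟩
    intro e he
    have hl := hS.split_back_letters ((hS.tgt_edgeLast_collecting hW).2 he)
    obtain ⟨y, hy⟩ := hword e
    refine ⟨by simp [hy, hl.1], fun f hf hfe => ?_⟩
    obtain ⟨z, hz⟩ := hword f
    have htgt : (S.split v hv).tgt (edgeLast f) = (S.split v hv).tgt (edgeLast e) := by
      rw [← evolvedVal_tgt, ← evolvedVal_tgt, hf]
    have hl' := hS.split_back_letters (g := edgeLast f)
      (by rw [htgt]; exact (hS.tgt_edgeLast_collecting hW).2 he)
    rw [hy, hz, List.getLast?_append_of_ne_nil _ hl.1, List.getLast?_append_of_ne_nil _ hl'.1]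
    exact hl.2 _ htgt fun h => hfe (edgeLast_injective hS.vertex h)
  · intro s t hs ht k hk
    have hs' := hS.expansion_isSymmetric hW hs
    have ht' := hS.expansion_isSymmetric hW ht
    rw [hS.evolved_frontWord_unsplit hW hper hs, hS.evolved_frontWord_unsplit hW hper ht] at hk
    have h1 := hS.occurs _ _ (unsplit_isSymmetric hv hS.vertex hs')
      (unsplit_isSymmetric hv hS.vertex ht') k hk
    refine le_trans h1 (le_trans ?_ (hS.occCount_expansion_le s t hs.1.1))
    -- positions in a path of `S` and in its lift differ by the copies of `v` before the two paths
    refine occCount_le_of_map (fun n => n + (splitPre hv ((expansion s).head hs'.1.1)).length -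
      (splitPre hv ((expansion t).head ht'.1.1)).length) ?_ ?_
    · intro p r h
      obtain ⟨a, b, hab, hlen⟩ := exists_of_unsplit hv hs' ht'.1 h
      exact ⟨a, b, hab, by omega⟩
    · intro p q r u h h' heq
      obtain ⟨a, b, -, hlen⟩ := exists_of_unsplit hv hs' ht'.1 h
      obtain ⟨a', b', -, hlen'⟩ := exists_of_unsplit hv hs' ht'.1 h'
      omega
  · intro x hx
    obtain ⟨s, hs, -, hxs⟩ := hS.evolved_covers hW hper hx
    exact ⟨s, hs, hxs⟩

end IsRauzyScheme

end WordGraph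

/-! ### Deterministic evolution -/

namespace IsInitialNumbering

variable {E : Type u} {num : E → ℕ}

lemma injective (h : IsInitialNumbering num) : Function.Injective num :=
  Set.injOn_univ.mp h.injOn

lemma le_card (h : IsInitialNumbering num) (e : E) : num e ≤ Nat.card E :=
  (h.mapsTo (Set.mem_univ e)).2

end IsInitialNumbering

namespace NumberedScheme

variable {A : Type w} {S T : NumberedScheme.{u, w} A} {W : ℕ → A} {M : EvolutionMethod.{u}}

lemma splitNum_injective (hnum : Function.Injective S.num) (v : S.E) (hv : S.IsSupporting v) :
    Function.Injective (S.splitNum v hv) := by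
  rintro (e | ⟨x, y⟩) (f | ⟨x', y'⟩) h
  · exact congrArg Sum.inl (Subtype.ext (hnum (Sum.inl_injective h)))
  · exact absurd h Sum.inl_ne_inr
  · exact absurd h Sum.inr_ne_inl
  · have h' := Prod.mk.inj (Sum.inr_injective h)
    rw [Subtype.ext (hnum h'.1), Subtype.ext (hnum h'.2)]

/-- The labels with double indices are pairwise distinct, because an edge of the evolved graph is
determined by the first edge of its path. -/
lemma evolvedLabelled_injective (hS : ∀ x, S.IsDistributing x ∨ S.IsCollecting x)
    (hnum : Function.Injective S.num) (v : S.E) (hv : S.IsSupporting v) :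
    Function.Injective (S.evolvedLabelled W v hv).num := fun _ _ h =>
  WordGraph.edgeHead_injective hS (splitNum_injective hnum v hv h)

lemma EvolStep.isRauzyScheme (h : EvolStep W M S T) (hW : IsRecurrentWord W)
    (hS : S.IsRauzyScheme W) (hnum : Function.Injective S.num) :
    T.IsRauzyScheme W ∧ IsInitialNumbering T.num := by
  obtain ⟨v, hv, -, hper, rfl⟩ := h
  have hT := hS.evolved_isRauzyScheme hW hper
  exact ⟨hT, M.isInitial _ hT.finite_V hT.finite_E
    (evolvedLabelled_injective hS.vertex hnum v hv)⟩

/-- Deterministic evolutions do not leave the class of Rauzy schemes numbered by `1, …, n`. -/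
lemma Arises.isRauzyScheme (h : T.Arises W M) (hW : IsRecurrentWord W) :
    T.IsRauzyScheme W ∧ IsInitialNumbering T.num := by
  obtain h | ⟨S, hS, hnum, h⟩ := h
  · exact h
  · induction h with
    | single h => exact h.isRauzyScheme hW hS hnum
    | tail _ h ih => exact h.isRauzyScheme hW ih.1 ih.2.injective

end NumberedScheme

/-! ### Counting numbered graphs -/

namespace LabelledGraph

/-- A graph with pairwise distinct labels, and with an edge leaving every vertex, is determined by
the set of the triples (label, beginning, end) of its edges. -/
lemma iso_of_range_eq {L : Type} {G H : LabelledGraph.{u} L} {ι : Type*} {a : G.V → ι} {b : H.V → ι}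
    (ha : Function.Injective a) (hb : Function.Injective b) (hG : Function.Injective G.num)
    (hH : Function.Injective H.num) (hGs : Function.Surjective G.src)
    (hHs : Function.Surjective H.src)
    (h : Set.range (fun e => (G.num e, a (G.src e), a (G.tgt e))) =
      Set.range fun e => (H.num e, b (H.src e), b (H.tgt e))) : G.Iso H := by
  have hGi : Function.Injective fun e => (G.num e, a (G.src e), a (G.tgt e)) :=
    fun _ _ h => hG (Prod.mk.inj h).1
  have hHi : Function.Injective fun e => (H.num e, b (H.src e), b (H.tgt e)) :=
    fun _ _ h => hH (Prod.mk.inj h).1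
  let g : G.E ≃ H.E :=
    (Equiv.ofInjective _ hGi).trans ((Equiv.setCongr h).trans (Equiv.ofInjective _ hHi).symm)
  have hg : ∀ e, (H.num (g e), b (H.src (g e)), b (H.tgt (g e))) =
      (G.num e, a (G.src e), a (G.tgt e)) := fun e =>
    congrArg Subtype.val ((Equiv.ofInjective _ hHi).apply_symm_apply
      (Equiv.setCongr h (Equiv.ofInjective _ hGi e)))
  simp only [Prod.mk.injEq] at hg
  have hV : Set.range a = Set.range b := by
    rw [← hGs.range_comp a, ← hHs.range_comp b, ← g.surjective.range_comp (b ∘ H.src)]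
    exact congrArg Set.range (funext fun e => (hg e).2.1.symm)
  let f : G.V ≃ H.V :=
    (Equiv.ofInjective a ha).trans ((Equiv.setCongr hV).trans (Equiv.ofInjective b hb).symm)
  have hf : ∀ x, b (f x) = a x := fun x =>
    congrArg Subtype.val ((Equiv.ofInjective b hb).apply_symm_apply
      (Equiv.setCongr hV (Equiv.ofInjective a ha x)))
  exact ⟨f, g, fun e => ⟨hb ((hg e).2.1.trans (hf _).symm), hb ((hg e).2.2.trans (hf _).symm),
    (hg e).1⟩⟩

/-- Up to isomorphism, there are at most `2 ^ ((N + 1) * (N * N))` graphs with at most `N` vertices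
and at most `N` edges that are numbered by `1, …, n`. -/
lemma ncard_le {N : ℕ} {Q : Set (Quotient (isoSetoid.{u} ℕ))}
    (hQ : ∀ X ∈ Q, ∃ G : LabelledGraph.{u} ℕ, X = Quotient.mk _ G ∧ Finite G.V ∧
      Nat.card G.V ≤ N ∧ Nat.card G.E ≤ N ∧ IsInitialNumbering G.num ∧
      Function.Surjective G.src) :
    Q.Finite ∧ Q.ncard ≤ 2 ^ ((N + 1) * (N * N)) := by
  replace hQ := fun X : Q => hQ X X.2
  choose G hX hfin hV hE hnum hsrc using hQ
  have hemb : ∀ X, ∃ a : (G X).V → Fin N, Function.Injective a := fun X =>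
    ⟨_, (Fin.castLE_injective (hV X)).comp (Finite.equivFin (G X).V).injective⟩
  choose a ha using hemb
  -- the class of `G X` is coded by the triples of the edges, with the vertices numbered by `a X`
  let R : Q → Set (ℕ × Fin N × Fin N) := fun X =>
    Set.range fun e => ((G X).num e, a X ((G X).src e), a X ((G X).tgt e))
  let code : Q → Set (Fin (N + 1) × Fin N × Fin N) := fun X => {z | (z.1.1, z.2) ∈ R X}
  have hsub : ∀ X Y : Q, code X = code Y → R X ⊆ R Y := by
    rintro X Y h _ ⟨e, rfl⟩
    have he : (G X).num e < N + 1 :=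
      Nat.lt_succ_of_le (((hnum X).le_card e).trans (hE X))
    have hmem : (⟨⟨_, he⟩, a X ((G X).src e), a X ((G X).tgt e)⟩ :
        Fin (N + 1) × Fin N × Fin N) ∈ code X := ⟨e, rfl⟩
    rw [h] at hmem
    exact hmem
  have hcode : Function.Injective code := fun X Y h => by
    refine Subtype.ext ((hX X).trans (Eq.trans (Quotient.sound ?_) (hX Y).symm))
    exact iso_of_range_eq (ha X) (ha Y) (hnum X).injective (hnum Y).injective
      (hsrc X) (hsrc Y) ((hsub X Y h).antisymm (hsub Y X h.symm))
  refine ⟨Finite.of_injective code hcode, ?_⟩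
  calc Q.ncard = Nat.card Q := (Nat.card_coe_set_eq Q).symm
    _ ≤ Nat.card (Set (Fin (N + 1) × Fin N × Fin N)) := Nat.card_le_card_of_injective _ hcode
    _ = 2 ^ ((N + 1) * (N * N)) := by
      simp [Nat.card_eq_fintype_card, Fintype.card_set]

end LabelledGraph

/-! ### Computability of the bounds -/

lemma Primrec.nat_pow : Primrec₂ ((· ^ ·) : ℕ → ℕ → ℕ) :=
  Primrec₂.unpaired'.1 Nat.Primrec.pow

/-- A bound for the numbers of vertices and edges of a Rauzy scheme of a word over `q` letters with
recurrence bound `C`. -/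
def schemeBound (q C : ℕ) : ℕ := (2 * q + 1) * (8 * C ^ 4 + 1) ^ 2

lemma primrec_schemeBound (q : ℕ) : Primrec (schemeBound q) :=
  Primrec.nat_mul.comp (Primrec.const _) (Primrec.nat_pow.comp
    (Primrec.nat_add.comp (Primrec.nat_mul.comp (Primrec.const 8)
      (Primrec.nat_pow.comp Primrec.id (Primrec.const 4))) (Primrec.const 1)) (Primrec.const 2))

lemma WordGraph.IsRauzyScheme.card_le_schemeBound {A : Type w} [Finite A] {W : ℕ → A} {C : ℕ}
    {S : WordGraph.{u, w} A} (hS : S.IsRauzyScheme W) (hC : IsRecurrenceBound W C) :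
    Nat.card S.V ≤ schemeBound (Nat.card A) C ∧ Nat.card S.E ≤ schemeBound (Nat.card A) C := by
  obtain ⟨hV, hE⟩ := hS.card_le hC
  exact ⟨hV.trans (Nat.mul_le_mul_right _ (by omega)), hE.trans (Nat.mul_le_mul_right _ (by omega))⟩

theorem mainTheorem8 (q : ℕ) :
    (∃ C₇ : ℕ → ℕ, Computable C₇ ∧
      ∀ (A : Type w) [Finite A], Nat.card A = q →
        ∀ (W : ℕ → A) (C : ℕ), IsRecurrenceBound W C →
          ∀ S : WordGraph.{u, w} A, S.IsRauzyScheme W → Nat.card S.V ≤ C₇ C) ∧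
    (∃ C_sch : ℕ → ℕ, Computable C_sch ∧
      ∀ (M : EvolutionMethod.{u}) (C : ℕ),
        (arisingLightSchemes.{u, w} q C M).Finite ∧
          (arisingLightSchemes.{u, w} q C M).ncard ≤ C_sch C) := by
  constructor
  · refine ⟨schemeBound q, (primrec_schemeBound q).to_comp, ?_⟩
    rintro A _ rfl W C hC S hS
    exact (hS.card_le_schemeBound hC).1
  · have hN := primrec_schemeBound q
    refine ⟨fun C => 2 ^ ((schemeBound q C + 1) * (schemeBound q C * schemeBound q C)),
      (Primrec.nat_pow.comp (Primrec.const 2) (Primrec.nat_mul.comp (Primrec.succ.comp hN)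
        (Primrec.nat_mul.comp hN hN))).to_comp, fun M C => LabelledGraph.ncard_le ?_⟩
    rintro _ ⟨A, _, W, T, rfl, hC, hT, rfl⟩
    obtain ⟨hS, hnum⟩ := hT.isRauzyScheme hC.isRecurrentWord
    obtain ⟨hV, hE⟩ := hS.card_le_schemeBound hC
    refine ⟨T.lighten, rfl, hS.finite_V, hV, hE, hnum, fun x => ?_⟩
    rcases hS.vertex x with h | h
    · exact h.2.imp fun e he => he.choose_spec.2.1
    · exact h.2.exists
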